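/- **Setting.** Let $\Omega\subset\mathbb R^2$ be a bounded open set, decomposed into finitely many non-overlapping simple polygons $E$: the elements $E\subset\Omega$ are open and pairwise disjoint, and their closures cover $\Omega$. Let $k\ge 1$ be an integer, $\varepsilon,\alpha_0,\alpha_1>0$, $\kappa(t)=\alpha_0\sinh(\alpha_1 t)$ and $g\in L^2(\Omega)$. Write $\|\cdot\|_\omega$ for the $L^2(\omega)$ norm, $P_m(E)$ for the polynomials of total degree at most $m$, and $\Pi^0_m$ for the $L^2(E)$-orthogonal projection onto $P_m(E)$ (componentwise on vector fields). Let $\Pi^\nabla_k\phi\in P_k(E)$ be determined by $\int_E\nabla(\phi-\Pi^\nabla_k\phi)\cdot\nabla m=0$ for all $m\in P_k(E)$ and $\int_{\partial E}(\phi-\Pi^\nabla_k\phi)\,ds=0$. The space $V^h_k(E)$ consists of the $\phi\in H^1(E)$ whose trace is continuous on $\partial E$ and a polynomial of degree at most $k$ on each edge, for which $\Delta\phi\in P_k(E)$, and for which $\phi-\Pi^\nabla_k\phi$ is $L^2(E)$-orthogonal to the scaled monomials $((x-x_E)/h_E)^\beta$ with $|\beta|\in\{k-1,k\}$, where $x_E$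 is the barycenter and $h_E$ the diameter of $E$. Put $$\Phi_{0,h}=\{\phi\in H^1_0(\Omega):\ \phi|_E\in V^h_k(E)\text{ for every element }E\},\qquad \mathbf V_h=\Phi_{0,h}\times\Phi_{0,h}.$$ For each element $E$ let $S^E$ be a symmetric positive definite bilinear form on $V^h_k(E)$ such that $$\lambda_*\|\nabla\phi\|_E^2\le S^E(\phi,\phi)\le\lambda^*\|\nabla\phi\|_E^2\qquad\text{for all }\phi\in V^h_k(E)\text{ with }\Pi^\nabla_k\phi=0,$$ with constants $0<\lambda_*\le\lambda^*$ that do not depend on $E$, and put $\gamma_*=\min\{1,\lambda_*\}$. For $\mathbf v\in\mathbf V_h$ and $\phi,\xi\in\Phi_{0,h}$ let $$\mathcal B_h(\mathbf v;\phi,\xi)=\sum_E\Big[\int_E\varepsilon\,\Pi^0_{k-1}\nabla\phi\cdot\Pi^0_{k-1}\nabla\xi+\varepsilon S^E(\phi-\Pi^\nabla_k\phi,\xi-\Pi^\nabla_k\xi)+\tfrac12\big(c^E(\mathbf v;\phi,\xi)-c^E(\mathbf v;\xi,\phi)\big)+\int_E\kappa(\Pi^0_k\phi)\,\Pi^0_k\xi\Big],$$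 $$c^E(\mathbf v;\phi,\xi)=\int_E\big(\Pi^0_k\mathbf v\cdot\Pi^0_{k-1}\nabla\phi\big)\,\Pi^0_k\xi .$$ Let $C_P$ be the Poincaré constant of $\Omega$, that is, the least $C\ge0$ with $\|\phi\|_\Omega\le C\|\nabla\phi\|_\Omega$ for all $\phi\in H^1_0(\Omega)$. **Theorem.** For every fixed $\mathbf u_h\in\mathbf V_h$ there is exactly one $\psi_h\in\Phi_{0,h}$ such that $$\mathcal B_h(\mathbf u_h;\psi_h,\xi_h)=\sum_E\int_E g\,\Pi^0_k\xi_h\qquad\text{for all }\xi_h\in\Phi_{0,h},$$ and it satisfies $$\|\nabla\psi_h\|_\Omega\le\frac{C_P}{\varepsilon\gamma_*}\,\|g\|_\Omega .$$ -/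

import Mathlib

open MeasureTheory TopologicalSpace
open scoped ContDiff

noncomputable section

namespace VEM

/-! ### Sobolev spaces on open subsets of the plane -/

/-- The Euclidean plane. -/
abbrev Plane := EuclideanSpace ℝ (Fin 2)

/-- `L²(Ω; F)`. -/
abbrev L2 (Ω : Opens Plane) (F : Type) [NormedAddCommGroup F] : Type :=
  Lp F 2 (volume.restrict (Ω : Set Plane))

/-- `η ∈ C_c^∞(Ω)`. -/
structure IsTestFunction (Ω : Opens Plane) (η : Plane → ℝ) : Prop where
  smooth : ContDiff ℝ ∞ η
  compact : HasCompactSupport η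
  support : tsupport η ⊆ Ω

/-- The classical partial derivative `∂η/∂xᵢ`. -/
def pd (i : Fin 2) (η : Plane → ℝ) (x : Plane) : ℝ :=
  fderiv ℝ η x (EuclideanSpace.single i 1)

/-- `G` is the weak gradient of `φ` on `Ω`. -/
def IsWeakGrad (Ω : Opens Plane) (φ : Plane → ℝ) (G : Plane → Plane) : Prop :=
  ∀ η, IsTestFunction Ω η → ∀ i : Fin 2,
    ∫ x in (Ω : Set Plane), φ x * pd i η x = -∫ x in (Ω : Set Plane), G x i * η x

lemma IsTestFunction.continuous_pd {Ω : Opens Plane} {η : Plane → ℝ} (h : IsTestFunction Ω η)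
    (i : Fin 2) : Continuous (pd i η) :=
  (h.smooth.continuous_fderiv (by simp)).clm_apply continuous_const

lemma IsTestFunction.compact_pd {Ω : Opens Plane} {η : Plane → ℝ} (h : IsTestFunction Ω η)
    (i : Fin 2) : HasCompactSupport (pd i η) :=
  h.compact.fderiv_apply (𝕜 := ℝ) _

lemma IsTestFunction.memLp {Ω : Opens Plane} {η : Plane → ℝ} (h : IsTestFunction Ω η)
    (μ : Measure Plane) [IsFiniteMeasureOnCompacts μ] : MemLp η 2 μ :=
  h.smooth.continuous.memLp_of_hasCompactSupport h.compact

lemma IsTestFunction.memLp_pd {Ω : Opens Plane} {η : Plane → ℝ} (h : IsTestFunction Ω η)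
    (i : Fin 2) (μ : Measure Plane) [IsFiniteMeasureOnCompacts μ] : MemLp (pd i η) 2 μ :=
  (h.continuous_pd i).memLp_of_hasCompactSupport (h.compact_pd i)

lemma memLp_coord {Ω : Opens Plane} {G : Plane → Plane}
    (hG : MemLp G 2 (volume.restrict (Ω : Set Plane))) (i : Fin 2) :
    MemLp (fun x => G x i) 2 (volume.restrict (Ω : Set Plane)) :=
  hG.continuousLinearMap_comp (EuclideanSpace.proj (𝕜 := ℝ) i)

/-- `H¹(Ω)`: the pairs `(φ, ∇φ)` of an `L²` function and its weak gradient in `L²`. The second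
component is determined by the first one. The topology is the one of the `H¹` norm. -/
def H1 (Ω : Opens Plane) : Submodule ℝ (L2 Ω ℝ × L2 Ω Plane) where
  carrier := {p | IsWeakGrad Ω p.1 p.2}
  zero_mem' := by
    intro η hη i
    have h1 : ((0 : L2 Ω ℝ × L2 Ω Plane).1 : Plane → ℝ) =ᵐ[volume.restrict (Ω : Set Plane)] 0 :=
      Lp.coeFn_zero ..
    have h2 : ((0 : L2 Ω ℝ × L2 Ω Plane).2 : Plane → Plane) =ᵐ[volume.restrict (Ω : Set Plane)] 0 :=
      Lp.coeFn_zero ..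
    rw [integral_eq_zero_of_ae, integral_eq_zero_of_ae, neg_zero]
    · filter_upwards [h2] with x hx; rw [hx]; simp
    · filter_upwards [h1] with x hx; rw [hx]; simp
  add_mem' := by
    intro a b ha hb η hη i
    have h1 : ((a + b).1 : Plane → ℝ) =ᵐ[volume.restrict (Ω : Set Plane)] a.1 + b.1 :=
      Lp.coeFn_add ..
    have h2 : ((a + b).2 : Plane → Plane) =ᵐ[volume.restrict (Ω : Set Plane)] a.2 + b.2 :=
      Lp.coeFn_add ..
    have e1 : ∫ x in (Ω : Set Plane), (a + b).1 x * pd i η x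
        = ∫ x in (Ω : Set Plane), (a.1 x * pd i η x + b.1 x * pd i η x) := by
      refine integral_congr_ae ?_
      filter_upwards [h1] with x hx
      rw [hx, Pi.add_apply, add_mul]
    have e2 : ∫ x in (Ω : Set Plane), (a + b).2 x i * η x
        = ∫ x in (Ω : Set Plane), (a.2 x i * η x + b.2 x i * η x) := by
      refine integral_congr_ae ?_
      filter_upwards [h2] with x hx
      rw [hx, Pi.add_apply, PiLp.add_apply, add_mul]
    rw [e1, e2, integral_add, integral_add, ha η hη i, hb η hη i, neg_add]
    · exact (memLp_coord (Lp.memLp a.2) i).integrable_mul (hη.memLp _)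
    · exact (memLp_coord (Lp.memLp b.2) i).integrable_mul (hη.memLp _)
    · exact (Lp.memLp a.1).integrable_mul (hη.memLp_pd i _)
    · exact (Lp.memLp b.1).integrable_mul (hη.memLp_pd i _)
  smul_mem' := by
    intro c a ha η hη i
    have h1 : ((c • a).1 : Plane → ℝ) =ᵐ[volume.restrict (Ω : Set Plane)] c • a.1 :=
      Lp.coeFn_smul ..
    have h2 : ((c • a).2 : Plane → Plane) =ᵐ[volume.restrict (Ω : Set Plane)] c • a.2 :=
      Lp.coeFn_smul ..
    have e1 : ∫ x in (Ω : Set Plane), (c • a).1 x * pd i η x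
        = ∫ x in (Ω : Set Plane), c * (a.1 x * pd i η x) := by
      refine integral_congr_ae ?_
      filter_upwards [h1] with x hx
      rw [hx, Pi.smul_apply, smul_eq_mul, mul_assoc]
    have e2 : ∫ x in (Ω : Set Plane), (c • a).2 x i * η x
        = ∫ x in (Ω : Set Plane), c * (a.2 x i * η x) := by
      refine integral_congr_ae ?_
      filter_upwards [h2] with x hx
      rw [hx, Pi.smul_apply, PiLp.smul_apply, smul_eq_mul, mul_assoc]
    rw [e1, e2, integral_const_mul, integral_const_mul, ha η hη i, mul_neg]

/-- The underlying function of an element of `H¹(Ω)`. -/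
def fn {Ω : Opens Plane} (φ : H1 Ω) : Plane → ℝ := φ.1.1

/-- The weak partial derivative `∂ᵢφ` of an element of `H¹(Ω)`. -/
def wd {Ω : Opens Plane} (i : Fin 2) (φ : H1 Ω) : Plane → ℝ := fun x => φ.1.2 x i

/-- The `L²(Ω)` norm `‖φ‖_Ω`. -/
def l2norm {Ω : Opens Plane} (φ : H1 Ω) : ℝ := ‖φ.1.1‖

/-- The `L²(Ω)` norm `‖∇φ‖_Ω` of the weak gradient. -/
def gradNorm {Ω : Opens Plane} (φ : H1 Ω) : ℝ := ‖φ.1.2‖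

lemma fn_add {Ω : Opens Plane} (φ ξ : H1 Ω) :
    fn (φ + ξ) =ᵐ[volume.restrict (Ω : Set Plane)] fn φ + fn ξ := Lp.coeFn_add ..

lemma fn_zero {Ω : Opens Plane} :
    fn (0 : H1 Ω) =ᵐ[volume.restrict (Ω : Set Plane)] 0 := Lp.coeFn_zero ..

lemma fn_smul {Ω : Opens Plane} (c : ℝ) (φ : H1 Ω) :
    fn (c • φ) =ᵐ[volume.restrict (Ω : Set Plane)] c • fn φ := Lp.coeFn_smul ..

lemma wd_add {Ω : Opens Plane} (i : Fin 2) (φ ξ : H1 Ω) :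
    wd i (φ + ξ) =ᵐ[volume.restrict (Ω : Set Plane)] wd i φ + wd i ξ := by
  have h : ((φ + ξ).1.2 : Plane → Plane) =ᵐ[volume.restrict (Ω : Set Plane)] φ.1.2 + ξ.1.2 :=
    Lp.coeFn_add ..
  filter_upwards [h] with x hx
  exact congrArg (fun y : Plane => y i) hx

lemma wd_zero {Ω : Opens Plane} (i : Fin 2) :
    wd i (0 : H1 Ω) =ᵐ[volume.restrict (Ω : Set Plane)] 0 := by
  have h : ((0 : H1 Ω).1.2 : Plane → Plane) =ᵐ[volume.restrict (Ω : Set Plane)] 0 :=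
    Lp.coeFn_zero ..
  filter_upwards [h] with x hx
  exact congrArg (fun y : Plane => y i) hx

lemma wd_smul {Ω : Opens Plane} (i : Fin 2) (c : ℝ) (φ : H1 Ω) :
    wd i (c • φ) =ᵐ[volume.restrict (Ω : Set Plane)] c • wd i φ := by
  have h : ((c • φ).1.2 : Plane → Plane) =ᵐ[volume.restrict (Ω : Set Plane)] c • φ.1.2 :=
    Lp.coeFn_smul ..
  filter_upwards [h] with x hx
  exact congrArg (fun y : Plane => y i) hx

lemma memLp_fn {Ω : Opens Plane} (φ : H1 Ω) :
    MemLp (fn φ) 2 (volume.restrict (Ω : Set Plane)) := Lp.memLp _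

lemma memLp_wd {Ω : Opens Plane} (i : Fin 2) (φ : H1 Ω) :
    MemLp (wd i φ) 2 (volume.restrict (Ω : Set Plane)) := memLp_coord (Lp.memLp _) i

/-- The elements of `H¹(Ω)` that come from `C_c^∞(Ω)`. -/
def testSpace (Ω : Opens Plane) : Submodule ℝ (H1 Ω) where
  carrier := {φ | ∃ η, IsTestFunction Ω η ∧ fn φ =ᵐ[volume.restrict (Ω : Set Plane)] η}
  zero_mem' := ⟨0, ⟨contDiff_const, HasCompactSupport.zero, by simp [tsupport]⟩, fn_zero⟩
  add_mem' := by
    rintro a b ⟨η, hη, h1⟩ ⟨θ, hθ, h2⟩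
    refine ⟨η + θ, ⟨hη.smooth.add hθ.smooth, hη.compact.add hθ.compact,
      (tsupport_add η θ).trans (Set.union_subset hη.support hθ.support)⟩, ?_⟩
    exact (fn_add a b).trans (h1.add h2)
  smul_mem' := by
    rintro c a ⟨η, hη, h1⟩
    refine ⟨c • η, ⟨hη.smooth.const_smul c, hη.compact.smul_left (f := fun _ => c),
      (tsupport_smul_subset_right (fun _ => c) η).trans hη.support⟩, ?_⟩
    exact (fn_smul c a).trans (h1.const_smul c)

/-- `H¹₀(Ω)`: the closure of `C_c^∞(Ω)` in `H¹(Ω)`. -/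
def H10 (Ω : Opens Plane) : Submodule ℝ (H1 Ω) := (testSpace Ω).topologicalClosure

/-- The Poincaré constant of `Ω`: the least `C ≥ 0` with `‖φ‖_Ω ≤ C ‖∇φ‖_Ω` on `H¹₀(Ω)`. -/
def poincareConst (Ω : Opens Plane) : ℝ :=
  sInf {C : ℝ | 0 ≤ C ∧ ∀ φ ∈ H10 Ω, l2norm φ ≤ C * gradNorm φ}

/-- Restriction of `L²` functions to a smaller open set. -/
def restrictL2 {E Ω : Opens Plane} (h : E ≤ Ω) (F : Type) [NormedAddCommGroup F]
    [NormedSpace ℝ F] : L2 Ω F →ₗ[ℝ] L2 E F where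
  toFun f := ((Lp.memLp f).mono_measure (Measure.restrict_mono_set volume h)).toLp f
  map_add' f g := by
    have hac : volume.restrict (E : Set Plane) ≪ volume.restrict (Ω : Set Plane) :=
      (Measure.restrict_mono_set volume h).absolutelyContinuous
    refine Lp.ext ?_
    refine (MemLp.coeFn_toLp _).trans ?_
    refine (hac.ae_eq (Lp.coeFn_add f g)).trans ?_
    refine Filter.EventuallyEq.trans ?_ (Lp.coeFn_add _ _).symm
    exact ((MemLp.coeFn_toLp _).symm).add ((MemLp.coeFn_toLp _).symm)
  map_smul' c f := by
    have hac : volume.restrict (E : Set Plane) ≪ volume.restrict (Ω : Set Plane) :=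
      (Measure.restrict_mono_set volume h).absolutelyContinuous
    refine Lp.ext ?_
    refine (MemLp.coeFn_toLp _).trans ?_
    refine (hac.ae_eq (Lp.coeFn_smul c f)).trans ?_
    refine Filter.EventuallyEq.trans ?_ (Lp.coeFn_smul _ _).symm
    exact ((MemLp.coeFn_toLp _).symm).const_smul c

lemma IsTestFunction.mono {E Ω : Opens Plane} (h : E ≤ Ω) {η : Plane → ℝ}
    (hη : IsTestFunction E η) : IsTestFunction Ω η :=
  ⟨hη.smooth, hη.compact, hη.support.trans h⟩

lemma IsTestFunction.eq_zero {E : Opens Plane} {η : Plane → ℝ}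
    (hη : IsTestFunction E η) {x : Plane} (hx : x ∉ E) : η x = 0 :=
  image_eq_zero_of_notMem_tsupport fun h' => hx (hη.support h')

lemma IsTestFunction.pd_eq_zero {E : Opens Plane} {η : Plane → ℝ}
    (hη : IsTestFunction E η) (i : Fin 2) {x : Plane} (hx : x ∉ E) : pd i η x = 0 := by
  have : x ∉ tsupport η := fun h' => hx (hη.support h')
  have h0 : fderiv ℝ η x = 0 := by
    by_contra hne
    exact this (support_fderiv_subset ℝ (f := η) hne)
  simp [pd, h0]

/-- Restriction `φ ↦ φ|_E` from `H¹(Ω)` to `H¹(E)`. -/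
def restrictH1 {E Ω : Opens Plane} (h : E ≤ Ω) : H1 Ω →ₗ[ℝ] H1 E :=
  (((restrictL2 h ℝ).prodMap (restrictL2 h Plane)).domRestrict (H1 Ω)).codRestrict (H1 E) (by
    rintro ⟨⟨f, G⟩, hfG⟩ η hη i
    have e1 : ∫ x in (E : Set Plane), (restrictL2 h ℝ f) x * pd i η x
        = ∫ x in (E : Set Plane), f x * pd i η x := by
      refine integral_congr_ae ?_
      filter_upwards [((Lp.memLp f).mono_measure
        (Measure.restrict_mono_set volume h)).coeFn_toLp] with x hx
      exact congrArg (· * pd i η x) hx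
    have e2 : ∫ x in (E : Set Plane), (restrictL2 h Plane G) x i * η x
        = ∫ x in (E : Set Plane), G x i * η x := by
      refine integral_congr_ae ?_
      filter_upwards [((Lp.memLp G).mono_measure
        (Measure.restrict_mono_set volume h)).coeFn_toLp] with x hx
      exact congrArg (fun y : Plane => y i * η x) hx
    have key := hfG η (hη.mono h) i
    rw [setIntegral_eq_of_subset_of_forall_sdiff_eq_zero Ω.isOpen.measurableSet h
      (fun x hx => by rw [hη.pd_eq_zero i hx.2, mul_zero]),
      setIntegral_eq_of_subset_of_forall_sdiff_eq_zero Ω.isOpen.measurableSet h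
      (fun x hx => by rw [hη.eq_zero hx.2, mul_zero])] at key
    exact e1.trans (key.trans (congrArg Neg.neg e2.symm)))

/-! ### Polynomials -/

/-- Polynomials in two variables. -/
abbrev Poly := MvPolynomial (Fin 2) ℝ

/-- `P_k`: the polynomials of total degree at most `k`. -/
abbrev Pk (k : ℕ) : Submodule ℝ Poly := MvPolynomial.restrictTotalDegree (Fin 2) ℝ k

/-- The polynomial function on the plane. -/
def pfn (p : Poly) (x : Plane) : ℝ := MvPolynomial.eval (fun i => x i) p

/-- The gradient of a polynomial function. -/
def pgrad (p : Poly) (x : Plane) : Plane :=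
  WithLp.toLp 2 fun i => pfn (MvPolynomial.pderiv i p) x

/-! ### Polygonal elements -/

/-- An open simple polygon. The boundary is the closed polygonal curve through the vertices
`v 0, …, v (n+2)` (indices are cyclic); flat angles are allowed, so that a hanging node
counts as a vertex. -/
structure Polygon where
  /-- the number of vertices, minus three -/
  n : ℕ
  /-- the vertices -/
  v : Fin (n + 3) → Plane
  /-- the open region enclosed -/
  dom : Opens Plane
  injective : Function.Injective v
  simple : ∀ i j, i ≠ j → segment ℝ (v i) (v (i + 1)) ∩ segment ℝ (v j) (v (j + 1)) ⊆
    {v i, v (i + 1)} ∩ {v j, v (j + 1)}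
  connected : IsConnected (dom : Set Plane)
  bounded : Bornology.IsBounded (dom : Set Plane)
  frontier_eq : frontier (dom : Set Plane) = ⋃ i, segment ℝ (v i) (v (i + 1))

namespace Polygon

variable (E : Polygon)

/-- The diameter `h_E`. -/
def diam : ℝ := Metric.diam (E.dom : Set Plane)

/-- The barycenter `x_E`. -/
def barycenter : Plane := ⨍ x in (E.dom : Set Plane), x

/-- The edge with index `i`. -/
def edge (i : Fin (E.n + 3)) : Set Plane := segment ℝ (E.v i) (E.v (i + 1))

/-- The boundary integral `∫_{∂E} γ ds`. -/
def bdryIntegral (γ : Plane → ℝ) : ℝ :=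
  ∑ i, dist (E.v i) (E.v (i + 1)) *
    ∫ t in (0 : ℝ)..1, γ (AffineMap.lineMap (E.v i) (E.v (i + 1)) t)

/-- The scaled monomial `((x - x_E)/h_E)^β`. -/
def monomial (β : Fin 2 → ℕ) (x : Plane) : ℝ :=
  ∏ i, ((x i - E.barycenter i) / E.diam) ^ β i

/-- The function `φ ∈ H¹(E)` has the Lipschitz boundary values `γ|_{∂E}`, that is,
`φ - γ ∈ H¹₀(E)`. (A continuous, edgewise polynomial function on the boundary of a simple polygon
is Lipschitz, and has a Lipschitz extension `γ` to the closed polygon.) -/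
def HasTrace (φ : H1 E.dom) (γ : Plane → ℝ) : Prop :=
  (∃ K, LipschitzOnWith K γ (closure (E.dom : Set Plane))) ∧
    ∃ ξ ∈ H10 E.dom, fn φ =ᵐ[volume.restrict (E.dom : Set Plane)] fn ξ + γ

lemma HasTrace.add {φ ξ : H1 E.dom} {γ δ : Plane → ℝ} (h1 : E.HasTrace φ γ)
    (h2 : E.HasTrace ξ δ) : E.HasTrace (φ + ξ) (γ + δ) := by
  obtain ⟨⟨K, hK⟩, a, ha, hφ⟩ := h1
  obtain ⟨⟨L, hL⟩, b, hb, hξ⟩ := h2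
  refine ⟨⟨K + L, hK.add hL⟩, a + b, Submodule.add_mem _ ha hb, ?_⟩
  filter_upwards [hφ, hξ, fn_add φ ξ, fn_add a b] with x h1 h2 h3 h4
  simp only [Pi.add_apply] at *
  rw [h3, h4, h1, h2]
  ring

lemma HasTrace.smul {φ : H1 E.dom} {γ : Plane → ℝ} (c : ℝ) (h1 : E.HasTrace φ γ) :
    E.HasTrace (c • φ) (c • γ) := by
  obtain ⟨⟨K, hK⟩, a, ha, hφ⟩ := h1
  refine ⟨⟨‖c‖₊ * K, (lipschitzWith_smul c).comp_lipschitzOnWith hK⟩, c • a,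
    Submodule.smul_mem _ c ha, ?_⟩
  filter_upwards [hφ, fn_smul c φ, fn_smul c a] with x h1 h3 h4
  simp only [Pi.add_apply, Pi.smul_apply, smul_eq_mul] at *
  rw [h3, h4, h1]
  ring

/-- `p = Π^{∇,E}_k φ`, the `H¹` energy projection of `φ` onto `P_k(E)`: the gradient of `φ - p` is
orthogonal to the gradients of `P_k`, and `∫_{∂E} (φ - p) ds = 0`. -/
def IsEnergyProj (k : ℕ) (φ : H1 E.dom) (p : Poly) : Prop :=
  p ∈ Pk k ∧
  (∀ m ∈ Pk k, ∫ x in (E.dom : Set Plane), ∑ i, (wd i φ x - pgrad p x i) * pgrad m x i = 0) ∧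
  ∃ γ, E.HasTrace φ γ ∧ E.bdryIntegral (fun x => γ x - pfn p x) = 0

/-- `q = Π^{0,E}_k f`, the `L²` projection of `f` onto `P_k(E)`. -/
def IsL2Proj (k : ℕ) (f : Plane → ℝ) (q : Poly) : Prop :=
  q ∈ Pk k ∧ ∀ m ∈ Pk k, ∫ x in (E.dom : Set Plane), (f x - pfn q x) * pfn m x = 0

open Classical in
/-- `Π^{0,E}_k f` (it exists and is unique for `f ∈ L²(E)`). -/
def l2Proj (k : ℕ) (f : Plane → ℝ) : Poly :=
  if h : ∃ q, E.IsL2Proj k f q then h.choose else 0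

open Classical in
/-- `Π^{∇,E}_k φ` (it exists and is unique for `φ ∈ H¹(E)` with Lipschitz boundary values). -/
def energyProj (k : ℕ) (φ : H1 E.dom) : Poly :=
  if h : ∃ p, E.IsEnergyProj k φ p then h.choose else 0

lemma energyProj_mem (k : ℕ) (φ : H1 E.dom) : E.energyProj k φ ∈ Pk k := by
  unfold energyProj
  split_ifs with h
  · exact h.choose_spec.1
  · exact Submodule.zero_mem _

/-- Membership of the local virtual element space `V^h_k(E)`:
(i), (iii) continuous boundary values that are polynomials of degree `≤ k` on each edge,
(ii) `Δφ ∈ P_k(E)`, (iv) `φ - Π^∇_k φ` is orthogonal in `L²(E)` to the scaled monomials of degree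
`k - 1` and `k`. -/
structure IsVirtual (k : ℕ) (φ : H1 E.dom) : Prop where
  trace : ∃ γ, E.HasTrace φ γ ∧ ∀ i, ∃ q ∈ Pk k, Set.EqOn γ (pfn q) (E.edge i)
  laplacian : ∃ q ∈ Pk k, ∀ η, IsTestFunction E.dom η →
    ∫ x in (E.dom : Set Plane), ∑ i, wd i φ x * pd i η x
      = -∫ x in (E.dom : Set Plane), pfn q x * η x
  enhanced : ∃ p, E.IsEnergyProj k φ p ∧ ∀ β : Fin 2 → ℕ, (∑ i, β i) + 1 = k ∨ ∑ i, β i = k →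
    ∫ x in (E.dom : Set Plane), (fn φ x - pfn p x) * E.monomial β x = 0
lemma edge_subset (i : Fin (E.n + 3)) : E.edge i ⊆ closure (E.dom : Set Plane) := by
  refine subset_trans ?_ frontier_subset_closure
  rw [E.frontier_eq]
  exact Set.subset_iUnion (fun i => segment ℝ (E.v i) (E.v (i + 1))) i

lemma continuous_pfn (p : Poly) : Continuous (pfn p) := by
  unfold pfn
  have h := MvPolynomial.continuous_eval p
  exact h.comp (by fun_prop)

lemma intervalIntegrable_edge {γ : Plane → ℝ} {K : NNReal}
    (h : LipschitzOnWith K γ (closure (E.dom : Set Plane))) (i : Fin (E.n + 3)) :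
    IntervalIntegrable (fun t : ℝ => γ (AffineMap.lineMap (E.v i) (E.v (i + 1)) t)) volume 0 1 := by
  apply ContinuousOn.intervalIntegrable
  rw [Set.uIcc_of_le zero_le_one]
  refine h.continuousOn.comp (by fun_prop) ?_
  intro t ht
  apply E.edge_subset i
  unfold edge
  rw [segment_eq_image_lineMap]
  exact ⟨t, ht, rfl⟩

lemma intervalIntegrable_sub_pfn {φ : H1 E.dom} {γ : Plane → ℝ} (h : E.HasTrace φ γ) (p : Poly)
    (i : Fin (E.n + 3)) : IntervalIntegrable (fun t : ℝ =>
      γ (AffineMap.lineMap (E.v i) (E.v (i + 1)) t)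
        - pfn p (AffineMap.lineMap (E.v i) (E.v (i + 1)) t)) volume 0 1 := by
  obtain ⟨⟨K, hK⟩, -⟩ := h
  refine (E.intervalIntegrable_edge hK i).sub ?_
  exact ((continuous_pfn p).comp (by fun_prop)).intervalIntegrable _ _

lemma memLp_of_continuous {F : Type} [NormedAddCommGroup F] [SecondCountableTopology F]
    {f : Plane → F} (hf : Continuous f) :
    MemLp f 2 (volume.restrict (E.dom : Set Plane)) := by
  have : IsFiniteMeasure (volume.restrict (E.dom : Set Plane)) :=
    ⟨by rw [Measure.restrict_apply_univ]; exact E.bounded.measure_lt_top⟩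
  obtain ⟨C, hC⟩ := (E.bounded.isCompact_closure).exists_bound_of_continuousOn hf.continuousOn
  refine MemLp.of_bound hf.aestronglyMeasurable C ?_
  filter_upwards [ae_restrict_mem E.dom.isOpen.measurableSet] with x hx
  exact hC x (subset_closure hx)

lemma pfn_add (p q : Poly) (x : Plane) : pfn (p + q) x = pfn p x + pfn q x := by simp [pfn]

lemma pfn_smul (c : ℝ) (p : Poly) (x : Plane) : pfn (c • p) x = c * pfn p x := by simp [pfn]

lemma pfn_zero (x : Plane) : pfn 0 x = 0 := by simp [pfn]

lemma pgrad_apply (p : Poly) (x : Plane) (i : Fin 2) :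
    pgrad p x i = pfn (MvPolynomial.pderiv i p) x := rfl

lemma continuous_pgrad (p : Poly) : Continuous (pgrad p) := by
  unfold pgrad
  exact (PiLp.continuous_toLp 2 _).comp (continuous_pi fun i => continuous_pfn _)

lemma hasFDerivAt_pfn (p : Poly) (x : Plane) :
    HasFDerivAt (pfn p) (∑ i, pfn (MvPolynomial.pderiv i p) x •
      (EuclideanSpace.proj i : Plane →L[ℝ] ℝ)) x := by
  induction p using MvPolynomial.induction_on with
  | C a =>
    have e : pfn (MvPolynomial.C a) = fun _ : Plane => a := by ext y; simp [pfn]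
    rw [e]
    refine (hasFDerivAt_const (𝕜 := ℝ) a x).congr_fderiv ?_
    simp [pfn_zero]
  | add p q hp hq =>
    have h := hp.add hq
    have e : pfn (p + q) = pfn p + pfn q := by ext y; simp [pfn]
    rw [e]
    refine h.congr_fderiv ?_
    rw [← Finset.sum_add_distrib]
    refine Finset.sum_congr rfl fun i _ => ?_
    rw [map_add, pfn_add, add_smul]
  | mul_X p j hp =>
    have hX : HasFDerivAt (fun y : Plane => y j) (EuclideanSpace.proj j : Plane →L[ℝ] ℝ) x :=
      (EuclideanSpace.proj j : Plane →L[ℝ] ℝ).hasFDerivAt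
    have h := hp.mul hX
    have e : pfn (p * MvPolynomial.X j) = fun y => pfn p y * y j := by ext y; simp [pfn]
    rw [e]
    refine h.congr_fderiv ?_
    ext y
    simp only [pfn, MvPolynomial.pderiv_mul, MvPolynomial.pderiv_X, map_add, map_mul,
      MvPolynomial.eval_X, Fin.sum_univ_two, add_apply, smul_apply, PiLp.proj_apply,
      smul_eq_mul]
    fin_cases j <;> simp <;> ring

lemma contDiff_pfn (p : Poly) : ContDiff ℝ 1 (pfn p) := by
  rw [contDiff_one_iff_hasFDerivAt]
  refine ⟨_, ?_, hasFDerivAt_pfn p⟩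
  refine continuous_finsetSum _ fun i _ => ?_
  exact (continuous_pfn _).smul continuous_const

lemma integral_pfn_mul_pd (p : Poly) {η : Plane → ℝ} (hη : IsTestFunction E.dom η) (i : Fin 2) :
    ∫ x in (E.dom : Set Plane), pfn p x * pd i η x
      = -∫ x in (E.dom : Set Plane), pfn (MvPolynomial.pderiv i p) x * η x := by
  rw [setIntegral_eq_integral_of_forall_compl_eq_zero
      (fun x hx => by rw [hη.pd_eq_zero i hx, mul_zero]),
    setIntegral_eq_integral_of_forall_compl_eq_zero
      (fun x hx => by rw [hη.eq_zero hx, mul_zero])]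
  have e : ∀ x, pfn (MvPolynomial.pderiv i p) x
      = fderiv ℝ (pfn p) x (EuclideanSpace.single i 1) := by
    intro x
    rw [(hasFDerivAt_pfn p x).fderiv]
    fin_cases i <;> simp [Fin.sum_univ_two]
  simp only [e]
  refine integral_mul_fderiv_eq_neg_fderiv_mul_of_integrable ?_ ?_ ?_ ?_ ?_
  · simp only [← e]
    exact ((continuous_pfn _).mul hη.smooth.continuous).integrable_of_hasCompactSupport
      hη.compact.mul_left
  · exact ((continuous_pfn p).mul (hη.continuous_pd i)).integrable_of_hasCompactSupport
      (hη.compact_pd i).mul_left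
  · exact ((continuous_pfn p).mul hη.smooth.continuous).integrable_of_hasCompactSupport
      hη.compact.mul_left
  · exact fun x _ => (hasFDerivAt_pfn p x).differentiableAt
  · exact fun x _ => hη.smooth.differentiable (by simp) x

/-- A polynomial as an element of `H¹(E)`. -/
def polyH1 (p : Poly) : H1 E.dom :=
  ⟨((E.memLp_of_continuous (continuous_pfn p)).toLp,
      (E.memLp_of_continuous (continuous_pgrad p)).toLp), by
    intro η hη i
    refine Eq.trans ?_ ((E.integral_pfn_mul_pd p hη i).trans (congrArg Neg.neg ?_))
    · refine integral_congr_ae ?_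
      filter_upwards [(E.memLp_of_continuous (continuous_pfn p)).coeFn_toLp] with x hx
      exact congrArg (· * pd i η x) hx
    · refine integral_congr_ae ?_
      filter_upwards [(E.memLp_of_continuous (continuous_pgrad p)).coeFn_toLp] with x hx
      exact (congrArg (fun y : Plane => y i * η x) hx).symm⟩

lemma fn_polyH1 (p : Poly) :
    fn (E.polyH1 p) =ᵐ[volume.restrict (E.dom : Set Plane)] pfn p :=
  (E.memLp_of_continuous (continuous_pfn p)).coeFn_toLp

lemma wd_polyH1 (p : Poly) (i : Fin 2) :
    wd i (E.polyH1 p) =ᵐ[volume.restrict (E.dom : Set Plane)] fun x => pgrad p x i := by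
  filter_upwards [(E.memLp_of_continuous (continuous_pgrad p)).coeFn_toLp] with x hx
  exact congrArg (fun y : Plane => y i) hx

lemma hasTrace_polyH1 (p : Poly) : E.HasTrace (E.polyH1 p) (pfn p) := by
  constructor
  · obtain ⟨R, hR⟩ := E.bounded.closure.subset_closedBall 0
    obtain ⟨C, hC⟩ := (isCompact_closedBall (0 : Plane) R).exists_bound_of_continuousOn
      ((contDiff_pfn p).continuous_fderiv (by simp)).continuousOn
    refine ⟨C.toNNReal, LipschitzOnWith.mono ?_ hR⟩
    refine (convex_closedBall (0 : Plane) R).lipschitzOnWith_of_nnnorm_fderiv_le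
      (fun x _ => (hasFDerivAt_pfn p x).differentiableAt) (fun x hx => ?_)
    rw [← NNReal.coe_le_coe, coe_nnnorm]
    exact (hC x hx).trans (Real.le_coe_toNNReal C)
  · refine ⟨0, Submodule.zero_mem _, ?_⟩
    filter_upwards [E.fn_polyH1 p, fn_zero (Ω := E.dom)] with x h1 h2
    simp [h1, h2]

lemma isEnergyProj_polyH1 {k : ℕ} {p : Poly} (hp : p ∈ Pk k) :
    E.IsEnergyProj k (E.polyH1 p) p := by
  refine ⟨hp, fun m _ => ?_, pfn p, E.hasTrace_polyH1 p, by simp [bdryIntegral]⟩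
  refine integral_eq_zero_of_ae ?_
  filter_upwards [E.wd_polyH1 p 0, E.wd_polyH1 p 1] with x h0 h1
  simp [Fin.sum_univ_two, h0, h1]

lemma pderiv_mem {k : ℕ} {p : Poly} (hp : p ∈ Pk k) (i : Fin 2) :
    MvPolynomial.pderiv i p ∈ Pk k := by
  rw [MvPolynomial.mem_restrictTotalDegree] at *
  refine (Finset.sup_le fun m hm => ?_).trans hp
  rw [MvPolynomial.mem_support_iff, MvPolynomial.coeff_pderiv] at hm
  have h := MvPolynomial.le_totalDegree (MvPolynomial.mem_support_iff.2 (left_ne_zero_of_mul hm))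
  rw [Finsupp.sum_add_index' (fun _ => rfl) (fun _ _ _ => rfl)] at h
  exact (Nat.le_add_right _ _).trans h

lemma isVirtual_polyH1 {k : ℕ} {p : Poly} (hp : p ∈ Pk k) : E.IsVirtual k (E.polyH1 p) where
  trace := ⟨pfn p, E.hasTrace_polyH1 p, fun _ => ⟨p, hp, fun _ _ => rfl⟩⟩
  laplacian := by
    refine ⟨∑ i, MvPolynomial.pderiv i (MvPolynomial.pderiv i p),
      Submodule.sum_mem _ fun i _ => pderiv_mem (pderiv_mem hp i) i, fun η hη => ?_⟩
    have hint : ∀ i, Integrable (fun x => pfn (MvPolynomial.pderiv i p) x * pd i η x)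
        (volume.restrict (E.dom : Set Plane)) := fun i =>
      (E.memLp_of_continuous (continuous_pfn _)).integrable_mul (hη.memLp_pd i _)
    have hint2 : ∀ i, Integrable (fun x =>
        pfn (MvPolynomial.pderiv i (MvPolynomial.pderiv i p)) x * η x)
        (volume.restrict (E.dom : Set Plane)) := fun i =>
      (E.memLp_of_continuous (continuous_pfn _)).integrable_mul (hη.memLp _)
    calc _ = ∫ x in (E.dom : Set Plane), (pfn (MvPolynomial.pderiv 0 p) x * pd 0 η x
          + pfn (MvPolynomial.pderiv 1 p) x * pd 1 η x) := by
          refine integral_congr_ae ?_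
          filter_upwards [E.wd_polyH1 p 0, E.wd_polyH1 p 1] with x h0 h1
          simp [Fin.sum_univ_two, h0, h1, pgrad_apply]
      _ = _ := by
          rw [integral_add (hint 0) (hint 1), E.integral_pfn_mul_pd _ hη,
            E.integral_pfn_mul_pd _ hη, ← neg_add, ← integral_add (hint2 0) (hint2 1)]
          congr 1
          refine integral_congr_ae (Filter.Eventually.of_forall fun x => ?_)
          simp only [Fin.sum_univ_two, pfn_add]
          ring
  enhanced := by
    refine ⟨p, E.isEnergyProj_polyH1 hp, fun β _ => integral_eq_zero_of_ae ?_⟩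
    filter_upwards [E.fn_polyH1 p] with x hx
    simp [hx]

lemma integrable_wd_mul (φ : H1 E.dom) (p m : Poly) (i : Fin 2) :
    Integrable (fun x => (wd i φ x - pgrad p x i) * pgrad m x i)
      (volume.restrict (E.dom : Set Plane)) :=
  ((memLp_wd i φ).sub (E.memLp_of_continuous (continuous_pfn _))).integrable_mul
    (E.memLp_of_continuous (continuous_pfn _))

variable {E}

lemma IsEnergyProj.add {k : ℕ} {φ ξ : H1 E.dom} {p q : Poly} (h1 : E.IsEnergyProj k φ p)
    (h2 : E.IsEnergyProj k ξ q) : E.IsEnergyProj k (φ + ξ) (p + q) := by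
  obtain ⟨hp, hpm, γ, hγ, hpb⟩ := h1
  obtain ⟨hq, hqm, δ, hδ, hqb⟩ := h2
  refine ⟨Submodule.add_mem _ hp hq, fun m hm => ?_, γ + δ, HasTrace.add E hγ hδ, ?_⟩
  · have hp' := hpm m hm
    have hq' := hqm m hm
    rw [← add_zero (0 : ℝ)]
    nth_rewrite 1 [← hp']
    rw [← hq', ← integral_add (integrable_finsetSum _ fun i _ => E.integrable_wd_mul φ p m i)
      (integrable_finsetSum _ fun i _ => E.integrable_wd_mul ξ q m i)]
    refine integral_congr_ae ?_
    filter_upwards [wd_add 0 φ ξ, wd_add 1 φ ξ] with x h0 h1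
    simp only [Fin.sum_univ_two, h0, h1, Pi.add_apply, pgrad_apply, map_add, pfn_add]
    ring
  · rw [← add_zero (0 : ℝ)]
    nth_rewrite 1 [← hpb]
    rw [← hqb]
    unfold bdryIntegral
    rw [← Finset.sum_add_distrib]
    refine Finset.sum_congr rfl fun i _ => ?_
    rw [← mul_add, ← intervalIntegral.integral_add (E.intervalIntegrable_sub_pfn hγ p i)
      (E.intervalIntegrable_sub_pfn hδ q i)]
    congr 1
    refine intervalIntegral.integral_congr fun t _ => ?_
    simp only [Pi.add_apply, pfn_add]
    ring

lemma IsEnergyProj.smul {k : ℕ} {φ : H1 E.dom} {p : Poly} (c : ℝ) (h1 : E.IsEnergyProj k φ p) :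
    E.IsEnergyProj k (c • φ) (c • p) := by
  obtain ⟨hp, hpm, γ, hγ, hpb⟩ := h1
  refine ⟨Submodule.smul_mem _ c hp, fun m hm => ?_, c • γ, HasTrace.smul E c hγ, ?_⟩
  · rw [← mul_zero c, ← hpm m hm, ← integral_const_mul]
    refine integral_congr_ae ?_
    filter_upwards [wd_smul 0 c φ, wd_smul 1 c φ] with x h0 h1
    simp only [Fin.sum_univ_two, h0, h1, Pi.smul_apply, smul_eq_mul, pgrad_apply,
      Derivation.map_smul, pfn_smul]
    ring
  · rw [← mul_zero c, ← hpb]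
    unfold bdryIntegral
    rw [Finset.mul_sum]
    refine Finset.sum_congr rfl fun i _ => ?_
    rw [mul_left_comm]
    congr 1
    rw [← intervalIntegral.integral_const_mul]
    refine intervalIntegral.integral_congr fun t _ => ?_
    simp only [Pi.smul_apply, smul_eq_mul, pfn_smul]
    ring

lemma continuous_monomial (β : Fin 2 → ℕ) : Continuous (E.monomial β) := by
  unfold monomial
  fun_prop

lemma integrable_sub_mul_monomial (φ : H1 E.dom) (p : Poly) (β : Fin 2 → ℕ) :
    Integrable (fun x => (fn φ x - pfn p x) * E.monomial β x)
      (volume.restrict (E.dom : Set Plane)) :=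
  ((memLp_fn φ).sub (E.memLp_of_continuous (continuous_pfn _))).integrable_mul
    (E.memLp_of_continuous (continuous_monomial β))

lemma polyH1_zero : E.polyH1 0 = 0 := by
  refine Subtype.ext (Prod.ext (Lp.ext ?_) (Lp.ext ?_))
  · refine (E.fn_polyH1 0).trans (Filter.EventuallyEq.trans ?_ (fn_zero (Ω := E.dom)).symm)
    exact Filter.Eventually.of_forall fun x => pfn_zero x
  · refine ((E.memLp_of_continuous (continuous_pgrad 0)).coeFn_toLp).trans
      (Filter.EventuallyEq.trans ?_ (Lp.coeFn_zero _ _ _).symm)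
    refine Filter.Eventually.of_forall fun x => ?_
    ext i
    simp [pgrad_apply, pfn_zero]

variable (E)

/-- The local virtual element space `V^h_k(E)`. -/
def Vloc (k : ℕ) : Submodule ℝ (H1 E.dom) where
  carrier := {φ | E.IsVirtual k φ}
  zero_mem' := by
    have h := E.isVirtual_polyH1 (Submodule.zero_mem (Pk k))
    rwa [polyH1_zero] at h
  add_mem' := by
    intro φ ξ h1 h2
    constructor
    · obtain ⟨γ, hγ, hγe⟩ := h1.trace
      obtain ⟨δ, hδ, hδe⟩ := h2.trace
      refine ⟨γ + δ, HasTrace.add E hγ hδ, fun i => ?_⟩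
      obtain ⟨p, hp, hpe⟩ := hγe i
      obtain ⟨q, hq, hqe⟩ := hδe i
      refine ⟨p + q, Submodule.add_mem _ hp hq, fun x hx => ?_⟩
      rw [Pi.add_apply, hpe hx, hqe hx, pfn_add]
    · obtain ⟨p, hp, hpe⟩ := h1.laplacian
      obtain ⟨q, hq, hqe⟩ := h2.laplacian
      refine ⟨p + q, Submodule.add_mem _ hp hq, fun η hη => ?_⟩
      have i1 : ∀ ζ : H1 E.dom, Integrable (fun x => ∑ i, wd i ζ x * pd i η x)
          (volume.restrict (E.dom : Set Plane)) := fun ζ =>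
        integrable_finsetSum _ fun i _ => (memLp_wd i ζ).integrable_mul (hη.memLp_pd i _)
      have i2 : ∀ r : Poly, Integrable (fun x => pfn r x * η x)
          (volume.restrict (E.dom : Set Plane)) := fun r =>
        (E.memLp_of_continuous (continuous_pfn r)).integrable_mul (hη.memLp _)
      calc _ = ∫ x in (E.dom : Set Plane),
            ((∑ i, wd i φ x * pd i η x) + ∑ i, wd i ξ x * pd i η x) := by
            refine integral_congr_ae ?_
            filter_upwards [wd_add 0 φ ξ, wd_add 1 φ ξ] with x h0 h1
            simp only [Fin.sum_univ_two, h0, h1, Pi.add_apply]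
            ring
        _ = _ := by
            rw [integral_add (i1 φ) (i1 ξ), hpe η hη, hqe η hη, ← neg_add,
              ← integral_add (i2 p) (i2 q)]
            simp only [pfn_add, add_mul]
    · obtain ⟨p, hp, hpe⟩ := h1.enhanced
      obtain ⟨q, hq, hqe⟩ := h2.enhanced
      refine ⟨p + q, hp.add hq, fun β hβ => ?_⟩
      rw [← add_zero (0 : ℝ)]
      nth_rewrite 1 [← hpe β hβ]
      rw [← hqe β hβ, ← integral_add (integrable_sub_mul_monomial φ p β)
        (integrable_sub_mul_monomial ξ q β)]
      refine integral_congr_ae ?_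
      filter_upwards [fn_add φ ξ] with x hx
      simp only [hx, Pi.add_apply, pfn_add]
      ring
  smul_mem' := by
    intro c φ h1
    constructor
    · obtain ⟨γ, hγ, hγe⟩ := h1.trace
      refine ⟨c • γ, HasTrace.smul E c hγ, fun i => ?_⟩
      obtain ⟨p, hp, hpe⟩ := hγe i
      refine ⟨c • p, Submodule.smul_mem _ c hp, fun x hx => ?_⟩
      rw [Pi.smul_apply, hpe hx, pfn_smul, smul_eq_mul]
    · obtain ⟨p, hp, hpe⟩ := h1.laplacian
      refine ⟨c • p, Submodule.smul_mem _ c hp, fun η hη => ?_⟩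
      calc _ = ∫ x in (E.dom : Set Plane), c * ∑ i, wd i φ x * pd i η x := by
            refine integral_congr_ae ?_
            filter_upwards [wd_smul 0 c φ, wd_smul 1 c φ] with x h0 h1
            simp only [Fin.sum_univ_two, h0, h1, Pi.smul_apply, smul_eq_mul]
            ring
        _ = _ := by
            rw [integral_const_mul, hpe η hη, mul_neg, ← integral_const_mul]
            simp only [pfn_smul, mul_assoc]
    · obtain ⟨p, hp, hpe⟩ := h1.enhanced
      refine ⟨c • p, hp.smul c, fun β hβ => ?_⟩
      rw [← mul_zero c, ← hpe β hβ, ← integral_const_mul]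
      refine integral_congr_ae ?_
      filter_upwards [fn_smul c φ] with x hx
      simp only [hx, Pi.smul_apply, smul_eq_mul, pfn_smul]
      ring

/-- `φ - Π^∇_k φ` for `φ ∈ V^h_k(E)`, again an element of `V^h_k(E)` since `P_k(E) ⊆ V^h_k(E)`. -/
def subProj (k : ℕ) (φ : E.Vloc k) : E.Vloc k :=
  φ - ⟨E.polyH1 (E.energyProj k φ), E.isVirtual_polyH1 (E.energyProj_mem k φ)⟩

/-- An admissible stabilization on `V^h_k(E)`: a symmetric positive definite bilinear form `S` with
`lo ‖∇φ‖²_E ≤ S(φ, φ) ≤ hi ‖∇φ‖²_E` for all `φ ∈ V^h_k(E)` in the kernel of `Π^∇_k`. -/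
structure IsStabilization (k : ℕ) (lo hi : ℝ) (S : LinearMap.BilinForm ℝ (E.Vloc k)) : Prop where
  symm : ∀ φ ξ, S φ ξ = S ξ φ
  posDef : ∀ φ, φ ≠ 0 → 0 < S φ φ
  lower : ∀ φ : E.Vloc k, E.energyProj k φ = 0 → lo * gradNorm (φ : H1 E.dom) ^ 2 ≤ S φ φ
  upper : ∀ φ : E.Vloc k, E.energyProj k φ = 0 → S φ φ ≤ hi * gradNorm (φ : H1 E.dom) ^ 2

end Polygon

/-! ### The discrete problem -/

/-- The charge density `κ(t) = α₀ sinh(α₁ t)`. -/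
def kappa (α₀ α₁ t : ℝ) : ℝ := α₀ * Real.sinh (α₁ * t)

/-- A decomposition of `Ω` into finitely many non-overlapping polygons. -/
structure Mesh (Ω : Opens Plane) where
  ι : Type
  fintype : Fintype ι
  elem : ι → Polygon
  subset : ∀ j, (elem j).dom ≤ Ω
  disjoint : ∀ i j, i ≠ j → Disjoint (elem i).dom (elem j).dom
  cover : (Ω : Set Plane) ⊆ ⋃ j, closure ((elem j).dom : Set Plane)

attribute [instance] Mesh.fintype

namespace Mesh

variable {Ω : Opens Plane} (M : Mesh Ω) (k : ℕ)

/-- The restriction `φ|_E` of `φ ∈ H¹(Ω)` to a mesh element. -/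
def res (j : M.ι) : H1 Ω →ₗ[ℝ] H1 (M.elem j).dom := restrictH1 (M.subset j)

/-- `Φ_{0,h}`: the functions in `H¹₀(Ω)` whose restriction to each element is in `V^h_k(E)`. -/
def Φ₀ : Submodule ℝ (H1 Ω) where
  carrier := {φ | φ ∈ H10 Ω ∧ ∀ j, M.res j φ ∈ (M.elem j).Vloc k}
  zero_mem' := ⟨Submodule.zero_mem _, fun j => by
    rw [map_zero]; exact Submodule.zero_mem _⟩
  add_mem' := fun h1 h2 => ⟨Submodule.add_mem _ h1.1 h2.1, fun j => by
    rw [map_add]; exact Submodule.add_mem _ (h1.2 j) (h2.2 j)⟩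
  smul_mem' := fun c _ h1 => ⟨Submodule.smul_mem _ c h1.1, fun j => by
    rw [map_smul]; exact Submodule.smul_mem _ c (h1.2 j)⟩

variable {M k}

/-- The restriction of `φ ∈ Φ_{0,h}` to an element, in `V^h_k(E)`. -/
def loc (φ : M.Φ₀ k) (j : M.ι) : (M.elem j).Vloc k :=
  ⟨M.res j φ, φ.2.2 j⟩

/-- `Π^{0,E}_k φ`, as a function. -/
def P0 (j : M.ι) (φ : M.Φ₀ k) : Plane → ℝ :=
  pfn ((M.elem j).l2Proj k (fn (φ : H1 Ω)))

/-- `Π^{0,E}_{k-1} ∂ᵢφ`, as a function. -/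
def P0d (j : M.ι) (i : Fin 2) (φ : M.Φ₀ k) : Plane → ℝ :=
  pfn ((M.elem j).l2Proj (k - 1) (wd i (φ : H1 Ω)))

/-- `a^E_{p,h}(φ, ξ)`. -/
def aForm (ε : ℝ) (S : ∀ j, LinearMap.BilinForm ℝ ((M.elem j).Vloc k)) (j : M.ι)
    (φ ξ : M.Φ₀ k) : ℝ :=
  (∫ x in ((M.elem j).dom : Set Plane), ε * ∑ i, P0d j i φ x * P0d j i ξ x)
    + ε * S j ((M.elem j).subProj k (loc φ j)) ((M.elem j).subProj k (loc ξ j))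

/-- `c^E_{p,h}(u; φ, ξ)`. -/
def cForm (u : Fin 2 → M.Φ₀ k) (j : M.ι) (φ ξ : M.Φ₀ k) : ℝ :=
  ∫ x in ((M.elem j).dom : Set Plane), (∑ i, P0 j (u i) x * P0d j i φ x) * P0 j ξ x

/-- `c^{skew,E}_{p,h}(u; φ, ξ)`. -/
def cSkew (u : Fin 2 → M.Φ₀ k) (j : M.ι) (φ ξ : M.Φ₀ k) : ℝ :=
  1 / 2 * (cForm u j φ ξ - cForm u j ξ φ)

/-- `d^E_h(φ, ξ)` for the nonlinearity `κ`. -/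
def dForm (κ : ℝ → ℝ) (j : M.ι) (φ ξ : M.Φ₀ k) : ℝ :=
  ∫ x in ((M.elem j).dom : Set Plane), κ (P0 j φ x) * P0 j ξ x

/-- `B_h(u; φ, ξ)`. -/
def bForm (ε : ℝ) (κ : ℝ → ℝ) (S : ∀ j, LinearMap.BilinForm ℝ ((M.elem j).Vloc k))
    (u : Fin 2 → M.Φ₀ k) (φ ξ : M.Φ₀ k) : ℝ :=
  ∑ j, (aForm ε S j φ ξ + cSkew u j φ ξ + dForm κ j φ ξ)

/-- The discrete load `(g_h, ξ)`. -/
def load (g : L2 Ω ℝ) (ξ : M.Φ₀ k) : ℝ :=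
  ∑ j, ∫ x in ((M.elem j).dom : Set Plane), g x * P0 j ξ x

/-- `ψ ∈ Φ_{0,h}` solves the discrete potential problem with velocity `u`:
`B_h(u; ψ, ξ) = (g_h, ξ)` for all `ξ ∈ Φ_{0,h}`. -/
def IsDiscreteSolution (ε : ℝ) (κ : ℝ → ℝ) (S : ∀ j, LinearMap.BilinForm ℝ ((M.elem j).Vloc k))
    (g : L2 Ω ℝ) (u : Fin 2 → M.Φ₀ k) (ψ : M.Φ₀ k) : Prop :=
  ∀ ξ : M.Φ₀ k, bForm ε κ S u ψ ξ = load g ξ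

end Mesh

end VEM

end

open MeasureTheory TopologicalSpace
open scoped ContDiff

noncomputable section

namespace VEM

/-! ### Elements of `H¹` and test functions -/

/-! The discrete problem is a strongly monotone equation in a finite-dimensional space. On the
diagonal the skew convection term cancels. Diffusion and stabilization together dominate `ε * min 1
lo` times the squared gradient norm: `∂ᵢ Π^∇_k φ` lies in `P_{k-1}`, so `∇φ - Π⁰_{k-1}∇φ` is no
larger in `L²` than `∇(φ - Π^∇_k φ)`, which the stabilization controls; Pythagoras adds the
projected part (`le_aForm`). The reaction term is monotone because `κ` is increasing and the same
linear projection `Π⁰_k` acts on its argument and on the test function. With the Poincaré inequality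
this gives uniqueness (`stronglyMonotone`) and, on testing with the solution itself, the a priori
bound (`gradNorm_le_of_isDiscreteSolution`).

Existence has one obstacle: `sinh` is not globally Lipschitz. The a priori bound uses only that the
nonlinearity is monotone and vanishes at `0`, so it is the same for every truncation. In finite
dimensions it bounds all local projections of a solution by some `T`, known in advance. Freezing `κ`
outside `[-T, T]` gives a Lipschitz problem, solved by a contraction
(`exists_eq_of_stronglyMonotone`), and its solution does not feel the freezing.

Two properties of the virtual element space need proof. The energy projection must be unique and
linear even though its boundary condition refers to some representative `γ` of the trace; this rests
on `eq_zero_of_mem_H10`: a function continuous up to the boundary that represents an element of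
`H¹₀` vanishes on the edges. And the space must be finite-dimensional: an element is determined by
its edge polynomials and its Laplacian, by the converse fact `exists_mem_H10_of_frontier` together
with `eq_zero_of_harmonic`. -/

/-- An element of `H¹(Ω)` is determined by its underlying function. -/
theorem H1_ext {Ω : Opens Plane} {φ ψ : H1 Ω}
    (h : fn φ =ᵐ[volume.restrict (Ω : Set Plane)] fn ψ) : φ = ψ := by
  have hwd : ∀ i, wd i φ =ᵐ[volume.restrict (Ω : Set Plane)] wd i ψ := by
    intro i
    have hint : ∀ ζ : H1 Ω, ∀ η, IsTestFunction Ω η →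
        Integrable (fun x => wd i ζ x * η x) (volume.restrict (Ω : Set Plane)) := fun ζ η hη =>
      (memLp_wd i ζ).integrable_mul (hη.memLp _)
    have hloc : LocallyIntegrableOn (fun x => wd i φ x - wd i ψ x) (Ω : Set Plane) volume :=
      locallyIntegrableOn_of_locallyIntegrable_restrict
        (((memLp_wd i φ).sub (memLp_wd i ψ)).locallyIntegrable (by norm_num))
    -- Both weak derivatives have the same integral against every test function, so the fundamental
    -- lemma of the calculus of variations identifies them.
    have key := Ω.isOpen.ae_eq_zero_of_integral_contDiff_smul_eq_zero hloc (fun η h1 h2 h3 => by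
      have hη : IsTestFunction Ω η := ⟨h1, h2, h3⟩
      have e : ∫ x, η x • (wd i φ x - wd i ψ x)
          = ∫ x in (Ω : Set Plane), (wd i φ x * η x - wd i ψ x * η x) := by
        rw [← setIntegral_eq_integral_of_forall_compl_eq_zero (s := (Ω : Set Plane))
          (fun x hx => by rw [hη.eq_zero hx, zero_smul])]
        refine integral_congr_ae (Filter.Eventually.of_forall fun x => ?_)
        simp only [smul_eq_mul]
        ring
      rw [e, integral_sub (hint φ η hη) (hint ψ η hη), sub_eq_zero]
      have a1 := φ.2 η hη i
      have a2 := ψ.2 η hη i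
      have a3 : ∫ x in (Ω : Set Plane), fn φ x * pd i η x
          = ∫ x in (Ω : Set Plane), fn ψ x * pd i η x := by
        refine integral_congr_ae ?_
        filter_upwards [h] with x hx
        rw [hx]
      exact neg_injective (a1.symm.trans (a3.trans a2)))
    rw [Filter.EventuallyEq, ae_restrict_iff' Ω.isOpen.measurableSet]
    filter_upwards [key] with x hx hxΩ
    exact sub_eq_zero.1 (hx hxΩ)
  refine Subtype.ext (Prod.ext (Lp.ext h) (Lp.ext ?_))
  filter_upwards [hwd 0, hwd 1] with x h0 h1
  ext i
  fin_cases i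
  · exact h0
  · exact h1

/-- The classical gradient of a function. -/
def grad (η : Plane → ℝ) (x : Plane) : Plane := WithLp.toLp 2 fun i => pd i η x

lemma IsTestFunction.memLp_grad {Ω : Opens Plane} {η : Plane → ℝ} (h : IsTestFunction Ω η)
    (μ : Measure Plane) [IsFiniteMeasureOnCompacts μ] : MemLp (grad η) 2 μ := by
  have hc : Continuous (grad η) :=
    (PiLp.continuous_toLp 2 _).comp (continuous_pi fun i => h.continuous_pd i)
  refine hc.memLp_of_hasCompactSupport ?_
  refine HasCompactSupport.intro (h.compact) fun x hx => ?_
  ext i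
  have h0 : fderiv ℝ η x = 0 := by
    by_contra hne
    exact hx (support_fderiv_subset ℝ (f := η) hne)
  simp [grad, pd, h0]

lemma IsTestFunction.isWeakGrad {Ω : Opens Plane} {θ : Plane → ℝ} (hθ : IsTestFunction Ω θ) :
    IsWeakGrad Ω θ (grad θ) := by
  intro η hη i
  rw [setIntegral_eq_integral_of_forall_compl_eq_zero
      (fun x hx => by rw [hη.pd_eq_zero i hx, mul_zero]),
    setIntegral_eq_integral_of_forall_compl_eq_zero
      (fun x hx => by rw [hη.eq_zero hx, mul_zero])]
  refine integral_mul_fderiv_eq_neg_fderiv_mul_of_integrable ?_ ?_ ?_ ?_ ?_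
  · exact ((hθ.continuous_pd i).mul hη.smooth.continuous).integrable_of_hasCompactSupport
      hη.compact.mul_left
  · exact (hθ.smooth.continuous.mul (hη.continuous_pd i)).integrable_of_hasCompactSupport
      (hη.compact_pd i).mul_left
  · exact (hθ.smooth.continuous.mul hη.smooth.continuous).integrable_of_hasCompactSupport
      hη.compact.mul_left
  · exact fun x _ => hθ.smooth.differentiable (by simp) x
  · exact fun x _ => hη.smooth.differentiable (by simp) x

/-- A test function as an element of `H¹(Ω)`. -/
def IsTestFunction.toH1 {Ω : Opens Plane} {θ : Plane → ℝ} (hθ : IsTestFunction Ω θ) : H1 Ω :=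
  ⟨((hθ.memLp _).toLp, (hθ.memLp_grad _).toLp), by
    intro η hη i
    refine Eq.trans ?_ ((hθ.isWeakGrad η hη i).trans (congrArg Neg.neg ?_))
    · refine integral_congr_ae ?_
      filter_upwards [(hθ.memLp (volume.restrict (Ω : Set Plane))).coeFn_toLp] with x hx
      exact congrArg (· * pd i η x) hx
    · refine integral_congr_ae ?_
      filter_upwards [(hθ.memLp_grad (volume.restrict (Ω : Set Plane))).coeFn_toLp] with x hx
      exact (congrArg (fun y : Plane => y i * η x) hx).symm⟩

lemma IsTestFunction.fn_toH1 {Ω : Opens Plane} {θ : Plane → ℝ} (hθ : IsTestFunction Ω θ) :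
    fn hθ.toH1 =ᵐ[volume.restrict (Ω : Set Plane)] θ := (hθ.memLp _).coeFn_toLp

lemma IsTestFunction.grad_toH1 {Ω : Opens Plane} {θ : Plane → ℝ} (hθ : IsTestFunction Ω θ) :
    hθ.toH1.1.2 =ᵐ[volume.restrict (Ω : Set Plane)] grad θ := (hθ.memLp_grad _).coeFn_toLp

lemma IsTestFunction.toH1_mem {Ω : Opens Plane} {θ : Plane → ℝ} (hθ : IsTestFunction Ω θ) :
    hθ.toH1 ∈ testSpace Ω := ⟨θ, hθ, hθ.fn_toH1⟩

/-- `testSpace` constrains only the function component; by `H1_ext` the gradient component is then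
the classical gradient. -/
lemma exists_toH1_eq {Ω : Opens Plane} {φ : H1 Ω} (h : φ ∈ testSpace Ω) :
    ∃ θ, ∃ hθ : IsTestFunction Ω θ, φ = hθ.toH1 := by
  obtain ⟨θ, hθ, h⟩ := h
  exact ⟨θ, hθ, H1_ext (h.trans hθ.fn_toH1.symm)⟩

/-- A closed property that holds for test functions holds on `H¹₀(Ω)`. -/
theorem H10_induction {Ω : Opens Plane} {P : H1 Ω → Prop} (hP : IsClosed {φ | P φ})
    (h : ∀ θ (hθ : IsTestFunction Ω θ), P hθ.toH1) {φ : H1 Ω} (hφ : φ ∈ H10 Ω) : P φ := by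
  have hsub : (testSpace Ω : Set (H1 Ω)) ⊆ {φ | P φ} := by
    intro ψ hψ
    obtain ⟨θ, hθ, rfl⟩ := exists_toH1_eq hψ
    exact h θ hθ
  exact closure_minimal hsub hP hφ

/-- The integral is an `L²` inner product with the `i`-th component of the field. It makes the
equations defining a weak gradient closed conditions. -/
lemma continuous_wd_inner {Ω : Opens Plane} {f : Plane → ℝ} (i : Fin 2)
    (hf : MemLp f 2 (volume.restrict (Ω : Set Plane))) :
    Continuous fun G : L2 Ω Plane => ∫ x in (Ω : Set Plane), G x i * f x := by
  have : (fun G : L2 Ω Plane => ∫ x in (Ω : Set Plane), G x i * f x)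
      = fun G => inner ℝ (hf.toLp f)
        ((EuclideanSpace.proj (𝕜 := ℝ) i : Plane →L[ℝ] ℝ).compLp G) := by
    ext G
    rw [L2.inner_def]
    refine integral_congr_ae ?_
    filter_upwards [hf.coeFn_toLp,
      (EuclideanSpace.proj (𝕜 := ℝ) i : Plane →L[ℝ] ℝ).coeFn_compLp G] with x h1 h2
    rw [h1, h2]
    simp
  rw [this]
  exact continuous_const.inner
    (((EuclideanSpace.proj (𝕜 := ℝ) i : Plane →L[ℝ] ℝ).compLpL 2 _).continuous)

lemma continuous_fn_inner {Ω : Opens Plane} {f : Plane → ℝ}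
    (hf : MemLp f 2 (volume.restrict (Ω : Set Plane))) :
    Continuous fun g : L2 Ω ℝ => ∫ x in (Ω : Set Plane), g x * f x := by
  have : (fun g : L2 Ω ℝ => ∫ x in (Ω : Set Plane), g x * f x)
      = fun g => inner ℝ (hf.toLp f) g := by
    ext g
    rw [L2.inner_def]
    refine integral_congr_ae ?_
    filter_upwards [hf.coeFn_toLp] with x h1
    rw [h1]
    simp
  rw [this]
  exact continuous_const.inner continuous_id

/-- `H¹(Ω)` is closed in `L²(Ω) × L²(Ω; ℝ²)`. -/
theorem isClosed_H1 (Ω : Opens Plane) : IsClosed (H1 Ω : Set (L2 Ω ℝ × L2 Ω Plane)) := by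
  have : (H1 Ω : Set (L2 Ω ℝ × L2 Ω Plane)) = ⋂ η, ⋂ (_ : IsTestFunction Ω η), ⋂ i : Fin 2,
      {p | ∫ x in (Ω : Set Plane), p.1 x * pd i η x = -∫ x in (Ω : Set Plane), p.2 x i * η x} := by
    ext p
    simp only [Set.mem_iInter, Set.mem_ofPred_eq]
    rfl
  rw [this]
  refine isClosed_iInter fun η => isClosed_iInter fun hη => isClosed_iInter fun i => ?_
  exact isClosed_eq ((continuous_fn_inner (hη.memLp_pd i _)).comp continuous_fst)
    ((continuous_wd_inner i (hη.memLp _)).comp continuous_snd).neg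

/-! ### Poincaré inequalities -/

lemma IsTestFunction.fderiv_apply {Ω : Opens Plane} {η : Plane → ℝ} (_ : IsTestFunction Ω η)
    (x v : Plane) : fderiv ℝ η x v = inner ℝ (grad η x) v := by
  have hv : v = ∑ i, v i • EuclideanSpace.single i (1 : ℝ) := by
    ext j
    fin_cases j <;> simp [Fin.sum_univ_two]
  conv_lhs => rw [hv]
  simp only [map_sum, map_smul, smul_eq_mul, PiLp.inner_apply, grad, pd]
  simp

/-- A function that vanishes somewhere on a segment is controlled by its derivative there. -/
lemma enorm_sq_le_of_eq_zero {f f' : ℝ → ℝ} (hf : ∀ s, HasDerivAt f (f' s) s)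
    (hc : Continuous f') {s : ℝ} (hs : s ∈ Set.Icc (0 : ℝ) 1) (h0 : f s = 0) :
    ‖f 0‖ₑ ^ 2 ≤ ∫⁻ t in Set.Icc (0 : ℝ) 1, ‖f' t‖ₑ ^ 2 := by
  -- Total mass one makes the `L¹` norm at most the `L²` norm, with no extra constant.
  have : IsProbabilityMeasure (volume.restrict (Set.Icc (0 : ℝ) 1)) := ⟨by simp⟩
  have e1 : ‖f 0‖ₑ ≤ ∫⁻ t in Set.Icc (0 : ℝ) 1, ‖f' t‖ₑ := by
    have h := intervalIntegral.integral_eq_sub_of_hasDerivAt (a := 0) (b := s)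
      (fun x _ => hf x) (hc.intervalIntegrable _ _)
    rw [h0, zero_sub] at h
    rw [← enorm_neg, ← h, intervalIntegral.integral_of_le hs.1]
    refine (enorm_integral_le_lintegral_enorm _).trans ?_
    refine lintegral_mono_set ?_
    exact Set.Ioc_subset_Icc_self.trans (Set.Icc_subset_Icc le_rfl hs.2)
  have e2 := eLpNorm_le_eLpNorm_of_exponent_le (p := 1) (q := 2) (by norm_num)
    (hc.aestronglyMeasurable (μ := volume.restrict (Set.Icc (0 : ℝ) 1)))
  rw [eLpNorm_one_eq_lintegral_enorm] at e2
  calc ‖f 0‖ₑ ^ 2 ≤ (eLpNorm f' 2 (volume.restrict (Set.Icc (0 : ℝ) 1))) ^ 2 := by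
        gcongr; exact e1.trans e2
    _ = _ := by
        rw [eLpNorm_eq_lintegral_rpow_enorm_toReal (by norm_num) (by norm_num)]
        simp only [ENNReal.toReal_ofNat, ENNReal.rpow_ofNat, one_div]
        rw [← ENNReal.rpow_natCast, ← ENNReal.rpow_mul]
        norm_num

/-- If every point of `A` is joined to a point outside of `U` by a piece of a segment in direction
`v` that lies in `B`, then test functions on `U` are controlled on `A` by their gradient on `B`. -/
lemma IsTestFunction.eLpNorm_le {U : Opens Plane} {η : Plane → ℝ} (hη : IsTestFunction U η)
    {A B : Set Plane} (hA : MeasurableSet A) (hB : MeasurableSet B) (v : Plane)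
    (hv : ∀ y ∈ A, ∃ s ∈ Set.Icc (0 : ℝ) 1, y + s • v ∉ U)
    (hAB : ∀ y ∈ A, ∀ s ∈ Set.Icc (0 : ℝ) 1, y + s • v ∈ B) :
    eLpNorm η 2 (volume.restrict A) ≤ ‖v‖ₑ * eLpNorm (grad η) 2 (volume.restrict B) := by
  set D : Plane → ℝ := fun x => fderiv ℝ η x v with hD
  have hDc : Continuous D := (hη.smooth.continuous_fderiv (by simp)).clm_apply continuous_const
  have key : ∫⁻ y in A, ‖η y‖ₑ ^ 2 ≤ ∫⁻ x in B, ‖D x‖ₑ ^ 2 := by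
    -- The one-dimensional bound is applied along each segment `y + s • v`, which meets a zero of
    -- `η`, and then integrated over `A`.
    calc ∫⁻ y in A, ‖η y‖ₑ ^ 2
        ≤ ∫⁻ y in A, ∫⁻ s in Set.Icc (0 : ℝ) 1, ‖D (y + s • v)‖ₑ ^ 2 := by
          refine setLIntegral_mono' hA fun y hy => ?_
          obtain ⟨s, hs, hsU⟩ := hv y hy
          have h := enorm_sq_le_of_eq_zero (f := fun s : ℝ => η (y + s • v))
            (f' := fun s => D (y + s • v)) (fun t => ?_) (hDc.comp (by fun_prop)) hs
            (hη.eq_zero hsU)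
          · simpa using h
          · have h1 : HasDerivAt (fun t : ℝ => y + t • v) v t := by
              simpa using ((hasDerivAt_id t).smul_const v).const_add y
            exact ((hη.smooth.differentiable (by simp) (y + t • v)).hasFDerivAt).comp_hasDerivAt
              t h1
      _ = ∫⁻ s in Set.Icc (0 : ℝ) 1, ∫⁻ y in A, ‖D (y + s • v)‖ₑ ^ 2 := by
          refine lintegral_lintegral_swap ?_
          refine Measurable.aemeasurable ?_
          refine Continuous.measurable ?_
          have : Continuous fun p : Plane × ℝ => D (p.1 + p.2 • v) := hDc.comp (by fun_prop)
          exact (ENNReal.continuous_pow 2).comp this.enorm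
      -- For fixed `s` the translation by `s • v` preserves volume and maps `A` into `B`.
      _ ≤ ∫⁻ s in Set.Icc (0 : ℝ) 1, ∫⁻ x in B, ‖D x‖ₑ ^ 2 := by
          refine setLIntegral_mono' measurableSet_Icc fun s hs => ?_
          rw [← lintegral_indicator hA, ← lintegral_indicator hB,
            ← lintegral_add_right_eq_self (B.indicator fun x => ‖D x‖ₑ ^ 2) (s • v)]
          refine lintegral_mono fun y => ?_
          by_cases hy : y ∈ A
          · simp [hy, hAB y hy s hs]
          · simp [hy]
      _ = _ := by simp
  have hDle : eLpNorm D 2 (volume.restrict B) ≤ ‖v‖ₑ * eLpNorm (grad η) 2 (volume.restrict B) := by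
    have := eLpNorm_le_mul_eLpNorm_of_ae_le_mul (μ := volume.restrict B) (f := D) (g := grad η)
      (c := ‖v‖) (Filter.Eventually.of_forall fun x => by
        simp only [hD]
        rw [hη.fderiv_apply, mul_comm]
        exact norm_inner_le_norm _ _) 2
    rwa [ofReal_norm] at this
  refine le_trans ?_ hDle
  rw [eLpNorm_eq_lintegral_rpow_enorm_toReal (by norm_num) (by norm_num),
    eLpNorm_eq_lintegral_rpow_enorm_toReal (by norm_num) (by norm_num)]
  simp only [ENNReal.toReal_ofNat, ENNReal.rpow_ofNat]
  gcongr

/-- The restriction of an `L²` function to a measurable subset. -/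
abbrev cut {U : Opens Plane} (F : Type) [NormedAddCommGroup F] [NormedSpace ℝ F] (A : Set Plane) :
    L2 U F →L[ℝ] Lp F 2 ((volume.restrict (U : Set Plane)).restrict A) :=
  LpToLpRestrictCLM Plane F ℝ (volume.restrict (U : Set Plane)) 2 A

/-- The local Poincaré inequality on `H¹₀(U)`. -/
theorem norm_cut_le {U : Opens Plane} {φ : H1 U} (hφ : φ ∈ H10 U) {A B : Set Plane}
    (hA : MeasurableSet A) (hB : MeasurableSet B) (v : Plane)
    (hv : ∀ y ∈ A, ∃ s ∈ Set.Icc (0 : ℝ) 1, y + s • v ∉ U)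
    (hAB : ∀ y ∈ A, ∀ s ∈ Set.Icc (0 : ℝ) 1, y + s • v ∈ B) :
    ‖cut ℝ A φ.1.1‖ ≤ ‖v‖ * ‖cut Plane B φ.1.2‖ := by
  refine H10_induction (P := fun φ : H1 U => ‖cut ℝ A φ.1.1‖ ≤ ‖v‖ * ‖cut Plane B φ.1.2‖)
    (isClosed_le (by fun_prop) (by fun_prop)) (fun θ hθ => ?_) hφ
  have e1 : cut ℝ A hθ.toH1.1.1 =ᵐ[(volume.restrict (U : Set Plane)).restrict A] θ :=
    (LpToLpRestrictCLM_coeFn ℝ A _).trans (ae_restrict_of_ae hθ.fn_toH1)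
  have e2 : cut Plane B hθ.toH1.1.2 =ᵐ[(volume.restrict (U : Set Plane)).restrict B] grad θ :=
    (LpToLpRestrictCLM_coeFn ℝ B _).trans (ae_restrict_of_ae hθ.grad_toH1)
  rw [Lp.norm_def, Lp.norm_def, eLpNorm_congr_ae e1, eLpNorm_congr_ae e2, ← toReal_enorm v,
    ← ENNReal.toReal_mul]
  refine ENNReal.toReal_mono (ENNReal.mul_ne_top (by simp)
    ((hθ.memLp_grad _).restrict B).eLpNorm_ne_top) ?_
  have h := hθ.eLpNorm_le hA hB v hv hAB
  -- The gradient of a test function on `U` vanishes outside `U`, so `B` may stick out of `U`.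
  have e3 : eLpNorm (grad θ) 2 (volume.restrict B)
      = eLpNorm (grad θ) 2 ((volume.restrict (U : Set Plane)).restrict B) := by
    have hind : grad θ = (U : Set Plane).indicator (grad θ) := by
      refine (Set.indicator_eq_self.2 fun x hx => ?_).symm
      by_contra hxU
      refine hx ?_
      ext i
      exact hθ.pd_eq_zero i hxU
    conv_lhs => rw [hind]
    rw [eLpNorm_indicator_eq_eLpNorm_restrict U.isOpen.measurableSet,
      Measure.restrict_comm hB]
  rw [← e3]
  refine le_trans ?_ h
  rw [Measure.restrict_restrict hA]
  exact eLpNorm_mono_measure _ (Measure.restrict_mono_set _ Set.inter_subset_left)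

/-- A translation longer than the diameter moves every point of a bounded set out of it, so the
local inequality applies with `A = U` and `B` the whole plane. -/
theorem exists_poincare (U : Opens Plane) (hU : Bornology.IsBounded (U : Set Plane)) :
    ∃ C, 0 ≤ C ∧ ∀ φ ∈ H10 U, l2norm φ ≤ C * gradNorm φ := by
  obtain ⟨R, hR⟩ := hU.subset_closedBall 0
  -- The length exceeds the diameter of the ball of radius `R`; the absolute value covers a negative
  -- `R`, possible when `U` is empty.
  set v : Plane := EuclideanSpace.single 0 (2 * |R| + 1) with hvdef
  have hvn : ‖v‖ = 2 * |R| + 1 := by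
    rw [hvdef, PiLp.norm_single, Real.norm_eq_abs, abs_of_nonneg (by positivity)]
  refine ⟨‖v‖, norm_nonneg v, fun φ hφ => ?_⟩
  have h := norm_cut_le hφ U.isOpen.measurableSet MeasurableSet.univ v (fun y hy => ?_)
    (fun _ _ _ _ => Set.mem_univ _)
  · have e : ‖φ.1.1‖ = ‖cut ℝ (U : Set Plane) φ.1.1‖ := by
      rw [Lp.norm_def, Lp.norm_def, eLpNorm_congr_ae (LpToLpRestrictCLM_coeFn ℝ _ _),
        Measure.restrict_restrict U.isOpen.measurableSet, Set.inter_self]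
    refine e.le.trans (h.trans ?_)
    gcongr
    exact norm_Lp_toLp_restrict_le _ _
  · refine ⟨1, by simp, fun h1 => ?_⟩
    have b1 : ‖y‖ ≤ R := by simpa using hR hy
    have b2 : ‖y + (1 : ℝ) • v‖ ≤ R := by simpa using hR h1
    have b3 : ‖v‖ ≤ 2 * R := by
      calc ‖v‖ = ‖(y + (1 : ℝ) • v) - y‖ := by simp
        _ ≤ _ := (norm_sub_le _ _).trans (by linarith)
    rw [hvn] at b3
    linarith [le_abs_self R]

/-- The admissible constants form a closed nonempty set bounded below, so the infimum is attained.
-/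
theorem l2norm_le_poincareConst {U : Opens Plane} (hU : Bornology.IsBounded (U : Set Plane))
    {φ : H1 U} (hφ : φ ∈ H10 U) : l2norm φ ≤ poincareConst U * gradNorm φ := by
  have hcl : IsClosed {C : ℝ | 0 ≤ C ∧ ∀ φ ∈ H10 U, l2norm φ ≤ C * gradNorm φ} := by
    simp only [Set.ofPred_and, Set.ofPred_forall]
    refine isClosed_Ici.inter (isClosed_iInter fun ψ => isClosed_iInter fun _ => ?_)
    exact isClosed_le continuous_const (by fun_prop)
  exact (hcl.csInf_mem (exists_poincare U hU) ⟨0, fun C hC => hC.1⟩).2 φ hφ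

theorem poincareConst_nonneg (U : Opens Plane) : 0 ≤ poincareConst U :=
  Real.sInf_nonneg fun _ hC => hC.1

/-! ### Lipschitz functions vanishing on the boundary belong to `H¹₀` -/

/-- In a Hilbert space, suitable convex combinations of the tails of a bounded sequence converge. -/
theorem exists_mem_convexHull_tendsto {X : Type*} [NormedAddCommGroup X] [InnerProductSpace ℝ X]
    [CompleteSpace X] (x : ℕ → X) (C : ℝ) (hx : ∀ n, ‖x n‖ ≤ C) :
    ∃ (y : ℕ → X) (l : X), (∀ n, y n ∈ convexHull ℝ (x '' Set.Ici n)) ∧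
      Filter.Tendsto y Filter.atTop (nhds l) := by
  set K : ℕ → Set X := fun n => closure (convexHull ℝ (x '' Set.Ici n)) with hK
  have hne : ∀ n, (convexHull ℝ (x '' Set.Ici n)).Nonempty := fun n =>
    ⟨x n, subset_convexHull ℝ _ ⟨n, Set.self_mem_Ici, rfl⟩⟩
  have hconv : ∀ n, Convex ℝ (K n) := fun n => (convex_convexHull ℝ _).closure
  have hanti : ∀ n m, n ≤ m → K m ⊆ K n := fun n m h =>
    closure_mono (convexHull_mono (Set.image_mono (Set.Ici_subset_Ici.2 h)))
  have hxK : ∀ n, x n ∈ K n := fun n =>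
    subset_closure (subset_convexHull ℝ _ ⟨n, Set.self_mem_Ici, rfl⟩)
  -- The points of least norm in the decreasing closed convex sets `K n` have increasing norms,
  -- bounded by `C`; the parallelogram law turns this into a Cauchy sequence.
  have hz : ∀ n, ∃ z ∈ K n, ∀ w ∈ K n, ‖z‖ ≤ ‖w‖ := by
    intro n
    obtain ⟨z, hz, h⟩ := exists_norm_eq_iInf_of_complete_convex (hne n).closure
      isClosed_closure.isComplete (hconv n) 0
    refine ⟨z, hz, fun w hw => ?_⟩
    have h2 : ⨅ w : K n, ‖(0 : X) - w‖ ≤ ‖(0 : X) - w‖ :=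
      ciInf_le (f := fun w : K n => ‖(0 : X) - w‖)
        ⟨0, Set.forall_mem_range.2 fun _ => norm_nonneg _⟩ ⟨w, hw⟩
    have h3 := h.trans_le h2
    simpa using h3
  choose z hzK hzmin using hz
  have hmono : Monotone fun n => ‖z n‖ ^ 2 := fun n m h =>
    pow_le_pow_left₀ (norm_nonneg _) (hzmin n _ (hanti n m h (hzK m))) 2
  have hbdd : BddAbove (Set.range fun n => ‖z n‖ ^ 2) := by
    refine ⟨C ^ 2, ?_⟩
    rintro _ ⟨n, rfl⟩
    exact pow_le_pow_left₀ (norm_nonneg _) ((hzmin n _ (hxK n)).trans (hx n)) 2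
  have hcau := (tendsto_atTop_ciSup hmono hbdd).cauchySeq
  have hdist : ∀ n m, n ≤ m → ‖z n - z m‖ ^ 2 ≤ 2 * (‖z m‖ ^ 2 - ‖z n‖ ^ 2) := by
    intro n m h
    -- The midpoint lies in `K n`, so its norm is at least `‖z n‖`.
    have hmid : (1 / 2 : ℝ) • z n + (1 / 2 : ℝ) • z m ∈ K n :=
      hconv n (hzK n) (hanti n m h (hzK m)) (by norm_num) (by norm_num) (by norm_num)
    have h1 := hzmin n _ hmid
    rw [← smul_add, norm_smul] at h1
    have h2 := parallelogram_law_with_norm ℝ (z n) (z m)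
    norm_num at h1
    nlinarith [norm_nonneg (z n), norm_nonneg (z n + z m)]
  have hzc : CauchySeq z := by
    rw [Metric.cauchySeq_iff]
    intro ε hε
    obtain ⟨N, hN⟩ := Metric.cauchySeq_iff.1 hcau (ε ^ 2 / 2) (by positivity)
    have main : ∀ n m, N ≤ n → n ≤ m → dist (z n) (z m) < ε := by
      intro n m hn hnm
      have h1 := hN m (hn.trans hnm) n hn
      rw [Real.dist_eq] at h1
      have h2 := hdist n m hnm
      have h3 := (abs_lt.1 h1).2
      rw [dist_eq_norm]
      refine lt_of_pow_lt_pow_left₀ 2 hε.le ?_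
      linarith
    refine ⟨N, fun m hm n hn => ?_⟩
    rcases le_total m n with h | h
    · exact main m n hm h
    · rw [dist_comm]; exact main n m hn h
  obtain ⟨l, hl⟩ := cauchySeq_tendsto_of_complete hzc
  -- The `z n` lie only in the closures; nearby points of the hulls themselves have the same limit.
  have hy : ∀ n : ℕ, ∃ y ∈ convexHull ℝ (x '' Set.Ici n), dist (z n) y < 1 / ((n : ℝ) + 1) :=
    fun n => Metric.mem_closure_iff.1 (hzK n) _ (by positivity)
  choose y hyK hyd using hy
  refine ⟨y, l, hyK, ?_⟩
  have hlim : Filter.Tendsto (fun n => dist (z n) (y n)) Filter.atTop (nhds 0) :=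
    squeeze_zero (fun _ => dist_nonneg) (fun n => (hyd n).le) tendsto_one_div_add_atTop_nhds_zero_nat
  exact (tendsto_iff_of_dist hlim).1 hl

open scoped Convolution in
/-- Mollification of a compactly supported Lipschitz function. -/
theorem exists_isTestFunction_approx {U : Opens Plane} {f : Plane → ℝ} {K : NNReal}
    (hf : LipschitzWith K f) (hc : HasCompactSupport f) (hU : tsupport f ⊆ U) {δ : ℝ}
    (hδ : 0 < δ) :
    ∃ η, IsTestFunction U η ∧ (∀ x, |η x - f x| ≤ δ) ∧ LipschitzWith K η := by
  obtain ⟨r, hr, hrU⟩ := hc.exists_cthickening_subset_open U.isOpen hU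
  -- The first bound keeps the support in `U`; the second gives `K * ρ ≤ δ`, with `K + 1` to allow
  -- `K = 0`.
  set ρ : ℝ := min r (δ / (K + 1)) with hρ
  have hρ0 : 0 < ρ := lt_min hr (by positivity)
  let b : ContDiffBump (0 : Plane) := ⟨ρ / 2, ρ, by positivity, by linarith⟩
  have hbc : HasCompactSupport (b.normed volume) := b.hasCompactSupport_normed
  set η : Plane → ℝ := (b.normed volume) ⋆[ContinuousLinearMap.lsmul ℝ ℝ, volume] f with hη
  have hint : ∀ x, Integrable (fun t => b.normed volume t * f (x - t)) := fun x =>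
    (b.continuous_normed.mul (hf.continuous.comp (by fun_prop))).integrable_of_hasCompactSupport
      hbc.mul_right
  have hηdef : ∀ x, η x = ∫ t, b.normed volume t * f (x - t) := fun x => rfl
  have hts : tsupport η ⊆ Metric.cthickening r (tsupport f) := by
    refine closure_minimal ?_ Metric.isClosed_cthickening
    refine (support_convolution_subset _).trans ?_
    rintro _ ⟨a, ha, c, hcs, rfl⟩
    rw [b.support_normed_eq] at ha
    refine Metric.mem_cthickening_of_dist_le _ c r _ (subset_tsupport f hcs) ?_
    have h1 : ‖a‖ < ρ := by simpa [b] using ha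
    have h2 : dist (a + c) c = ‖a‖ := by rw [dist_eq_norm, add_sub_cancel_right]
    exact h2.le.trans (h1.le.trans (min_le_left _ _))
  refine ⟨η, ⟨?_, ?_, hts.trans hrU⟩, ?_, ?_⟩
  · exact hbc.contDiff_convolution_left _ b.contDiff_normed hf.continuous.locallyIntegrable
  · exact HasCompactSupport.of_support_subset_isCompact hc.isCompact.cthickening
      ((subset_tsupport η).trans hts)
  · intro x
    rw [← Real.dist_eq]
    refine b.dist_normed_convolution_le hf.continuous.aestronglyMeasurable fun y hy => ?_
    have h1 : dist y x < ρ := hy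
    calc dist (f y) (f x) ≤ K * dist y x := hf.dist_le_mul _ _
      _ ≤ K * (δ / (K + 1)) := by gcongr; exact h1.le.trans (min_le_right _ _)
      _ ≤ δ := by
          rw [mul_div_assoc', div_le_iff₀ (by positivity)]
          nlinarith
  -- Convolution with a probability density averages translates of `f`, all with the same Lipschitz
  -- constant.
  · refine LipschitzWith.of_dist_le_mul fun x y => ?_
    rw [Real.dist_eq, hηdef, hηdef, ← integral_sub (hint x) (hint y), ← Real.norm_eq_abs]
    have hb : ∫ t, b.normed volume t * (K * dist x y) = K * dist x y := by
      rw [integral_mul_const, b.integral_normed, one_mul]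
    rw [← hb]
    refine norm_integral_le_of_norm_le (b.integrable_normed.mul_const _)
      (Filter.Eventually.of_forall fun t => ?_)
    rw [← mul_sub, norm_mul, Real.norm_of_nonneg (b.nonneg_normed t)]
    refine mul_le_mul_of_nonneg_left ?_ (b.nonneg_normed t)
    have := hf.dist_le_mul (x - t) (y - t)
    rwa [Real.dist_eq, dist_sub_right] at this

/-- Shrinking towards zero by `ε`. -/
def shrink (ε t : ℝ) : ℝ := max (t - ε) 0 + min (t + ε) 0

/-- Each summand is 1-Lipschitz. The constant 2 is not sharp; what matters is that it does not
depend on `ε`. -/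
lemma lipschitzWith_shrink (ε : ℝ) : LipschitzWith 2 (shrink ε) := by
  have h1 : LipschitzWith 1 fun t : ℝ => max (t - ε) 0 :=
    (LipschitzWith.of_dist_le_mul fun x y => by simp).max_const 0
  have h2 : LipschitzWith 1 fun t : ℝ => min (t + ε) 0 :=
    (LipschitzWith.of_dist_le_mul fun x y => by simp).min_const 0
  have := h1.add h2
  rwa [one_add_one_eq_two] at this

lemma abs_shrink_sub_le {ε : ℝ} (hε : 0 ≤ ε) (t : ℝ) : |shrink ε t - t| ≤ ε := by
  unfold shrink
  rw [abs_le]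
  rcases le_total (t - ε) 0 with h | h <;> rcases le_total (t + ε) 0 with h' | h' <;>
    simp only [max_eq_left, max_eq_right, min_eq_left, min_eq_right, h, h'] <;>
    constructor <;> linarith

lemma shrink_eq_zero {ε t : ℝ} (h : |t| ≤ ε) : shrink ε t = 0 := by
  unfold shrink
  obtain ⟨h1, h2⟩ := abs_le.1 h
  rw [max_eq_right (by linarith), min_eq_right (by linarith), add_zero]

/-- A set that misses the frontier is covered by the disjoint open sets `U` and the complement of
its closure. It is used for segments that leave `U` and for half-discs at an edge. -/
lemma subset_of_isPreconnected_of_frontier {X : Type*} [TopologicalSpace X] {S U : Set X}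
    (hS : IsPreconnected S) (hU : IsOpen U) (hSU : (S ∩ U).Nonempty)
    (h : ∀ z ∈ S, z ∉ frontier U) : S ⊆ U := by
  refine hS.subset_left_of_subset_union hU (v := (closure U)ᶜ) isClosed_closure.isOpen_compl
    ?_ ?_ hSU
  · exact disjoint_compl_right.mono_left subset_closure
  · intro z hz
    by_cases hzU : z ∈ U
    · exact Or.inl hzU
    · refine Or.inr fun hzc => h z hz ?_
      rw [hU.frontier_eq]
      exact ⟨hzc, hzU⟩

lemma exists_mem_segment_frontier {X : Type*} [AddCommGroup X] [Module ℝ X] [TopologicalSpace X]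
    [ContinuousAdd X] [ContinuousSMul ℝ X] {U : Set X} (hU : IsOpen U) {x y : X}
    (hx : x ∈ U) (hy : y ∉ U) : ∃ z ∈ segment ℝ x y, z ∈ frontier U := by
  by_contra! h
  exact hy (subset_of_isPreconnected_of_frontier (convex_segment x y).isPreconnected hU
    ⟨x, left_mem_segment ℝ x y, hx⟩ h (right_mem_segment ℝ x y))

/-- The extension by zero of a Lipschitz function that vanishes on the boundary. -/
lemma lipschitzWith_indicator {U : Opens Plane} {γ : Plane → ℝ} {K : NNReal}
    (hγ : LipschitzOnWith K γ (closure (U : Set Plane)))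
    (h0 : ∀ x ∈ frontier (U : Set Plane), γ x = 0) :
    LipschitzWith K ((U : Set Plane).indicator γ) := by
  have main : ∀ x y, x ∈ U → y ∉ U → |γ x| ≤ K * dist x y := by
    intro x y hx hy
    -- Where the segment crosses the frontier `γ` vanishes, and the crossing point is no farther
    -- from `x` than `y` is.
    obtain ⟨z, hz, hzf⟩ := exists_mem_segment_frontier U.isOpen hx hy
    have h1 := hγ.dist_le_mul x (subset_closure hx) z (frontier_subset_closure hzf)
    rw [h0 z hzf, Real.dist_eq, sub_zero] at h1
    refine h1.trans ?_
    gcongr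
    have := dist_add_dist_of_mem_segment hz
    linarith [dist_nonneg (x := z) (y := y)]
  refine LipschitzWith.of_dist_le_mul fun x y => ?_
  by_cases hx : x ∈ (U : Set Plane) <;> by_cases hy : y ∈ (U : Set Plane)
  · rw [Set.indicator_of_mem hx, Set.indicator_of_mem hy]
    exact hγ.dist_le_mul x (subset_closure hx) y (subset_closure hy)
  · rw [Set.indicator_of_mem hx, Set.indicator_of_notMem hy, Real.dist_eq, sub_zero]
    exact main x y hx hy
  · rw [Set.indicator_of_notMem hx, Set.indicator_of_mem hy, dist_comm, Real.dist_eq, sub_zero,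
      dist_comm]
    exact main y x hy hx
  · rw [Set.indicator_of_notMem hx, Set.indicator_of_notMem hy, dist_self]
    positivity

/-- Shrinking the values of the zero extension by `δ / 2` moves its support into `{δ / 2 ≤ |f|}`, a
compact subset of `U`; mollification may then spend the other `δ / 2`. The factor 2 comes from
`shrink`. -/
lemma exists_isTestFunction_approx_of_frontier {U : Opens Plane}
    (hU : Bornology.IsBounded (U : Set Plane)) {γ : Plane → ℝ} {K : NNReal}
    (hγ : LipschitzOnWith K γ (closure (U : Set Plane)))
    (h0 : ∀ x ∈ frontier (U : Set Plane), γ x = 0) {δ : ℝ} (hδ : 0 < δ) :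
    ∃ η, IsTestFunction U η ∧ (∀ x ∈ U, |η x - γ x| ≤ δ) ∧ LipschitzWith (2 * K) η := by
  set f : Plane → ℝ := (U : Set Plane).indicator γ with hf
  have hfL := lipschitzWith_indicator hγ h0
  have hsupp : tsupport (fun x => shrink (δ / 2) (f x)) ⊆ {x | δ / 2 ≤ |f x|} := by
    refine closure_minimal (fun x hx => ?_)
      (isClosed_le continuous_const hfL.continuous.abs)
    by_contra hlt
    exact hx (shrink_eq_zero (not_le.1 hlt).le)
  have hsub : {x | δ / 2 ≤ |f x|} ⊆ (U : Set Plane) := by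
    intro x hx
    by_contra hxU
    have : δ / 2 ≤ |f x| := hx
    rw [hf, Set.indicator_of_notMem hxU, abs_zero] at this
    linarith
  have hcomp : HasCompactSupport fun x => shrink (δ / 2) (f x) :=
    Metric.isCompact_of_isClosed_isBounded (isClosed_tsupport _)
      (hU.subset (hsupp.trans hsub))
  obtain ⟨η, hη, hηa, hηL⟩ := exists_isTestFunction_approx
    ((lipschitzWith_shrink (δ / 2)).comp hfL) hcomp (hsupp.trans hsub) (half_pos hδ)
  refine ⟨η, hη, fun x hx => ?_, hηL⟩
  have h1 := hηa x
  have h2 := abs_shrink_sub_le (half_pos hδ).le (f x)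
  have h3 : f x = γ x := Set.indicator_of_mem (s := (U : Set Plane)) hx γ
  rw [← h3]
  refine (abs_sub_le _ (shrink (δ / 2) (f x)) _).trans ?_
  simp only [Function.comp_apply] at h1
  linarith

lemma IsTestFunction.norm_grad_le {U : Opens Plane} {η : Plane → ℝ} (hη : IsTestFunction U η)
    {K : NNReal} (h : LipschitzWith K η) (x : Plane) : ‖grad η x‖ ≤ K := by
  have h1 : ‖grad η x‖ ^ 2 ≤ K * ‖grad η x‖ := by
    rw [← real_inner_self_eq_norm_sq, ← hη.fderiv_apply]
    refine (le_abs_self _).trans ?_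
    refine ((fderiv ℝ η x).le_opNorm (grad η x)).trans ?_
    gcongr
    exact norm_fderiv_le_of_lipschitz ℝ h
  by_contra! hlt
  nlinarith [K.coe_nonneg]

/-- A Lipschitz function that vanishes on the boundary belongs to `H¹₀`. -/
theorem exists_mem_H10_of_frontier {U : Opens Plane}
    (hU : Bornology.IsBounded (U : Set Plane)) {γ : Plane → ℝ} {K : NNReal}
    (hγ : LipschitzOnWith K γ (closure (U : Set Plane)))
    (h0 : ∀ x ∈ frontier (U : Set Plane), γ x = 0) :
    ∃ z ∈ H10 U, fn z =ᵐ[volume.restrict (U : Set Plane)] γ := by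
  have hfin : IsFiniteMeasure (volume.restrict (U : Set Plane)) :=
    ⟨by rw [Measure.restrict_apply_univ]; exact hU.measure_lt_top⟩
  set f : Plane → ℝ := (U : Set Plane).indicator γ with hf
  have hfL : LipschitzWith K f := lipschitzWith_indicator hγ h0
  have hfc : HasCompactSupport f := by
    refine HasCompactSupport.intro (hU.isCompact_closure) fun x hx => ?_
    exact Set.indicator_of_notMem (fun h => hx (subset_closure h)) γ
  have hfγ : f =ᵐ[volume.restrict (U : Set Plane)] γ := by
    filter_upwards [ae_restrict_mem U.isOpen.measurableSet] with x hx
    exact Set.indicator_of_mem hx γ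
  have hfLp : MemLp f 2 (volume.restrict (U : Set Plane)) :=
    hfL.continuous.memLp_of_hasCompactSupport hfc
  -- These test functions converge uniformly, hence in `L²` as `U` has finite measure, but their
  -- gradients are only bounded.
  have happ : ∀ n : ℕ, ∃ η, IsTestFunction U η ∧ (∀ x ∈ U, |η x - γ x| ≤ 1 / ((n : ℝ) + 1)) ∧
      LipschitzWith (2 * K) η := fun n =>
    exists_isTestFunction_approx_of_frontier hU hγ h0 (by positivity)
  choose η hη hηa hηL using happ
  set V : ℝ := (volume.restrict (U : Set Plane)).real Set.univ ^ (ENNReal.toReal 2)⁻¹ with hV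
  have hV0 : 0 ≤ V := by positivity
  have hG : ∀ n, ‖(hη n).toH1.1.2‖ ≤ V * (2 * K : NNReal) := fun n => by
    refine Lp.norm_le_of_ae_bound (by positivity) ?_
    filter_upwards [(hη n).grad_toH1] with x hx
    rw [hx]
    exact (hη n).norm_grad_le (hηL n) x
  have hF : ∀ n, ‖(hη n).toH1.1.1 - hfLp.toLp f‖ ≤ V * (1 / ((n : ℝ) + 1)) := fun n => by
    refine Lp.norm_le_of_ae_bound (by positivity) ?_
    filter_upwards [(hη n).fn_toH1, hfLp.coeFn_toLp, hfγ, Lp.coeFn_sub (hη n).toH1.1.1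
      (hfLp.toLp f), ae_restrict_mem U.isOpen.measurableSet] with x h1 h2 h3 h4 hx
    rw [h4, Pi.sub_apply, h2, h3]
    have h1' : (hη n).toH1.1.1 x = η n x := h1
    rw [h1']
    exact hηa n x hx
  -- Convex combinations of the tails make the gradients converge strongly.
  obtain ⟨y, l, hy, hl⟩ := exists_mem_convexHull_tendsto (fun n => (hη n).toH1.1.2) _ hG
  have hζ : ∀ n : ℕ, ∃ ζ ∈ testSpace U, ‖ζ.1.1 - hfLp.toLp f‖ ≤ V * (1 / ((n : ℝ) + 1)) ∧
      ζ.1.2 = y n := by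
    intro n
    let L1 : H1 U →ₗ[ℝ] L2 U ℝ := LinearMap.fst ℝ _ _ ∘ₗ (H1 U).subtype
    let L2' : H1 U →ₗ[ℝ] L2 U Plane := LinearMap.snd ℝ _ _ ∘ₗ (H1 U).subtype
    -- `T` is convex, so the same combinations of the test functions stay in `testSpace` and just as
    -- close to `f` in `L²`.
    set T : Set (H1 U) := (testSpace U : Set (H1 U)) ∩
      L1 ⁻¹' Metric.closedBall (hfLp.toLp f) (V * (1 / ((n : ℝ) + 1))) with hT
    have hTc : Convex ℝ T :=
      (testSpace U).convex.inter ((convex_closedBall _ _).linear_preimage L1)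
    have hsub : convexHull ℝ ((fun n => (hη n).toH1.1.2) '' Set.Ici n) ⊆ L2' '' T := by
      refine convexHull_min ?_ (hTc.linear_image L2')
      rintro _ ⟨m, hm, rfl⟩
      refine ⟨(hη m).toH1, ⟨(hη m).toH1_mem, ?_⟩, rfl⟩
      rw [Set.mem_preimage, mem_closedBall_iff_norm]
      refine (hF m).trans ?_
      have : (n : ℝ) ≤ m := by exact_mod_cast hm
      gcongr
    obtain ⟨ζ, ⟨h1, h2⟩, h3⟩ := hsub (hy n)
    refine ⟨ζ, h1, ?_, h3⟩
    rwa [Set.mem_preimage, mem_closedBall_iff_norm] at h2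
  choose ζ hζt hζF hζG using hζ
  have hlim1 : Filter.Tendsto (fun n => (ζ n).1.1) Filter.atTop (nhds (hfLp.toLp f)) := by
    rw [tendsto_iff_norm_sub_tendsto_zero]
    refine squeeze_zero (fun _ => norm_nonneg _) hζF ?_
    simpa using (tendsto_one_div_add_atTop_nhds_zero_nat (𝕜 := ℝ)).const_mul V
  have hlim : Filter.Tendsto (fun n => (ζ n).1) Filter.atTop (nhds (hfLp.toLp f, l)) := by
    refine Filter.Tendsto.prodMk_nhds hlim1 ?_
    simpa only [hζG] using hl
  -- Closedness of `H¹` makes `l` the weak gradient of the limit.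
  have hmem : (hfLp.toLp f, l) ∈ H1 U :=
    (isClosed_H1 U).mem_of_tendsto hlim (Filter.Eventually.of_forall fun n => (ζ n).2)
  refine ⟨⟨_, hmem⟩, ?_, hfLp.coeFn_toLp.trans hfγ⟩
  refine mem_closure_of_tendsto (f := ζ) (tendsto_subtype_rng.2 hlim)
    (Filter.Eventually.of_forall hζt)

/-- A weakly harmonic function in `H¹₀` vanishes. -/
theorem eq_zero_of_harmonic {U : Opens Plane} (hU : Bornology.IsBounded (U : Set Plane))
    {φ : H1 U} (hφ : φ ∈ H10 U) (h : ∀ η, IsTestFunction U η →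
      ∫ x in (U : Set Plane), ∑ i, wd i φ x * pd i η x = 0) : φ = 0 := by
  have key : inner ℝ φ.1.2 φ.1.2 = 0 := by
    -- Orthogonality to gradients of test functions extends to `H¹₀`, and so to `φ` itself.
    refine H10_induction (P := fun ψ : H1 U => inner ℝ φ.1.2 ψ.1.2 = 0)
      (isClosed_eq (by fun_prop) continuous_const) (fun θ hθ => ?_) hφ
    rw [← h θ hθ, L2.inner_def]
    refine integral_congr_ae ?_
    filter_upwards [hθ.grad_toH1] with x hx
    rw [hx]
    simp [PiLp.inner_apply, grad, wd, mul_comm]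
  have h2 : φ.1.2 = 0 := inner_self_eq_zero.1 key
  have h1 : φ.1.1 = 0 := by
    obtain ⟨C, -, hC⟩ := exists_poincare U hU
    have := hC φ hφ
    rw [gradNorm, h2, norm_zero, mul_zero] at this
    exact norm_le_zero_iff.1 this
  exact Subtype.ext (Prod.ext h1 h2)

/-! ### Uniqueness of traces on polygons -/

lemma L2_norm_sq {X F : Type*} [MeasurableSpace X] {μ : Measure X} [NormedAddCommGroup F]
    [InnerProductSpace ℝ F] (f : Lp F 2 μ) : ‖f‖ ^ 2 = ∫ x, ‖f x‖ ^ 2 ∂μ := by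
  rw [← real_inner_self_eq_norm_sq, L2.inner_def]
  simp only [real_inner_self_eq_norm_sq]

lemma volume_segment (a b : Plane) : volume (segment ℝ a b) = 0 := by
  refine measure_mono_null (t := (affineSpan ℝ {a, b} : Set Plane)) ?_
    (Measure.addHaar_affineSubspace volume _ ?_)
  · rw [segment_eq_image_lineMap]
    rintro _ ⟨t, -, rfl⟩
    exact AffineMap.lineMap_mem_affineSpan_pair t a b
  · intro h
    have h1 := collinear_iff_finrank_le_one.1 (collinear_pair ℝ a b)
    rw [← direction_affineSpan, h, AffineSubspace.direction_top, finrank_top] at h1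
    simp at h1

/-- A Lipschitz function that represents an element of `H¹₀(U)` vanishes at the points near which
the boundary of `U` is a straight line. -/
theorem eq_zero_of_flat {U : Opens Plane} {ξ : H1 U} (hξ : ξ ∈ H10 U) {γ : Plane → ℝ}
    (hγ : ContinuousOn γ (closure (U : Set Plane)))
    (hξγ : fn ξ =ᵐ[volume.restrict (U : Set Plane)] γ) {x₀ ν : Plane} (hν : ‖ν‖ = 1) {r : ℝ}
    (hr : 0 < r) (hx₀ : x₀ ∈ closure (U : Set Plane))
    (hfr : ∀ x ∈ Metric.ball x₀ r, inner ℝ ν (x - x₀) = 0 → x ∉ U)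
    (hU : Metric.ball x₀ r ∩ {x | 0 < inner ℝ ν (x - x₀)} ⊆ U) : γ x₀ = 0 := by
  by_contra hne
  -- Contradiction by scaling: near `x₀` one has `|γ| ≥ c`, so the squared `L²` norm on a half-disc
  -- of radius `δ` is at least of order `c ^ 2 * δ ^ 2`, while the local Poincaré inequality bounds
  -- it by `δ ^ 2` times a squared gradient norm that tends to `0`.
  set c : ℝ := |γ x₀| / 2 with hc
  have hc0 : 0 < c := by have := abs_pos.2 hne; positivity
  obtain ⟨d, hd, hdγ⟩ := Metric.continuousOn_iff.1 hγ x₀ hx₀ c hc0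
  have hlow : ∀ x ∈ U, dist x x₀ < d → c ≤ |γ x| := by
    intro x hx hxd
    have h1 := hdγ x (subset_closure hx) hxd
    rw [Real.dist_eq, abs_sub_comm] at h1
    have h2 := abs_sub_abs_le_abs_sub (γ x₀) (γ x)
    linarith
  -- Absolute continuity of the integral: the gradient has norm at most `c / 2` on sets of measure
  -- at most `m`.
  obtain ⟨m, hm, hmle⟩ := (Lp.memLp ξ.1.2).eLpNorm_indicator_le (by norm_num) (by norm_num)
    (half_pos hc0)
  obtain ⟨δ, hδ0, hδr, hδd, hδm⟩ : ∃ δ : ℝ, 0 < δ ∧ 2 * δ < r ∧ δ ≤ d ∧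
      volume (Metric.ball x₀ (2 * δ)) ≤ ENNReal.ofReal m := by
    have hlim : Filter.Tendsto (fun δ : ℝ => volume (Metric.ball x₀ (2 * δ)))
        (nhds 0) (nhds 0) := by
      simp only [EuclideanSpace.volume_ball_fin_two]
      have : Continuous fun δ : ℝ => ENNReal.ofReal (2 * δ) ^ 2 * ENNReal.ofReal Real.pi := by
        refine (ENNReal.continuous_mul_const ENNReal.ofReal_ne_top).comp ?_
        exact (ENNReal.continuous_pow 2).comp (ENNReal.continuous_ofReal.comp (by fun_prop))
      simpa using this.tendsto 0
    have h1 := (hlim.eventually (ge_mem_nhds (ENNReal.ofReal_pos.2 hm)))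
    have h2 : ∀ᶠ δ : ℝ in nhds 0, 2 * δ < r :=
      (continuous_const_mul (2 : ℝ)).continuousAt.eventually_lt continuousAt_const (by simpa)
    have h3 : ∀ᶠ δ : ℝ in nhds 0, δ ≤ d := ge_mem_nhds hd
    have h4 := ((h1.and h2).and h3).filter_mono (nhdsWithin_le_nhds (s := Set.Ioi 0))
    obtain ⟨δ, h5, h6⟩ := (h4.and self_mem_nhdsWithin).exists
    exact ⟨δ, h6, h5.1.2, h5.2, h5.1.1⟩
  set A : Set Plane := Metric.ball x₀ δ ∩ {x | 0 < inner ℝ ν (x - x₀)} with hA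
  have hAo : IsOpen A := Metric.isOpen_ball.inter (isOpen_lt continuous_const (by fun_prop))
  have hAU : A ⊆ U := fun x hx => hU ⟨Metric.ball_subset_ball (by linarith) hx.1, hx.2⟩
  set B : Set Plane := Metric.ball x₀ (2 * δ) with hB
  have hle := norm_cut_le hξ hAo.measurableSet (Metric.isOpen_ball.measurableSet (s := B))
    (-δ • ν) (fun y hy => ?_) (fun y hy s hs => ?_)
  rotate_left
  · have h1 : inner ℝ ν (y - x₀) < δ := by
      refine (real_inner_le_norm _ _).trans_lt ?_
      rw [hν, one_mul]
      exact mem_ball_iff_norm.1 hy.1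
    have h0 : 0 < inner ℝ ν (y - x₀) := hy.2
    -- This parameter moves `y` along `-ν` exactly onto the flat boundary line.
    refine ⟨inner ℝ ν (y - x₀) / δ, ⟨by positivity, (div_le_one hδ0).2 h1.le⟩, hfr _ ?_ ?_⟩
    · rw [mem_ball_iff_norm, smul_smul, add_sub_right_comm]
      refine (norm_add_le _ _).trans_lt ?_
      have h2 := mem_ball_iff_norm.1 hy.1
      rw [norm_smul, hν, mul_neg, norm_neg, div_mul_cancel₀ _ hδ0.ne', Real.norm_of_nonneg h0.le]
      linarith
    · rw [smul_smul, add_sub_right_comm, inner_add_right, inner_smul_right,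
        real_inner_self_eq_norm_sq, hν, mul_neg, div_mul_cancel₀ _ hδ0.ne']
      ring
  · rw [hB, mem_ball_iff_norm, add_sub_right_comm]
    refine (norm_add_le _ _).trans_lt ?_
    have h2 := mem_ball_iff_norm.1 hy.1
    rw [smul_smul, norm_smul, hν, mul_neg, norm_neg, norm_mul, Real.norm_of_nonneg hs.1,
      Real.norm_of_nonneg hδ0.le, mul_one]
    nlinarith [hs.2]
  have hBn : ‖cut Plane B ξ.1.2‖ ≤ c / 2 := by
    rw [Lp.norm_def]
    refine ENNReal.toReal_le_of_le_ofReal (by positivity) ?_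
    rw [eLpNorm_congr_ae (LpToLpRestrictCLM_coeFn ℝ B _),
      ← eLpNorm_indicator_eq_eLpNorm_restrict Metric.isOpen_ball.measurableSet]
    exact hmle B Metric.isOpen_ball.measurableSet ((Measure.restrict_apply_le _ _).trans hδm)
  have hAn : c ^ 2 * (Real.pi * (δ / 2) ^ 2) ≤ ‖cut ℝ A ξ.1.1‖ ^ 2 := by
    have hvol : Real.pi * (δ / 2) ^ 2 ≤ volume.real A := by
      -- A disc inscribed in the half-disc gives a simple lower bound for its area.
      have hsub : Metric.ball (x₀ + (δ / 2) • ν) (δ / 2) ⊆ A := by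
        intro x hx
        rw [mem_ball_iff_norm] at hx
        have e : x - x₀ = (x - (x₀ + (δ / 2) • ν)) + (δ / 2) • ν := by abel
        refine ⟨?_, ?_⟩
        · rw [mem_ball_iff_norm, e]
          refine (norm_add_le _ _).trans_lt ?_
          rw [norm_smul, hν, Real.norm_of_nonneg (by positivity)]
          linarith
        · have h1 := neg_le_of_abs_le (abs_real_inner_le_norm ν (x - (x₀ + (δ / 2) • ν)))
          rw [hν, one_mul] at h1
          show 0 < inner ℝ ν (x - x₀)
          rw [e, inner_add_right, inner_smul_right, real_inner_self_eq_norm_sq, hν]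
          linarith
      have h2 := measureReal_mono (μ := volume) hsub
        (Metric.isBounded_ball.subset Set.inter_subset_left).measure_lt_top.ne
      refine le_trans (le_of_eq ?_) h2
      rw [measureReal_def, EuclideanSpace.volume_ball_fin_two, ENNReal.toReal_mul,
        ENNReal.toReal_pow, ENNReal.toReal_ofReal (by positivity)]
      simp [mul_comm, ENNReal.toReal_ofReal Real.pi_pos.le]
    have hAf : volume A ≠ ⊤ := (Metric.isBounded_ball.subset Set.inter_subset_left).measure_lt_top.ne
    rw [L2_norm_sq]
    have hμ : (volume.restrict (U : Set Plane)).restrict A = volume.restrict A :=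
      Measure.restrict_restrict_of_subset hAU
    have hae : ∀ᵐ x ∂((volume.restrict (U : Set Plane)).restrict A),
        c ^ 2 ≤ ‖cut ℝ A ξ.1.1 x‖ ^ 2 := by
      filter_upwards [LpToLpRestrictCLM_coeFn ℝ A ξ.1.1, ae_restrict_of_ae hξγ,
        ae_restrict_mem hAo.measurableSet] with x h1 h2 h3
      rw [h1, Real.norm_eq_abs]
      have h2' : ξ.1.1 x = γ x := h2
      rw [h2']
      exact pow_le_pow_left₀ hc0.le
        (hlow x (hAU h3) ((Metric.mem_ball.1 h3.1).trans_le hδd)) 2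
    calc c ^ 2 * (Real.pi * (δ / 2) ^ 2) ≤ c ^ 2 * volume.real A := by gcongr
      _ = ∫ x, c ^ 2 ∂((volume.restrict (U : Set Plane)).restrict A) := by
          rw [hμ, setIntegral_const, smul_eq_mul, mul_comm]
      _ ≤ _ := by
          refine integral_mono_ae ?_ ?_ hae
          · rw [hμ]; exact integrableOn_const hAf
          · exact (Lp.memLp (cut ℝ A ξ.1.1)).integrable_norm_pow (by norm_num)
  rw [norm_smul, norm_neg, hν, Real.norm_of_nonneg hδ0.le, mul_one] at hle
  have h3 : ‖cut ℝ A ξ.1.1‖ ^ 2 ≤ (δ * (c / 2)) ^ 2 := by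
    gcongr
    exact hle.trans (by gcongr)
  have h4 : 0 < c ^ 2 * δ ^ 2 := by positivity
  -- The two bounds would give `c ^ 2 * π * δ ^ 2 / 4 ≤ c ^ 2 * δ ^ 2 / 4`.
  nlinarith [Real.pi_gt_three]

namespace Polygon

variable (E : Polygon)

lemma volume_frontier : volume (frontier (E.dom : Set Plane)) = 0 := by
  rw [E.frontier_eq]
  exact measure_iUnion_null fun i => volume_segment _ _

lemma v_ne (i : Fin (E.n + 3)) : E.v i ≠ E.v (i + 1) := by
  intro h
  have := E.injective h
  simp at this

lemma lineMap_notMem_edge {i j : Fin (E.n + 3)} (hij : i ≠ j) {t : ℝ} (ht : t ∈ Set.Ioo (0 : ℝ) 1) :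
    AffineMap.lineMap (E.v i) (E.v (i + 1)) t ∉ E.edge j := by
  intro h
  have hi : AffineMap.lineMap (E.v i) (E.v (i + 1)) t ∈ segment ℝ (E.v i) (E.v (i + 1)) := by
    rw [segment_eq_image_lineMap]
    exact ⟨t, ⟨ht.1.le, ht.2.le⟩, rfl⟩
  rcases (E.simple i j hij ⟨hi, h⟩).1 with h1 | h1
  · rw [AffineMap.lineMap_eq_left_iff] at h1
    exact h1.elim (E.v_ne i) ht.1.ne'
  · rw [Set.mem_singleton_iff, AffineMap.lineMap_eq_right_iff] at h1
    exact h1.elim (E.v_ne i) ht.2.ne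

/-- A direction orthogonal to a given one in the plane. -/
lemma exists_normal {w : Plane} (hw : w ≠ 0) : ∃ ν : Plane, ‖ν‖ = 1 ∧ inner ℝ ν w = 0 ∧
    ∀ d : Plane, inner ℝ ν d = 0 → ∃ s : ℝ, d = s • w := by
  have hw2 : w 0 ^ 2 + w 1 ^ 2 ≠ 0 := by
    intro h
    refine hw ?_
    have h0 : w 0 = 0 := by nlinarith [sq_nonneg (w 0), sq_nonneg (w 1)]
    have h1 : w 1 = 0 := by nlinarith [sq_nonneg (w 0), sq_nonneg (w 1)]
    ext i
    fin_cases i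
    · exact h0
    · exact h1
  -- The quarter turn of `w`.
  set J : Plane := !₂[-w 1, w 0] with hJ
  have hJi : ∀ d : Plane, inner ℝ J d = -w 1 * d 0 + w 0 * d 1 := fun d => by
    simp [PiLp.inner_apply, hJ, Fin.sum_univ_two]
    ring
  have hJ0 : J ≠ 0 := by
    intro h
    refine hw2 ?_
    have h0 : J 0 = 0 := by rw [h]; rfl
    have h1 : J 1 = 0 := by rw [h]; rfl
    simp only [hJ, PiLp.toLp_apply, Matrix.cons_val_zero, Matrix.cons_val_one] at h0 h1
    nlinarith
  have hn : ‖J‖ ≠ 0 := norm_ne_zero_iff.2 hJ0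
  refine ⟨‖J‖⁻¹ • J, ?_, ?_, fun d hd => ?_⟩
  · rw [norm_smul, norm_inv, norm_norm, inv_mul_cancel₀ hn]
  · rw [inner_smul_left, hJi]
    simp
    right
    ring
  · rw [inner_smul_left, hJi] at hd
    have hd' : -w 1 * d 0 + w 0 * d 1 = 0 := by
      rcases mul_eq_zero.1 hd with h | h
      · simp [hJ0] at h
      · exact h
    refine ⟨(d 0 * w 0 + d 1 * w 1) / (w 0 ^ 2 + w 1 ^ 2), ?_⟩
    ext i
    rw [PiLp.smul_apply, smul_eq_mul, div_mul_eq_mul_div, eq_div_iff hw2]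
    fin_cases i
    · simp only [Fin.zero_eta]
      linear_combination (-w 1) * hd'
    · simp only [Fin.mk_one]
      linear_combination (w 0) * hd'

/-- A Lipschitz function with zero trace vanishes on the edges. -/
theorem eq_zero_of_mem_H10 {ξ : H1 E.dom} (hξ : ξ ∈ H10 E.dom) {γ : Plane → ℝ}
    (hγ : ContinuousOn γ (closure (E.dom : Set Plane)))
    (hξγ : fn ξ =ᵐ[volume.restrict (E.dom : Set Plane)] γ) (i : Fin (E.n + 3)) {t : ℝ}
    (ht : t ∈ Set.Ioo (0 : ℝ) 1) : γ (AffineMap.lineMap (E.v i) (E.v (i + 1)) t) = 0 := by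
  set x₀ := AffineMap.lineMap (E.v i) (E.v (i + 1)) t with hx₀
  set w := E.v (i + 1) - E.v i with hw
  have hw0 : w ≠ 0 := sub_ne_zero.2 (E.v_ne i).symm
  have hline : ∀ s : ℝ, AffineMap.lineMap (E.v i) (E.v (i + 1)) s = x₀ + (s - t) • w := by
    intro s
    rw [hx₀, AffineMap.lineMap_apply, AffineMap.lineMap_apply, hw]
    simp only [vsub_eq_sub, vadd_eq_add, sub_smul]
    abel
  obtain ⟨ν, hν, hνw, hνd⟩ := exists_normal hw0
  have hedge : x₀ ∈ E.edge i := by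
    rw [edge, segment_eq_image_lineMap]
    exact ⟨t, ⟨ht.1.le, ht.2.le⟩, rfl⟩
  have hcl : IsClosed (⋃ j ∈ {j | j ≠ i}, E.edge j) := by
    refine Set.Finite.isClosed_biUnion (Set.toFinite _) fun j _ => ?_
    rw [edge, segment_eq_image_lineMap]
    exact (isCompact_Icc.image (by fun_prop)).isClosed
  have hnot : x₀ ∈ (⋃ j ∈ {j | j ≠ i}, E.edge j)ᶜ := by
    simp only [Set.mem_compl_iff, Set.mem_iUnion, not_exists]
    exact fun j hj => E.lineMap_notMem_edge (Ne.symm hj) ht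
  obtain ⟨r₁, hr₁, hball⟩ := Metric.isOpen_iff.1 hcl.isOpen_compl x₀ hnot
  -- The ball avoids all other edges and does not reach beyond the ends of edge `i`, so inside it
  -- the frontier is exactly a diameter.
  set r := min r₁ (min t (1 - t) * ‖w‖) with hr
  have hr0 : 0 < r := by
    refine lt_min hr₁ (mul_pos (lt_min ht.1 (by linarith [ht.2])) (norm_pos_iff.2 hw0))
  have hfr1 : ∀ x ∈ Metric.ball x₀ r, x ∈ frontier (E.dom : Set Plane) →
      inner ℝ ν (x - x₀) = 0 := by
    intro x hx hxf
    rw [E.frontier_eq] at hxf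
    obtain ⟨j, hj⟩ := Set.mem_iUnion.1 hxf
    by_cases hji : j = i
    · subst hji
      rw [segment_eq_image_lineMap] at hj
      obtain ⟨s, -, rfl⟩ := hj
      rw [hline, add_sub_cancel_left, inner_smul_right, hνw, mul_zero]
    · exact absurd (Set.mem_biUnion (t := E.edge) (show j ∈ {j | j ≠ i} from hji) hj)
        (hball (Metric.ball_subset_ball (min_le_left _ _) hx))
  have hfr2 : ∀ x ∈ Metric.ball x₀ r, inner ℝ ν (x - x₀) = 0 → x ∉ E.dom := by
    intro x hx hx0 hxE
    obtain ⟨s, hs⟩ := hνd _ hx0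
    have h1 : |s| < min t (1 - t) := by
      have h2 := (mem_ball_iff_norm.1 hx).trans_le (min_le_right _ _)
      rw [hs, norm_smul, Real.norm_eq_abs] at h2
      exact lt_of_mul_lt_mul_right h2 (norm_nonneg _)
    have h3 := abs_lt.1 (h1.trans_le (min_le_left _ _))
    have h4 := abs_lt.1 (h1.trans_le (min_le_right _ _))
    have h5 : x ∈ frontier (E.dom : Set Plane) := by
      rw [E.frontier_eq]
      refine Set.mem_iUnion.2 ⟨i, ?_⟩
      rw [segment_eq_image_lineMap]
      refine ⟨t + s, ⟨by linarith, by linarith⟩, ?_⟩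
      rw [hline, add_sub_cancel_left, ← hs, add_sub_cancel]
    rw [E.dom.isOpen.frontier_eq] at h5
    exact h5.2 hxE
  have hx₀c : x₀ ∈ closure (E.dom : Set Plane) := E.edge_subset i hedge
  -- An open half-disc is convex and misses the frontier, so it lies in the polygon as soon as it
  -- meets it.
  have half : ∀ μ : Plane, (∀ x ∈ Metric.ball x₀ r, x ∈ frontier (E.dom : Set Plane) →
      inner ℝ μ (x - x₀) = 0) → ∀ y ∈ E.dom, y ∈ Metric.ball x₀ r → 0 < inner ℝ μ (y - x₀) →
      Metric.ball x₀ r ∩ {x | 0 < inner ℝ μ (x - x₀)} ⊆ E.dom := by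
    intro μ hμ y hyE hyb hy
    refine subset_of_isPreconnected_of_frontier ?_ E.dom.isOpen ⟨y, ⟨hyb, hy⟩, hyE⟩ ?_
    · refine Convex.isPreconnected ((convex_ball _ _).inter ?_)
      have : {x | 0 < inner ℝ μ (x - x₀)} = {x : Plane | inner ℝ μ x₀ < innerSL ℝ μ x} := by
        ext x
        simp [inner_sub_right]
      rw [this]
      exact convex_halfSpace_gt (innerSL ℝ μ).isLinear _
    · intro z hz hzf
      exact hz.2.ne' (hμ z hz.1 hzf)
  obtain ⟨y, hyE, hyb⟩ := Metric.mem_closure_iff.1 hx₀c r hr0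
  have hyb' : y ∈ Metric.ball x₀ r := by rwa [Metric.mem_ball, dist_comm]
  -- The polygon has a point `y` in the ball off the diameter; the side on which it lies decides
  -- between `ν` and `-ν`.
  rcases lt_trichotomy 0 (inner ℝ ν (y - x₀)) with h | h | h
  · exact eq_zero_of_flat hξ hγ hξγ hν hr0 hx₀c hfr2 (half ν hfr1 y hyE hyb' h)
  · exact absurd hyE (hfr2 y hyb' h.symm)
  · refine eq_zero_of_flat hξ hγ hξγ (ν := -ν) (by rw [norm_neg, hν]) hr0 hx₀c
      (fun x hx hx0 => hfr2 x hx (by simpa using hx0))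
      (half (-ν) (fun x hx hxf => by simpa using hfr1 x hx hxf) y hyE hyb' (by simpa using h))

end Polygon

namespace Polygon

/-! ### Polynomials on a polygon -/

lemma pfn_mul (p q : Poly) (x : Plane) : pfn (p * q) x = pfn p x * pfn q x := by simp [pfn]

lemma pfn_sub (p q : Poly) (x : Plane) : pfn (p - q) x = pfn p x - pfn q x := by simp [pfn]

lemma pfn_C (c : ℝ) (x : Plane) : pfn (MvPolynomial.C c) x = c := by simp [pfn]

/-- A nonempty open set contains a product of infinite sets, and a polynomial vanishing on such a
product is zero. -/
lemma poly_eq_zero_of_eqOn {U : Set Plane} (hU : IsOpen U) (hne : U.Nonempty) {p : Poly}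
    (h : ∀ x ∈ U, pfn p x = 0) : p = 0 := by
  obtain ⟨x, hx⟩ := hne
  have hU' : IsOpen ((fun y : Fin 2 → ℝ => (WithLp.toLp 2 y : Plane)) ⁻¹' U) :=
    hU.preimage (PiLp.continuous_toLp 2 _)
  obtain ⟨r, hr, hball⟩ := Metric.isOpen_iff.1 hU' (fun i => x i) hx
  refine MvPolynomial.funext_set (fun i => Metric.ball (x i) r) (fun i => ?_) fun y hy => ?_
  · rw [Real.ball_eq_Ioo]
    exact Set.Ioo_infinite (by linarith)
  · rw [map_zero]
    refine h (WithLp.toLp 2 y) (hball ?_)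
    rw [ball_pi _ hr]
    exact hy

variable (E : Polygon)

instance : IsFiniteMeasure (volume.restrict (E.dom : Set Plane)) :=
  ⟨by rw [Measure.restrict_apply_univ]; exact E.bounded.measure_lt_top⟩

lemma poly_eq_zero_of_ae {p : Poly} (h : pfn p =ᵐ[volume.restrict (E.dom : Set Plane)] 0) :
    p = 0 :=
  poly_eq_zero_of_eqOn E.dom.isOpen E.connected.nonempty
    (Measure.eqOn_open_of_ae_eq h E.dom.isOpen (continuous_pfn p).continuousOn continuousOn_const)

/-- A polynomial as an element of `L²(E)`. -/
def polyL2 : Poly →ₗ[ℝ] L2 E.dom ℝ where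
  toFun p := (E.memLp_of_continuous (continuous_pfn p)).toLp
  map_add' p q := by
    rw [← MemLp.toLp_add]
    congr 1
    ext x
    exact pfn_add p q x
  map_smul' c p := by
    rw [RingHom.id_apply, ← MemLp.toLp_const_smul]
    congr 1
    ext x
    exact pfn_smul c p x

lemma coeFn_polyL2 (p : Poly) : E.polyL2 p =ᵐ[volume.restrict (E.dom : Set Plane)] pfn p :=
  (E.memLp_of_continuous (continuous_pfn p)).coeFn_toLp

lemma polyL2_injective : Function.Injective E.polyL2 := by
  rw [← LinearMap.ker_eq_bot, LinearMap.ker_eq_bot']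
  intro p hp
  refine E.poly_eq_zero_of_ae ?_
  have h := E.coeFn_polyL2 p
  rw [hp] at h
  exact h.symm.trans (Lp.coeFn_zero ..)

/-- `P_k(E)` as a subspace of `L²(E)`. -/
def polySpace (k : ℕ) : Submodule ℝ (L2 E.dom ℝ) := (Pk k).map E.polyL2

instance (k : ℕ) : FiniteDimensional ℝ (E.polySpace k) :=
  inferInstanceAs (FiniteDimensional ℝ ((Pk k).map E.polyL2))

lemma inner_polyL2 {f : Plane → ℝ} (hf : MemLp f 2 (volume.restrict (E.dom : Set Plane)))
    (q m : Poly) : inner ℝ (hf.toLp f - E.polyL2 q) (E.polyL2 m)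
      = ∫ x in (E.dom : Set Plane), (f x - pfn q x) * pfn m x := by
  rw [L2.inner_def]
  refine integral_congr_ae ?_
  filter_upwards [hf.coeFn_toLp, E.coeFn_polyL2 q, E.coeFn_polyL2 m,
    Lp.coeFn_sub (hf.toLp f) (E.polyL2 q)] with x h1 h2 h3 h4
  rw [h4, Pi.sub_apply, h1, h2, h3]
  simp [mul_comm]

/-- Existence, linearity and the norm bound of `Π⁰_k` are thereby taken from orthogonal projection
in the Hilbert space `L²(E)`. -/
lemma isL2Proj_iff {f : Plane → ℝ} (hf : MemLp f 2 (volume.restrict (E.dom : Set Plane)))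
    (k : ℕ) (q : Poly) : E.IsL2Proj k f q ↔
      q ∈ Pk k ∧ E.polyL2 q = (E.polySpace k).starProjection (hf.toLp f) := by
  refine and_congr_right fun hq => ⟨fun h => ?_, fun h m hm => ?_⟩
  · refine (Submodule.eq_starProjection_of_mem_of_inner_eq_zero
      (Submodule.mem_map_of_mem hq) ?_).symm
    rintro _ ⟨m, hm, rfl⟩
    rw [E.inner_polyL2 hf]
    exact h m hm
  · rw [← E.inner_polyL2 hf, h]
    exact Submodule.starProjection_inner_eq_zero _ _ (Submodule.mem_map_of_mem hm)

lemma isL2Proj_l2Proj {f : Plane → ℝ} (hf : MemLp f 2 (volume.restrict (E.dom : Set Plane)))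
    (k : ℕ) : E.IsL2Proj k f (E.l2Proj k f) := by
  have h : ∃ q, E.IsL2Proj k f q := by
    obtain ⟨q, hq, h⟩ := Submodule.starProjection_apply_mem (E.polySpace k) (hf.toLp f)
    exact ⟨q, (E.isL2Proj_iff hf k q).2 ⟨hq, h⟩⟩
  rw [l2Proj, dif_pos h]
  exact h.choose_spec

lemma polyL2_l2Proj {f : Plane → ℝ} (hf : MemLp f 2 (volume.restrict (E.dom : Set Plane)))
    (k : ℕ) : E.polyL2 (E.l2Proj k f) = (E.polySpace k).starProjection (hf.toLp f) :=
  ((E.isL2Proj_iff hf k _).1 (E.isL2Proj_l2Proj hf k)).2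

/-! ### The energy projection -/

/-- The drop in degree makes `∂ᵢ Π^∇_k φ` a competitor for the projection onto `P_{k-1}`, which
coercivity needs. For `k = 0` the derivative is zero. -/
lemma pderiv_mem_pred {k : ℕ} {p : Poly} (hp : p ∈ Pk k) (i : Fin 2) :
    MvPolynomial.pderiv i p ∈ Pk (k - 1) := by
  rw [MvPolynomial.mem_restrictTotalDegree] at *
  refine Finset.sup_le fun m hm => ?_
  rw [MvPolynomial.mem_support_iff, MvPolynomial.coeff_pderiv] at hm
  have h := (MvPolynomial.le_totalDegree
    (MvPolynomial.mem_support_iff.2 (left_ne_zero_of_mul hm))).trans hp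
  rw [Finsupp.sum_add_index' (fun _ => rfl) (fun _ _ _ => rfl), Finsupp.sum_single_index rfl] at h
  exact Nat.le_sub_one_of_lt h

lemma eq_C_of_pderiv_eq_zero {p : Poly} (h : ∀ i, MvPolynomial.pderiv i p = 0) :
    p = MvPolynomial.C (MvPolynomial.coeff 0 p) := by
  ext m
  rw [MvPolynomial.coeff_C]
  split_ifs with hm
  · rw [hm]
  · obtain ⟨i, hi⟩ : ∃ i, m i ≠ 0 := by
      by_contra! hall
      exact hm (Finsupp.ext fun i => (hall i).symm)
    have h1 := MvPolynomial.coeff_pderiv (i := i) p (m - Finsupp.single i 1)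
    rw [h i, MvPolynomial.coeff_zero, tsub_add_cancel_of_le
      (Finsupp.single_le_iff.2 (Nat.one_le_iff_ne_zero.2 hi))] at h1
    rcases mul_eq_zero.1 h1.symm with h2 | h2
    · exact h2
    · exact absurd h2 (by positivity)

variable {E}

/-- Testing with `r` itself gives `∇r = 0`, so `r` is a constant `c`. Any trace `γ` of the zero
function vanishes in the interior of each edge, so the boundary condition reads `c` times the
perimeter equals zero. -/
lemma IsEnergyProj.eq_zero {k : ℕ} {r : Poly} (h : E.IsEnergyProj k 0 r) : r = 0 := by
  obtain ⟨hr, hm, γ, ⟨⟨K, hK⟩, ξ, hξ, hγ⟩, hb⟩ := h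
  have hsq : ∀ i, Integrable (fun x => pgrad r x i * pgrad r x i)
      (volume.restrict (E.dom : Set Plane)) := fun i =>
    (E.memLp_of_continuous (continuous_pfn _)).integrable_mul
      (E.memLp_of_continuous (continuous_pfn _))
  have h1 : ∫ x in (E.dom : Set Plane), ∑ i, pgrad r x i * pgrad r x i = 0 := by
    rw [← neg_eq_zero, ← hm r hr, ← integral_neg]
    refine integral_congr_ae ?_
    filter_upwards [wd_zero (Ω := E.dom) 0, wd_zero (Ω := E.dom) 1] with x h0 h1
    simp only [Fin.sum_univ_two, h0, h1, Pi.zero_apply]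
    ring
  have h2 := (integral_eq_zero_iff_of_nonneg
    (fun x => Finset.sum_nonneg fun i _ => mul_self_nonneg _)
    (integrable_finsetSum _ fun i _ => hsq i)).1 h1
  have h3 : ∀ i, MvPolynomial.pderiv i r = 0 := fun i => by
    refine E.poly_eq_zero_of_ae ?_
    filter_upwards [h2] with x hx
    have := (Finset.sum_eq_zero_iff_of_nonneg (fun i _ => mul_self_nonneg _)).1 hx i
      (Finset.mem_univ i)
    exact mul_self_eq_zero.1 this
  have hC := eq_C_of_pderiv_eq_zero h3
  set c := MvPolynomial.coeff 0 r with hc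
  have hγ0 : ∀ i, ∀ t ∈ Set.Ioo (0 : ℝ) 1,
      γ (AffineMap.lineMap (E.v i) (E.v (i + 1)) t) = 0 := by
    intro i t ht
    -- From `0 = ξ + γ` almost everywhere, `γ` represents `-ξ`.
    refine E.eq_zero_of_mem_H10 (ξ := -ξ) (Submodule.neg_mem _ hξ) hK.continuousOn ?_ i ht
    have h4 : fn (-ξ) =ᵐ[volume.restrict (E.dom : Set Plane)] -fn ξ := Lp.coeFn_neg _
    filter_upwards [h4, hγ, fn_zero (Ω := E.dom)] with x h5 h6 h7
    simp only [h7, Pi.add_apply, Pi.zero_apply] at h6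
    rw [h5, Pi.neg_apply]
    linarith
  have hb' : E.bdryIntegral (fun x => γ x - pfn r x)
      = -(c * ∑ i, dist (E.v i) (E.v (i + 1))) := by
    unfold bdryIntegral
    rw [Finset.mul_sum, ← Finset.sum_neg_distrib]
    refine Finset.sum_congr rfl fun i _ => ?_
    have h5 : ∫ t in (0 : ℝ)..1, (γ (AffineMap.lineMap (E.v i) (E.v (i + 1)) t)
        - pfn r (AffineMap.lineMap (E.v i) (E.v (i + 1)) t)) = ∫ t in (0 : ℝ)..1, -c := by
      rw [intervalIntegral.integral_of_le zero_le_one, intervalIntegral.integral_of_le zero_le_one,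
        integral_Ioc_eq_integral_Ioo, integral_Ioc_eq_integral_Ioo]
      refine setIntegral_congr_fun measurableSet_Ioo fun t ht => ?_
      simp only [hγ0 i t ht]
      rw [hC, pfn_C, zero_sub]
    rw [h5]
    simp
    ring
  rw [hb'] at hb
  have hpos : 0 < ∑ i, dist (E.v i) (E.v (i + 1)) :=
    Finset.sum_pos (fun i _ => dist_pos.2 (E.v_ne i)) Finset.univ_nonempty
  have hc0 : c = 0 := by
    rcases mul_eq_zero.1 (neg_eq_zero.1 hb) with h | h
    · exact h
    · exact absurd h hpos.ne'
  rw [hC, hc0, map_zero]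

lemma IsEnergyProj.unique {k : ℕ} {φ : H1 E.dom} {p q : Poly} (hp : E.IsEnergyProj k φ p)
    (hq : E.IsEnergyProj k φ q) : p = q := by
  have h := hp.add (hq.smul (-1))
  rw [neg_one_smul, show (-1 : ℝ) • φ = -φ from neg_one_smul ℝ φ, ← sub_eq_add_neg, ← sub_eq_add_neg, sub_self] at h
  exact sub_eq_zero.1 h.eq_zero

lemma IsEnergyProj.energyProj_eq {k : ℕ} {φ : H1 E.dom} {p : Poly} (hp : E.IsEnergyProj k φ p) :
    E.energyProj k φ = p := by
  have h : ∃ p, E.IsEnergyProj k φ p := ⟨p, hp⟩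
  rw [energyProj, dif_pos h]
  exact h.choose_spec.unique hp

/-- Existence is part of membership in `Vloc` through `enhanced`; uniqueness identifies that
polynomial with the chosen one. -/
lemma isEnergyProj_energyProj {k : ℕ} (φ : E.Vloc k) :
    E.IsEnergyProj k (φ : H1 E.dom) (E.energyProj k φ) := by
  obtain ⟨p, hp, -⟩ := φ.2.enhanced
  rwa [hp.energyProj_eq]

variable (E)

/-- A polynomial as an element of `H¹(E)`, as a linear map. -/
def polyH1L : Poly →ₗ[ℝ] H1 E.dom where
  toFun := E.polyH1
  map_add' p q := by
    refine H1_ext ?_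
    filter_upwards [E.fn_polyH1 (p + q), E.fn_polyH1 p, E.fn_polyH1 q,
      fn_add (E.polyH1 p) (E.polyH1 q)] with x h1 h2 h3 h4
    rw [h1, h4, Pi.add_apply, h2, h3, pfn_add]
  map_smul' c p := by
    refine H1_ext ?_
    filter_upwards [E.fn_polyH1 (c • p), E.fn_polyH1 p, fn_smul c (E.polyH1 p)] with x h1 h2 h3
    rw [RingHom.id_apply, h1, h3, Pi.smul_apply, h2, pfn_smul, smul_eq_mul]

/-- `φ ↦ φ - Π^∇_k φ` as a linear map. -/
def subProjL (k : ℕ) : E.Vloc k →ₗ[ℝ] E.Vloc k where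
  toFun := E.subProj k
  map_add' φ ξ := by
    have h : E.energyProj k (φ + ξ : E.Vloc k) = E.energyProj k φ + E.energyProj k ξ :=
      ((isEnergyProj_energyProj φ).add (isEnergyProj_energyProj ξ)).energyProj_eq
    refine Subtype.ext ?_
    have h2 := E.polyH1L.map_add (E.energyProj k φ) (E.energyProj k ξ)
    rw [← h] at h2
    have h3 : E.polyH1 (E.energyProj k (φ + ξ : E.Vloc k))
      = E.polyH1 (E.energyProj k φ) + E.polyH1 (E.energyProj k ξ) := h2
    simp only [subProj, Submodule.coe_sub, Submodule.coe_add] at h3 ⊢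
    rw [h3]
    abel
  map_smul' c φ := by
    have h : E.energyProj k (c • φ : E.Vloc k) = c • E.energyProj k φ :=
      ((isEnergyProj_energyProj φ).smul c).energyProj_eq
    refine Subtype.ext ?_
    have h2 := E.polyH1L.map_smul c (E.energyProj k φ)
    rw [← h] at h2
    have h3 : E.polyH1 (E.energyProj k (c • φ : E.Vloc k)) = c • E.polyH1 (E.energyProj k φ) := h2
    simp only [subProj, Submodule.coe_sub, Submodule.coe_smul, RingHom.id_apply] at h3 ⊢
    rw [h3, smul_sub]

/-- The projection is linear and reproduces `P_k`. Hence the residual lies in the kernel on which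
the stabilization bounds hold. -/
lemma energyProj_subProj (k : ℕ) (φ : E.Vloc k) : E.energyProj k (E.subProj k φ) = 0 := by
  have h := (isEnergyProj_energyProj φ).add
    ((E.isEnergyProj_polyH1 (E.energyProj_mem k φ)).smul (-1))
  rw [neg_one_smul, show (-1 : ℝ) • E.polyH1 (E.energyProj k φ) = -E.polyH1 (E.energyProj k φ)
    from neg_one_smul ℝ (E.polyH1 (E.energyProj k φ)), ← sub_eq_add_neg, ← sub_eq_add_neg, sub_self] at h
  exact IsEnergyProj.energyProj_eq h

/-! ### Finite dimension of the local space -/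

/-- A vector space is finite-dimensional if its vectors are determined, through a linear relation,
by vectors of a finite-dimensional space. -/
lemma finiteDimensional_of_relation {V W : Type*} [AddCommGroup V] [Module ℝ V] [AddCommGroup W]
    [Module ℝ W] [FiniteDimensional ℝ W] (r : V → W → Prop) (h0 : r 0 0)
    (hadd : ∀ v w v' w', r v w → r v' w' → r (v + v') (w + w'))
    (hsmul : ∀ (c : ℝ) v w, r v w → r (c • v) (c • w)) (hinj : ∀ v, r v 0 → v = 0)
    (hex : ∀ v, ∃ w, r v w) : FiniteDimensional ℝ V := by
  -- The relation is a subspace that embeds into `W` and projects onto `V`; no choice of a linear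
  -- map is needed.
  let R : Submodule ℝ (V × W) :=
    { carrier := {p | r p.1 p.2}
      zero_mem' := h0
      add_mem' := fun ha hb => hadd _ _ _ _ ha hb
      smul_mem' := fun c _ ha => hsmul c _ _ ha }
  have hR : Function.Injective (LinearMap.snd ℝ V W ∘ₗ R.subtype) := by
    rw [← LinearMap.ker_eq_bot, LinearMap.ker_eq_bot']
    rintro ⟨⟨v, w⟩, hw⟩ hz
    have hz' : w = 0 := hz
    subst hz'
    have := hinj v hw
    subst this
    rfl
  have : FiniteDimensional ℝ R := FiniteDimensional.of_injective _ hR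
  refine Module.Finite.of_surjective (LinearMap.fst ℝ V W ∘ₗ R.subtype) fun v => ?_
  obtain ⟨w, hw⟩ := hex v
  exact ⟨⟨(v, w), hw⟩, rfl⟩

lemma inner_grad_toH1 (φ : H1 E.dom) {η : Plane → ℝ} (hη : IsTestFunction E.dom η) :
    inner ℝ φ.1.2 hη.toH1.1.2 = ∫ x in (E.dom : Set Plane), ∑ i, wd i φ x * pd i η x := by
  rw [L2.inner_def]
  refine integral_congr_ae ?_
  filter_upwards [hη.grad_toH1] with x hx
  rw [hx]
  simp [PiLp.inner_apply, grad, wd, mul_comm]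

lemma inner_polyL2_toH1 (p : Poly) {η : Plane → ℝ} (hη : IsTestFunction E.dom η) :
    inner ℝ (E.polyL2 p) hη.toH1.1.1 = ∫ x in (E.dom : Set Plane), pfn p x * η x := by
  rw [L2.inner_def]
  refine integral_congr_ae ?_
  filter_upwards [hη.fn_toH1, E.coeFn_polyL2 p] with x hx h2
  have hx' : hη.toH1.1.1 x = η x := hx
  rw [hx', h2]
  simp [mul_comm]

/-- The relation between a virtual element function, its edge polynomials and its Laplacian. -/
def DofRel (k : ℕ) (φ : E.Vloc k) (w : (Fin (E.n + 3) → Pk k) × Pk k) : Prop :=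
  (∃ γ, E.HasTrace (φ : H1 E.dom) γ ∧ ∀ i, Set.EqOn γ (pfn (w.1 i : Poly)) (E.edge i)) ∧
    ∀ η (hη : IsTestFunction E.dom η), inner ℝ (φ : H1 E.dom).1.2 hη.toH1.1.2
      = -inner ℝ (E.polyL2 w.2) hη.toH1.1.1

/-- With zero edge polynomials `γ` vanishes on the frontier, hence represents an element of `H¹₀`,
and so `φ` lies in `H¹₀`. It is weakly harmonic as well, so it is zero. -/
lemma DofRel.eq_zero {k : ℕ} {φ : E.Vloc k} (h : E.DofRel k φ 0) : φ = 0 := by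
  obtain ⟨⟨γ, ⟨⟨K, hK⟩, ξ, hξ, hφ⟩, hγ⟩, hΔ⟩ := h
  obtain ⟨z, hz, hzγ⟩ := exists_mem_H10_of_frontier E.bounded hK (fun x hx => by
    rw [E.frontier_eq] at hx
    obtain ⟨i, hi⟩ := Set.mem_iUnion.1 hx
    exact (hγ i hi).trans (pfn_zero x))
  have hφz : (φ : H1 E.dom) = ξ + z := by
    refine H1_ext ?_
    filter_upwards [hφ, hzγ, fn_add ξ z] with x h1 h2 h3
    rw [h3, Pi.add_apply, h2]
    exact h1
  have hmem : (φ : H1 E.dom) ∈ H10 E.dom := by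
    rw [hφz]
    exact Submodule.add_mem _ hξ hz
  refine Subtype.ext (eq_zero_of_harmonic E.bounded hmem fun η hη => ?_)
  rw [← inner_grad_toH1]
  have := hΔ η hη
  simpa using this

/-- Edge polynomials and Laplacian range over a finite-dimensional space and determine the function.
-/
instance finiteDimensional_Vloc (k : ℕ) : FiniteDimensional ℝ (E.Vloc k) := by
  refine finiteDimensional_of_relation (E.DofRel k) ?_ ?_ ?_ (fun φ h => DofRel.eq_zero E h) ?_
  · refine ⟨⟨pfn 0, ?_, fun i x _ => rfl⟩, fun η hη => ?_⟩
    · have h := E.hasTrace_polyH1 0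
      rwa [polyH1_zero] at h
    · simp
  · rintro φ ⟨q, p⟩ φ' ⟨q', p'⟩ ⟨⟨γ, hγ, hq⟩, hp⟩ ⟨⟨γ', hγ', hq'⟩, hp'⟩
    refine ⟨⟨γ + γ', HasTrace.add E hγ hγ', fun i x hx => ?_⟩, fun η hη => ?_⟩
    · have h1 := hq i hx
      have h2 := hq' i hx
      simp only [Prod.fst_add, Pi.add_apply, Submodule.coe_add, pfn_add] at *
      rw [h1, h2]
    · have h1 := hp η hη
      have h2 := hp' η hη
      simp only [Prod.snd_add, Submodule.coe_add, map_add, inner_add_left] at *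
      rw [h1, h2]
      ring
  · rintro c φ ⟨q, p⟩ ⟨⟨γ, hγ, hq⟩, hp⟩
    refine ⟨⟨c • γ, HasTrace.smul E c hγ, fun i x hx => ?_⟩, fun η hη => ?_⟩
    · have h1 := hq i hx
      simp only [Prod.smul_fst, Pi.smul_apply, Submodule.coe_smul, pfn_smul, smul_eq_mul] at *
      rw [h1]
    · have h1 := hp η hη
      simp only [Prod.smul_snd, Submodule.coe_smul, map_smul, real_inner_smul_left] at *
      rw [h1]
      ring
  · intro φ
    obtain ⟨γ, hγ, hq⟩ := φ.2.trace
    obtain ⟨p, hp, hΔ⟩ := φ.2.laplacian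
    choose q hqm hqe using hq
    refine ⟨(fun i => ⟨q i, hqm i⟩, ⟨p, hp⟩), ⟨γ, hγ, hqe⟩, fun η hη => ?_⟩
    rw [inner_grad_toH1, inner_polyL2_toH1]
    exact hΔ η hη

end Polygon

/-! ### Monotone equations in finite dimensions -/

/-- A Lipschitz continuous, strongly monotone map of a Hilbert space is surjective. -/
theorem exists_eq_of_stronglyMonotone {H : Type*} [NormedAddCommGroup H] [InnerProductSpace ℝ H]
    [CompleteSpace H] {F : H → H} {m L : ℝ} (hm : 0 < m)
    (hmono : ∀ x y, m * ‖x - y‖ ^ 2 ≤ inner ℝ (F x - F y) (x - y))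
    (hL : ∀ x y, ‖F x - F y‖ ≤ L * ‖x - y‖) (b : H) : ∃ x, F x = b := by
  -- A Lipschitz constant that is positive and at least `m`, so that `q` below is nonnegative.
  set K : ℝ := |L| + m with hK
  have hK0 : 0 < K := by positivity
  have hmK : m ≤ K := by rw [hK]; linarith [abs_nonneg L]
  have hLK : ∀ x y, ‖F x - F y‖ ≤ K * ‖x - y‖ := fun x y =>
    (hL x y).trans (by gcongr; rw [hK]; linarith [le_abs_self L])
  -- This `t` minimizes `1 - 2 * t * m + t ^ 2 * K ^ 2`, the squared contraction factor of `x - t •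
  -- (F x - b)`; the minimum is `q`.
  set t : ℝ := m / K ^ 2 with ht
  have ht0 : 0 < t := by positivity
  set q : ℝ := 1 - m ^ 2 / K ^ 2 with hq
  have hq0 : 0 ≤ q := by
    rw [hq, sub_nonneg, div_le_one (by positivity)]
    gcongr
  have hq1 : q < 1 := by
    rw [hq]
    linarith [show 0 < m ^ 2 / K ^ 2 by positivity]
  have hcontr : ContractingWith (Real.toNNReal √q) fun x => x - t • (F x - b) := by
    constructor
    · rw [← NNReal.coe_lt_coe, Real.coe_toNNReal _ (Real.sqrt_nonneg q), NNReal.coe_one,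
        Real.sqrt_lt' one_pos]
      linarith
    · refine LipschitzWith.of_dist_le_mul fun x y => ?_
      rw [Real.coe_toNNReal _ (Real.sqrt_nonneg q), dist_eq_norm, dist_eq_norm]
      have e : x - t • (F x - b) - (y - t • (F y - b)) = (x - y) - t • (F x - F y) := by
        simp only [smul_sub]
        abel
      rw [e]
      refine le_of_sq_le_sq ?_ (by positivity)
      rw [mul_pow, Real.sq_sqrt hq0, norm_sub_sq_real, inner_smul_right, norm_smul, mul_pow,
        Real.norm_eq_abs, sq_abs, real_inner_comm]
      have h1 := hmono x y
      have h2 : ‖F x - F y‖ ^ 2 ≤ K ^ 2 * ‖x - y‖ ^ 2 := by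
        rw [← mul_pow]
        exact pow_le_pow_left₀ (norm_nonneg _) (hLK x y) 2
      have h3 : t * m = m ^ 2 / K ^ 2 := by rw [ht]; ring
      have h4 : t ^ 2 * K ^ 2 = m ^ 2 / K ^ 2 := by rw [ht]; field_simp
      have h5 := mul_le_mul_of_nonneg_left h1 ht0.le
      have h6 := mul_le_mul_of_nonneg_left h2 (sq_nonneg t)
      rw [← mul_assoc, h3] at h5
      rw [← mul_assoc, h4] at h6
      rw [hq, sub_mul, one_mul]
      linarith
  have : Nonempty H := ⟨0⟩
  refine ⟨hcontr.fixedPoint, ?_⟩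
  have h := hcontr.fixedPoint_isFixedPt
  have h1 : t • (F (ContractingWith.fixedPoint _ hcontr) - b) = 0 := by
    have h2 : ContractingWith.fixedPoint _ hcontr
      - t • (F (ContractingWith.fixedPoint _ hcontr) - b) = ContractingWith.fixedPoint _ hcontr := h
    exact sub_eq_self.1 h2
  exact sub_eq_zero.1 ((smul_eq_zero.1 h1).resolve_left ht0.ne')

/-- A Lipschitz continuous, strongly monotone variational problem in finite dimensions is
solvable. -/
theorem exists_forall_eq_of_stronglyMonotone {V : Type*} [NormedAddCommGroup V] [NormedSpace ℝ V]
    [FiniteDimensional ℝ V] {B : V → V →ₗ[ℝ] ℝ} {m L : ℝ} (hm : 0 < m)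
    (hmono : ∀ x y, m * ‖x - y‖ ^ 2 ≤ B x (x - y) - B y (x - y))
    (hL : ∀ x y ξ, |B x ξ - B y ξ| ≤ L * ‖x - y‖ * ‖ξ‖) (l : V →ₗ[ℝ] ℝ) :
    ∃ x, ∀ ξ, B x ξ = l ξ := by
  -- The norm of `V` need not come from an inner product, so the problem is moved to Euclidean
  -- space, where the Riesz map `R` turns functionals into vectors.
  let e := toEuclidean (E := V)
  let R : (V →ₗ[ℝ] ℝ) → EuclideanSpace ℝ (Fin (Module.finrank ℝ V)) := fun f =>
    (InnerProductSpace.toDual ℝ _).symm (LinearMap.toContinuousLinearMap (f ∘ₗ e.symm.toLinearMap))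
  have hR : ∀ f z, inner ℝ (R f) z = f (e.symm z) := fun f z => by
    simp only [R, InnerProductSpace.toDual_symm_apply]
    rfl
  -- The summand `1` keeps `a` positive even when `V` is trivial.
  set a : ℝ := ‖(e : V →L[ℝ] EuclideanSpace ℝ (Fin (Module.finrank ℝ V)))‖ + 1 with ha
  set c : ℝ := ‖(e.symm : EuclideanSpace ℝ (Fin (Module.finrank ℝ V)) →L[ℝ] V)‖ with hc
  have ha0 : 0 < a := by positivity
  have hae : ∀ z, ‖z‖ ≤ a * ‖e.symm z‖ := fun z => by
    have h := (e : V →L[ℝ] EuclideanSpace ℝ (Fin (Module.finrank ℝ V))).le_opNorm (e.symm z)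
    rw [ContinuousLinearEquiv.coe_coe, e.apply_symm_apply] at h
    exact h.trans (by gcongr; rw [ha]; linarith)
  have hce : ∀ z, ‖e.symm z‖ ≤ c * ‖z‖ := fun z =>
    (e.symm : EuclideanSpace ℝ (Fin (Module.finrank ℝ V)) →L[ℝ] V).le_opNorm z
  have hmonoR : ∀ x y, m / a ^ 2 * ‖x - y‖ ^ 2
      ≤ inner ℝ (R (B (e.symm x)) - R (B (e.symm y))) (x - y) := by
    intro x y
    rw [inner_sub_left, hR, hR, map_sub]
    refine le_trans ?_ (hmono (e.symm x) (e.symm y))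
    rw [← map_sub, div_mul_eq_mul_div, div_le_iff₀ (by positivity), mul_assoc, ← mul_pow,
      mul_comm _ a]
    gcongr
    exact hae _
  have hLR : ∀ x y, ‖R (B (e.symm x)) - R (B (e.symm y))‖ ≤ |L| * c * c * ‖x - y‖ := by
    intro x y
    set w := R (B (e.symm x)) - R (B (e.symm y)) with hw
    have h1 : ‖w‖ * ‖w‖ ≤ |L| * c * c * ‖x - y‖ * ‖w‖ := by
      rw [← real_inner_self_eq_norm_mul_norm]
      have h2 : inner ℝ w w = B (e.symm x) (e.symm w) - B (e.symm y) (e.symm w) := by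
        conv_lhs => rw [hw, inner_sub_left, hR, hR]
      rw [h2]
      refine (le_abs_self _).trans ((hL _ _ _).trans ?_)
      rw [← map_sub]
      calc L * ‖e.symm (x - y)‖ * ‖e.symm w‖ ≤ |L| * (c * ‖x - y‖) * (c * ‖w‖) := by
            gcongr
            · exact le_abs_self L
            · exact hce _
            · exact hce _
        _ = _ := by ring
    rcases (norm_nonneg w).eq_or_lt with h0 | h0
    · rw [← h0]; positivity
    · exact le_of_mul_le_mul_right h1 h0
  obtain ⟨x, hx⟩ := exists_eq_of_stronglyMonotone (by positivity) hmonoR hLR (R l)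
  refine ⟨e.symm x, fun ξ => ?_⟩
  have h1 := hR (B (e.symm x)) (e ξ)
  rw [hx, hR l (e ξ), e.symm_apply_apply] at h1
  exact h1.symm

/-! ### Decomposition over the mesh -/

/-- The `i`-th component of a square integrable vector field. -/
abbrev comp {U : Opens Plane} (i : Fin 2) : L2 U Plane →L[ℝ] L2 U ℝ :=
  (EuclideanSpace.proj (𝕜 := ℝ) i : Plane →L[ℝ] ℝ).compLpL 2 _

lemma coeFn_comp {U : Opens Plane} (i : Fin 2) (G : L2 U Plane) :
    comp i G =ᵐ[volume.restrict (U : Set Plane)] fun x => G x i :=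
  (EuclideanSpace.proj (𝕜 := ℝ) i : Plane →L[ℝ] ℝ).coeFn_compLpL G

lemma norm_sq_eq_sum_comp {U : Opens Plane} (G : L2 U Plane) :
    ‖G‖ ^ 2 = ∑ i, ‖comp i G‖ ^ 2 := by
  simp only [L2_norm_sq]
  rw [← integral_finsetSum _ fun i _ => (Lp.memLp (comp i G)).integrable_norm_pow (by norm_num)]
  refine integral_congr_ae ?_
  filter_upwards [coeFn_comp 0 G, coeFn_comp 1 G] with x h0 h1
  rw [EuclideanSpace.norm_sq_eq, Fin.sum_univ_two, Fin.sum_univ_two, h0, h1]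

lemma coeFn_restrictL2 {E Ω : Opens Plane} (h : E ≤ Ω) {F : Type} [NormedAddCommGroup F]
    [NormedSpace ℝ F] (f : L2 Ω F) :
    restrictL2 h F f =ᵐ[volume.restrict (E : Set Plane)] f :=
  ((Lp.memLp f).mono_measure (Measure.restrict_mono_set volume h)).coeFn_toLp

namespace Mesh

variable {Ω : Opens Plane} (M : Mesh Ω)

lemma isBounded (M : Mesh Ω) : Bornology.IsBounded (Ω : Set Plane) :=
  (Bornology.isBounded_iUnion.2 fun j => (M.elem j).bounded.closure).subset M.cover

/-- A point of `Ω` in no element lies on the frontier of some element, and these frontiers are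
finite unions of segments. -/
lemma ae_eq_iUnion :
    (Ω : Set Plane) =ᵐ[volume] ⋃ j, ((M.elem j).dom : Set Plane) := by
  refine Filter.EventuallyLE.antisymm ?_
    (Filter.Eventually.of_forall (Set.iUnion_subset fun j => M.subset j))
  have h0 : volume (⋃ j, frontier ((M.elem j).dom : Set Plane)) = 0 :=
    measure_iUnion_null fun j => (M.elem j).volume_frontier
  filter_upwards [measure_eq_zero_iff_ae_notMem.1 h0] with x hx hxΩ
  obtain ⟨j, hj⟩ := Set.mem_iUnion.1 (M.cover hxΩ)
  by_contra hn
  refine hx (Set.mem_iUnion.2 ⟨j, ?_⟩)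
  rw [(M.elem j).dom.isOpen.frontier_eq]
  exact ⟨hj, fun hj' => hn (Set.mem_iUnion.2 ⟨j, hj'⟩)⟩

lemma restrict_eq : volume.restrict (Ω : Set Plane)
    = volume.restrict (⋃ j, ((M.elem j).dom : Set Plane)) :=
  Measure.restrict_congr_set M.ae_eq_iUnion

lemma ae_restrict_of_forall {p : Plane → Prop}
    (h : ∀ j, ∀ᵐ x ∂volume.restrict ((M.elem j).dom : Set Plane), p x) :
    ∀ᵐ x ∂volume.restrict (Ω : Set Plane), p x := by
  rw [M.restrict_eq]
  exact (ae_restrict_iUnion_iff _ _).2 h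

lemma integral_eq_sum {f : Plane → ℝ} (hf : IntegrableOn f (Ω : Set Plane)) :
    ∫ x in (Ω : Set Plane), f x = ∑ j, ∫ x in ((M.elem j).dom : Set Plane), f x := by
  rw [M.restrict_eq]
  refine integral_iUnion_fintype (fun j => (M.elem j).dom.isOpen.measurableSet)
    (fun i j hij => ?_) (fun j => hf.mono_set (M.subset j))
  have h := M.disjoint i j hij
  rw [Function.onFun, Set.disjoint_iff_inter_eq_empty]
  have h2 := (disjoint_iff.1 h)
  have h3 := congrArg (fun U : Opens Plane => (U : Set Plane)) h2
  simpa using h3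

lemma norm_sq_eq_sum {F : Type} [NormedAddCommGroup F] [InnerProductSpace ℝ F] (f : L2 Ω F) :
    ‖f‖ ^ 2 = ∑ j, ‖restrictL2 (M.subset j) F f‖ ^ 2 := by
  simp only [L2_norm_sq]
  rw [M.integral_eq_sum ((Lp.memLp f).integrable_norm_pow (by norm_num))]
  refine Finset.sum_congr rfl fun j _ => integral_congr_ae ?_
  filter_upwards [coeFn_restrictL2 (M.subset j) f] with x hx
  rw [hx]

variable {M} {k : ℕ}

/-- Restriction to an element as a linear map. -/
def locL (j : M.ι) : M.Φ₀ k →ₗ[ℝ] (M.elem j).Vloc k where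
  toFun φ := loc φ j
  map_add' φ ξ := Subtype.ext ((M.res j).map_add φ ξ)
  map_smul' c φ := Subtype.ext ((M.res j).map_smul c φ)

/-- The elements fill `Ω` up to a null set, so a function is determined by its restrictions to the
finitely many local spaces. -/
instance : FiniteDimensional ℝ (M.Φ₀ k) := by
  refine Polygon.finiteDimensional_of_relation (W := (j : M.ι) → (M.elem j).Vloc k)
    (fun φ w => ∀ j, w j = locL j φ) (fun j => (map_zero (locL j)).symm)
    (fun φ w ξ w' h h' j => ?_) (fun c φ w h j => ?_) (fun φ h => ?_)
    (fun φ => ⟨fun j => locL j φ, fun j => rfl⟩)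
  · rw [Pi.add_apply, h j, h' j, map_add]
  · rw [Pi.smul_apply, h j, map_smul]
  refine Subtype.ext (H1_ext (M.ae_restrict_of_forall fun j => ?_))
  have h1 : M.res j φ = 0 := congrArg Subtype.val (h j).symm
  have h2 : restrictL2 (M.subset j) ℝ (φ : H1 Ω).1.1
      = restrictL2 (M.subset j) ℝ (0 : H1 Ω).1.1 := by
    refine (congrArg (fun ζ : H1 (M.elem j).dom => ζ.1.1) h1).trans ?_
    exact (map_zero (restrictL2 (M.subset j) ℝ)).symm
  have h3 := coeFn_restrictL2 (M.subset j) (φ : H1 Ω).1.1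
  rw [h2] at h3
  exact h3.symm.trans (coeFn_restrictL2 (M.subset j) (0 : H1 Ω).1.1)

/-! ### The discrete operators as linear maps -/

lemma polyL2_l2Proj_fn (j : M.ι) (φ : M.Φ₀ k) :
    (M.elem j).polyL2 ((M.elem j).l2Proj k (fn (φ : H1 Ω)))
      = ((M.elem j).polySpace k).starProjection (M.res j φ).1.1 :=
  (M.elem j).polyL2_l2Proj ((memLp_fn (φ : H1 Ω)).mono_measure
    (Measure.restrict_mono_set volume (M.subset j))) k

lemma polyL2_l2Proj_wd (j : M.ι) (i : Fin 2) (φ : M.Φ₀ k) :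
    (M.elem j).polyL2 ((M.elem j).l2Proj (k - 1) (wd i (φ : H1 Ω)))
      = ((M.elem j).polySpace (k - 1)).starProjection (comp i (M.res j φ).1.2) := by
  have hm : MemLp (wd i (φ : H1 Ω)) 2 (volume.restrict ((M.elem j).dom : Set Plane)) :=
    (memLp_wd i (φ : H1 Ω)).mono_measure (Measure.restrict_mono_set volume (M.subset j))
  rw [(M.elem j).polyL2_l2Proj hm]
  congr 1

/-- `φ ↦ Π^{0,E}_k φ` as a linear map. -/
def projL (j : M.ι) : M.Φ₀ k →ₗ[ℝ] Poly where
  toFun φ := (M.elem j).l2Proj k (fn (φ : H1 Ω))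
  map_add' φ ξ := by
    refine (M.elem j).polyL2_injective ?_
    rw [map_add, polyL2_l2Proj_fn, polyL2_l2Proj_fn, polyL2_l2Proj_fn, ← map_add,
      Submodule.coe_add, map_add]
    rfl
  map_smul' c φ := by
    refine (M.elem j).polyL2_injective ?_
    rw [map_smul, polyL2_l2Proj_fn, polyL2_l2Proj_fn, RingHom.id_apply, ← map_smul,
      Submodule.coe_smul, map_smul]
    rfl

/-- `φ ↦ Π^{0,E}_{k-1} ∂ᵢφ` as a linear map. -/
def projdL (j : M.ι) (i : Fin 2) : M.Φ₀ k →ₗ[ℝ] Poly where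
  toFun φ := (M.elem j).l2Proj (k - 1) (wd i (φ : H1 Ω))
  map_add' φ ξ := by
    refine (M.elem j).polyL2_injective ?_
    rw [map_add, polyL2_l2Proj_wd, polyL2_l2Proj_wd, polyL2_l2Proj_wd, ← map_add, ← map_add,
      Submodule.coe_add, map_add]
    rfl
  map_smul' c φ := by
    refine (M.elem j).polyL2_injective ?_
    rw [map_smul, polyL2_l2Proj_wd, polyL2_l2Proj_wd, RingHom.id_apply, ← map_smul, ← map_smul,
      Submodule.coe_smul, map_smul]
    rfl

lemma norm_polyL2_projL_le (j : M.ι) (φ : M.Φ₀ k) :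
    ‖(M.elem j).polyL2 (projL j φ)‖ ≤ ‖restrictL2 (M.subset j) ℝ (φ : H1 Ω).1.1‖ := by
  refine le_trans (le_of_eq (congrArg norm (polyL2_l2Proj_fn j φ))) ?_
  exact Submodule.norm_starProjection_apply_le _ _

/-- Integration of polynomials over an element. -/
def intL (E : Polygon) : Poly →ₗ[ℝ] ℝ where
  toFun p := ∫ x in (E.dom : Set Plane), pfn p x
  map_add' p q := by
    rw [← integral_add ((E.memLp_of_continuous (Polygon.continuous_pfn p)).integrable (by norm_num))
      ((E.memLp_of_continuous (Polygon.continuous_pfn q)).integrable (by norm_num))]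
    simp only [Polygon.pfn_add]
  map_smul' c p := by
    rw [RingHom.id_apply, smul_eq_mul, ← integral_const_mul]
    simp only [Polygon.pfn_smul]

end Mesh

namespace Mesh

variable {Ω : Opens Plane} {M : Mesh Ω} {k : ℕ}

/-! ### The bilinear part of the form -/

lemma real_inner_eq_mul (a b : ℝ) : inner ℝ a b = a * b := mul_comm b a

lemma exists_linear_bound {V W : Type*} [NormedAddCommGroup V] [NormedSpace ℝ V]
    [FiniteDimensional ℝ V] [NormedAddCommGroup W] [NormedSpace ℝ W] (L : V →ₗ[ℝ] W) :
    ∃ C, 0 ≤ C ∧ ∀ x, ‖L x‖ ≤ C * ‖x‖ :=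
  ⟨‖L.toContinuousLinearMap‖, norm_nonneg _, L.toContinuousLinearMap.le_opNorm⟩

lemma exists_bilinear_bound {V : Type*} [NormedAddCommGroup V] [NormedSpace ℝ V]
    [FiniteDimensional ℝ V] (A : V →ₗ[ℝ] V →ₗ[ℝ] ℝ) :
    ∃ C, 0 ≤ C ∧ ∀ x y, |A x y| ≤ C * ‖x‖ * ‖y‖ := by
  let A' : V →L[ℝ] V →L[ℝ] ℝ := LinearMap.toContinuousLinearMap
    ((LinearMap.toContinuousLinearMap : (V →ₗ[ℝ] ℝ) ≃ₗ[ℝ] (V →L[ℝ] ℝ)).toLinearMap ∘ₗ A)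
  exact ⟨‖A'‖, A'.opNorm_nonneg, fun x y => A'.le_opNorm₂ x y⟩

lemma projL_sub (j : M.ι) (φ ψ : M.Φ₀ k) : projL j (φ - ψ) = projL j φ - projL j ψ :=
  LinearMap.map_sub (projL j) φ ψ

/-- Written through linear maps into polynomials, the form shows its bilinearity. -/
lemma aForm_eq (ε : ℝ) (S : ∀ j, LinearMap.BilinForm ℝ ((M.elem j).Vloc k)) (j : M.ι)
    (φ ξ : M.Φ₀ k) : aForm ε S j φ ξ = ε * intL (M.elem j) (∑ i, projdL j i φ * projdL j i ξ)
      + ε * S j ((M.elem j).subProjL k (locL j φ)) ((M.elem j).subProjL k (locL j ξ)) := by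
  have h : ε * intL (M.elem j) (∑ i, projdL j i φ * projdL j i ξ)
      = ∫ x in ((M.elem j).dom : Set Plane), ε * ∑ i, P0d j i φ x * P0d j i ξ x := by
    rw [integral_const_mul]
    congr 1
    refine integral_congr_ae (Filter.Eventually.of_forall fun x => ?_)
    simp only [Fin.sum_univ_two, Polygon.pfn_add, Polygon.pfn_mul]
    rfl
  rw [h]
  rfl

lemma cForm_eq (u : Fin 2 → M.Φ₀ k) (j : M.ι) (φ ξ : M.Φ₀ k) :
    cForm u j φ ξ = intL (M.elem j) ((∑ i, projL j (u i) * projdL j i φ) * projL j ξ) := by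
  refine integral_congr_ae (Filter.Eventually.of_forall fun x => ?_)
  simp only [Fin.sum_univ_two, Polygon.pfn_add, Polygon.pfn_mul]
  rfl

/-- The bilinear part of `B_h(u; ·, ·)`. -/
def linB (ε : ℝ) (S : ∀ j, LinearMap.BilinForm ℝ ((M.elem j).Vloc k)) (u : Fin 2 → M.Φ₀ k) :
    M.Φ₀ k →ₗ[ℝ] M.Φ₀ k →ₗ[ℝ] ℝ :=
  LinearMap.mk₂ ℝ (fun φ ξ => ∑ j, (aForm ε S j φ ξ + cSkew u j φ ξ))
    (fun φ φ' ξ => by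
      rw [← Finset.sum_add_distrib]
      refine Finset.sum_congr rfl fun j _ => ?_
      simp only [cSkew, aForm_eq, cForm_eq, Fin.sum_univ_two, map_add, LinearMap.add_apply,
        add_mul, mul_add]
      ring)
    (fun c φ ξ => by
      rw [smul_eq_mul, Finset.mul_sum]
      refine Finset.sum_congr rfl fun j _ => ?_
      simp only [cSkew, aForm_eq, cForm_eq, Fin.sum_univ_two, map_smul, map_add,
        LinearMap.smul_apply, add_mul, mul_add, smul_mul_assoc, mul_smul_comm, smul_eq_mul]
      ring)
    (fun φ ξ ξ' => by
      rw [← Finset.sum_add_distrib]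
      refine Finset.sum_congr rfl fun j _ => ?_
      simp only [cSkew, aForm_eq, cForm_eq, Fin.sum_univ_two, map_add, add_mul, mul_add]
      ring)
    (fun c φ ξ => by
      rw [smul_eq_mul, Finset.mul_sum]
      refine Finset.sum_congr rfl fun j _ => ?_
      simp only [cSkew, aForm_eq, cForm_eq, Fin.sum_univ_two, map_smul, map_add, add_mul,
        mul_add, smul_mul_assoc, mul_smul_comm, smul_eq_mul]
      ring)

lemma linB_apply (ε : ℝ) (S : ∀ j, LinearMap.BilinForm ℝ ((M.elem j).Vloc k))
    (u : Fin 2 → M.Φ₀ k) (φ ξ : M.Φ₀ k) :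
    linB ε S u φ ξ = ∑ j, (aForm ε S j φ ξ + cSkew u j φ ξ) := rfl

attribute [irreducible] linB

lemma linB_sub (ε : ℝ) (S : ∀ j, LinearMap.BilinForm ℝ ((M.elem j).Vloc k))
    (u : Fin 2 → M.Φ₀ k) (φ ψ ξ : M.Φ₀ k) :
    linB ε S u (φ - ψ) ξ = linB ε S u φ ξ - linB ε S u ψ ξ :=
  LinearMap.map_sub ((linB ε S u).flip ξ) φ ψ

lemma norm_sq_polyL2 (E : Polygon) (p : Poly) : ‖E.polyL2 p‖ ^ 2 = intL E (p * p) := by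
  rw [L2_norm_sq]
  refine integral_congr_ae ?_
  filter_upwards [E.coeFn_polyL2 p] with x hx
  rw [hx, Real.norm_eq_abs, sq_abs, Polygon.pfn_mul, sq]

lemma comp_polyH1 (E : Polygon) (p : Poly) (i : Fin 2) :
    comp i (E.polyH1 p).1.2 = E.polyL2 (MvPolynomial.pderiv i p) := by
  refine Lp.ext ?_
  filter_upwards [coeFn_comp i (E.polyH1 p).1.2, E.wd_polyH1 p i,
    E.coeFn_polyL2 (MvPolynomial.pderiv i p)] with x h1 h2 h3
  rw [h1, h3]
  exact h2

/-- Coercivity of the local diffusion form. -/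
lemma le_aForm {ε lo hi : ℝ} (hε : 0 < ε) (hlo : 0 < lo)
    {S : ∀ j, LinearMap.BilinForm ℝ ((M.elem j).Vloc k)}
    (hS : ∀ j, (M.elem j).IsStabilization k lo hi (S j)) (j : M.ι) (φ : M.Φ₀ k) :
    ε * min 1 lo * ‖restrictL2 (M.subset j) Plane (φ : H1 Ω).1.2‖ ^ 2 ≤ aForm ε S j φ φ := by
  set E := M.elem j with hE
  set G : L2 E.dom Plane := restrictL2 (M.subset j) Plane (φ : H1 Ω).1.2 with hG
  set r : E.Vloc k := E.subProj k (loc φ j) with hr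
  set p : Poly := E.energyProj k (loc φ j) with hp
  have hr2 : (r : H1 E.dom).1.2 = G - (E.polyH1 p).1.2 := rfl
  have hSr : lo * ‖(r : H1 E.dom).1.2‖ ^ 2 ≤ S j r r :=
    (hS j).lower r (E.energyProj_subProj k _)
  have hi : ∀ i, ‖comp i G‖ ^ 2
      ≤ intL E (projdL j i φ * projdL j i φ) + ‖comp i (r : H1 E.dom).1.2‖ ^ 2 := by
    intro i
    have e1 : E.polyL2 (projdL j i φ) = (E.polySpace (k - 1)).starProjection (comp i G) :=
      polyL2_l2Proj_wd j i φ
    -- The projection is the best approximation from `P_{k-1}`, and `∂ᵢ p` is a competitor whose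
    -- error is `∂ᵢ r`.
    have h1 : ‖comp i G - E.polyL2 (projdL j i φ)‖ ≤ ‖comp i (r : H1 E.dom).1.2‖ := by
      rw [e1, Submodule.starProjection_minimal]
      rw [hr2, map_sub, comp_polyH1]
      refine ciInf_le (f := fun x : E.polySpace (k - 1) => ‖comp i G - x‖)
        ⟨0, Set.forall_mem_range.2 fun _ => norm_nonneg _⟩
        ⟨E.polyL2 (MvPolynomial.pderiv i p), ?_⟩
      exact Submodule.mem_map_of_mem (Polygon.pderiv_mem_pred (E.energyProj_mem k _) i)
    -- Pythagoras for the orthogonal projection.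
    have h2 : ‖comp i G‖ ^ 2
        = ‖E.polyL2 (projdL j i φ)‖ ^ 2 + ‖comp i G - E.polyL2 (projdL j i φ)‖ ^ 2 := by
      have h3 := norm_add_sq_eq_norm_sq_add_norm_sq_of_inner_eq_zero
        (comp i G - (E.polySpace (k - 1)).starProjection (comp i G))
        ((E.polySpace (k - 1)).starProjection (comp i G))
        (Submodule.starProjection_inner_eq_zero _ _ (Submodule.starProjection_apply_mem _ _))
      rw [sub_add_cancel] at h3
      rw [e1]
      nlinarith [h3]
    rw [h2, ← norm_sq_polyL2]
    gcongr
  have hsum : ‖G‖ ^ 2 ≤ intL E (∑ i, projdL j i φ * projdL j i φ)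
      + ‖(r : H1 E.dom).1.2‖ ^ 2 := by
    rw [norm_sq_eq_sum_comp, norm_sq_eq_sum_comp, map_sum, ← Finset.sum_add_distrib]
    exact Finset.sum_le_sum fun i _ => hi i
  have hI : 0 ≤ intL E (∑ i, projdL j i φ * projdL j i φ) := by
    rw [map_sum]
    exact Finset.sum_nonneg fun i _ => by rw [← norm_sq_polyL2]; positivity
  have hmin : 0 < min 1 lo := lt_min one_pos hlo
  have hfin : min 1 lo * ‖G‖ ^ 2
      ≤ intL E (∑ i, projdL j i φ * projdL j i φ) + S j r r := by
    calc min 1 lo * ‖G‖ ^ 2 ≤ min 1 lo * (intL E (∑ i, projdL j i φ * projdL j i φ)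
          + ‖(r : H1 E.dom).1.2‖ ^ 2) := by gcongr
      _ = min 1 lo * intL E (∑ i, projdL j i φ * projdL j i φ)
          + min 1 lo * ‖(r : H1 E.dom).1.2‖ ^ 2 := by ring
      _ ≤ 1 * intL E (∑ i, projdL j i φ * projdL j i φ) + lo * ‖(r : H1 E.dom).1.2‖ ^ 2 := by
          gcongr
          · exact min_le_left _ _
          · exact min_le_right _ _
      _ ≤ _ := by rw [one_mul]; gcongr
  rw [aForm_eq, ← mul_add, mul_assoc]
  exact mul_le_mul_of_nonneg_left hfin hε.le

/-- Coercivity of the bilinear part. -/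
lemma le_linB {ε lo hi : ℝ} (hε : 0 < ε) (hlo : 0 < lo)
    {S : ∀ j, LinearMap.BilinForm ℝ ((M.elem j).Vloc k)}
    (hS : ∀ j, (M.elem j).IsStabilization k lo hi (S j)) (u : Fin 2 → M.Φ₀ k) (φ : M.Φ₀ k) :
    ε * min 1 lo * gradNorm (φ : H1 Ω) ^ 2 ≤ linB ε S u φ φ := by
  rw [linB_apply, gradNorm, M.norm_sq_eq_sum, Finset.mul_sum]
  refine Finset.sum_le_sum fun j _ => ?_
  -- The skew form vanishes on the diagonal, whatever the velocity.
  rw [cSkew, sub_self, mul_zero, add_zero]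
  exact le_aForm hε hlo hS j φ

/-! ### The nonlinear part of the form -/

/-- `κ(Π^{0,E}_k φ)` in `L²(E)`. -/
def nl {κ : ℝ → ℝ} (hκ : Continuous κ) (j : M.ι) (φ : M.Φ₀ k) : L2 (M.elem j).dom ℝ :=
  ((M.elem j).memLp_of_continuous
    (hκ.comp (Polygon.continuous_pfn (projL j φ)))).toLp fun x => κ (pfn (projL j φ) x)

lemma coeFn_nl {κ : ℝ → ℝ} (hκ : Continuous κ) (j : M.ι) (φ : M.Φ₀ k) :
    nl hκ j φ =ᵐ[volume.restrict ((M.elem j).dom : Set Plane)]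
      fun x => κ (pfn (projL j φ) x) :=
  ((M.elem j).memLp_of_continuous
    (hκ.comp (Polygon.continuous_pfn (projL j φ)))).coeFn_toLp

lemma dForm_eq {κ : ℝ → ℝ} (hκ : Continuous κ) (j : M.ι) (φ ξ : M.Φ₀ k) :
    dForm κ j φ ξ = inner ℝ (nl hκ j φ) ((M.elem j).polyL2 (projL j ξ)) := by
  rw [L2.inner_def]
  refine integral_congr_ae ?_
  filter_upwards [coeFn_nl hκ j φ, (M.elem j).coeFn_polyL2 (projL j ξ)] with x h1 h2
  rw [h1, h2, real_inner_eq_mul]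
  rfl

/-- Since `Π⁰_k` is linear, the integrand is `(κ s - κ t) * (s - t)` with `s`, `t` the values of the
two projections. -/
lemma dForm_sub_nonneg {κ : ℝ → ℝ} (hκ : Continuous κ) (hmono : Monotone κ) (j : M.ι)
    (φ ψ : M.Φ₀ k) : 0 ≤ dForm κ j φ (φ - ψ) - dForm κ j ψ (φ - ψ) := by
  rw [dForm_eq hκ, dForm_eq hκ, ← inner_sub_left, L2.inner_def]
  refine integral_nonneg_of_ae ?_
  filter_upwards [coeFn_nl hκ j φ, coeFn_nl hκ j ψ, Lp.coeFn_sub (nl hκ j φ) (nl hκ j ψ),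
    (M.elem j).coeFn_polyL2 (projL j (φ - ψ))] with x h1 h2 h3 h4
  rw [h3, Pi.sub_apply, h1, h2, h4, projL_sub, Polygon.pfn_sub, real_inner_eq_mul]
  rcases le_total (pfn (projL j φ) x) (pfn (projL j ψ) x) with h | h
  · exact mul_nonneg_of_nonpos_of_nonpos (sub_nonpos.2 (hmono h)) (sub_nonpos.2 h)
  · exact mul_nonneg (sub_nonneg.2 (hmono h)) (sub_nonneg.2 h)

lemma dForm_self_nonneg {κ : ℝ → ℝ} (hmono : Monotone κ) (h0 : κ 0 = 0)
    (j : M.ι) (φ : M.Φ₀ k) : 0 ≤ dForm κ j φ φ := by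
  refine integral_nonneg fun x => ?_
  rcases le_total (P0 j φ x) 0 with hx | hx
  · exact mul_nonneg_of_nonpos_of_nonpos (h0 ▸ hmono hx) hx
  · exact mul_nonneg (h0 ▸ hmono hx) hx

lemma norm_projL_le (j : M.ι) (φ : M.Φ₀ k) : ‖(M.elem j).polyL2 (projL j φ)‖ ≤ ‖φ‖ := by
  refine (norm_polyL2_projL_le j φ).trans (le_trans ?_ (norm_fst_le (φ : H1 Ω).1))
  have h := M.norm_sq_eq_sum (φ : H1 Ω).1.1
  refine le_of_sq_le_sq ?_ (norm_nonneg _)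
  rw [h]
  exact Finset.single_le_sum (f := fun j => ‖restrictL2 (M.subset j) ℝ (φ : H1 Ω).1.1‖ ^ 2)
    (fun _ _ => sq_nonneg _) (Finset.mem_univ j)

lemma abs_dForm_sub_le {κ : ℝ → ℝ} {K : NNReal} (hκ : LipschitzWith K κ) (j : M.ι)
    (φ ψ ξ : M.Φ₀ k) : |dForm κ j φ ξ - dForm κ j ψ ξ| ≤ K * ‖φ - ψ‖ * ‖ξ‖ := by
  rw [dForm_eq hκ.continuous, dForm_eq hκ.continuous, ← inner_sub_left]
  refine (abs_real_inner_le_norm _ _).trans ?_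
  have h1 : ‖nl hκ.continuous j φ - nl hκ.continuous j ψ‖
      ≤ K * ‖(M.elem j).polyL2 (projL j (φ - ψ))‖ := by
    refine Lp.norm_le_mul_norm_of_ae_le_mul ?_
    filter_upwards [coeFn_nl hκ.continuous j φ, coeFn_nl hκ.continuous j ψ,
      Lp.coeFn_sub (nl hκ.continuous j φ) (nl hκ.continuous j ψ),
      (M.elem j).coeFn_polyL2 (projL j (φ - ψ))] with x h1 h2 h3 h4
    rw [h3, Pi.sub_apply, h1, h2, h4, projL_sub, Polygon.pfn_sub]
    exact hκ.norm_sub_le _ _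
  gcongr
  · exact h1.trans (by gcongr; exact norm_projL_le j _)
  · exact norm_projL_le j ξ

/-- `B_h(u; φ, ·)` as a linear functional. -/
def bL (ε : ℝ) {κ : ℝ → ℝ} (hκ : Continuous κ)
    (S : ∀ j, LinearMap.BilinForm ℝ ((M.elem j).Vloc k)) (u : Fin 2 → M.Φ₀ k) (φ : M.Φ₀ k) :
    M.Φ₀ k →ₗ[ℝ] ℝ :=
  linB ε S u φ + ∑ j, (innerₛₗ ℝ (nl hκ j φ)) ∘ₗ (M.elem j).polyL2 ∘ₗ projL j

lemma bL_apply (ε : ℝ) {κ : ℝ → ℝ} (hκ : Continuous κ)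
    (S : ∀ j, LinearMap.BilinForm ℝ ((M.elem j).Vloc k)) (u : Fin 2 → M.Φ₀ k) (φ ξ : M.Φ₀ k) :
    bL ε hκ S u φ ξ = linB ε S u φ ξ + ∑ j, dForm κ j φ ξ := by
  simp only [bL, LinearMap.add_apply, LinearMap.sum_apply, dForm_eq hκ]
  rfl

lemma bForm_eq (ε : ℝ) (κ : ℝ → ℝ)
    (S : ∀ j, LinearMap.BilinForm ℝ ((M.elem j).Vloc k)) (u : Fin 2 → M.Φ₀ k) (φ ξ : M.Φ₀ k) :
    bForm ε κ S u φ ξ = linB ε S u φ ξ + ∑ j, dForm κ j φ ξ := by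
  rw [bForm, linB_apply, ← Finset.sum_add_distrib]

/-- The load as a linear functional. -/
def loadL (g : L2 Ω ℝ) : M.Φ₀ k →ₗ[ℝ] ℝ :=
  ∑ j, (innerₛₗ ℝ (restrictL2 (M.subset j) ℝ g)) ∘ₗ (M.elem j).polyL2 ∘ₗ projL j

lemma load_eq (g : L2 Ω ℝ) (ξ : M.Φ₀ k) : load g ξ
    = ∑ j, inner ℝ (restrictL2 (M.subset j) ℝ g) ((M.elem j).polyL2 (projL j ξ)) := by
  refine Finset.sum_congr rfl fun j _ => ?_
  rw [L2.inner_def]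
  refine integral_congr_ae ?_
  filter_upwards [coeFn_restrictL2 (M.subset j) g,
    (M.elem j).coeFn_polyL2 (projL j ξ)] with x h1 h2
  rw [h1, h2, real_inner_eq_mul]
  rfl

lemma loadL_apply (g : L2 Ω ℝ) (ξ : M.Φ₀ k) : loadL g ξ = load g ξ := by
  rw [load_eq, loadL, LinearMap.sum_apply]
  rfl

/-- Cauchy-Schwarz on each element and then over the elements; the local projections do not increase
the `L²` norm. -/
lemma load_le (g : L2 Ω ℝ) (ξ : M.Φ₀ k) : load g ξ ≤ ‖g‖ * l2norm (ξ : H1 Ω) := by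
  rw [load_eq]
  calc _ ≤ ∑ j, ‖restrictL2 (M.subset j) ℝ g‖ * ‖restrictL2 (M.subset j) ℝ (ξ : H1 Ω).1.1‖ := by
        refine Finset.sum_le_sum fun j _ => (real_inner_le_norm _ _).trans ?_
        gcongr
        exact norm_polyL2_projL_le j ξ
    _ ≤ ‖g‖ * l2norm (ξ : H1 Ω) := by
        refine le_of_sq_le_sq ?_ (mul_nonneg (norm_nonneg _) (norm_nonneg _))
        rw [mul_pow, l2norm, M.norm_sq_eq_sum g, M.norm_sq_eq_sum (ξ : H1 Ω).1.1]
        exact Finset.sum_mul_sq_le_sq_mul_sq _ _ _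

attribute [irreducible] bL loadL

/-! ### The a priori bound and the solution of the discrete problem -/

/-- The equation is tested with `ψ` and the nonnegative reaction term is dropped. The bound depends
on `κ` in no other way, so it is uniform over truncations. -/
lemma gradNorm_le_of_isDiscreteSolution {ε lo hi : ℝ} (hε : 0 < ε) (hlo : 0 < lo)
    {S : ∀ j, LinearMap.BilinForm ℝ ((M.elem j).Vloc k)}
    (hS : ∀ j, (M.elem j).IsStabilization k lo hi (S j)) {κ : ℝ → ℝ}
    (hmono : Monotone κ) (h0 : κ 0 = 0) {g : L2 Ω ℝ} {u : Fin 2 → M.Φ₀ k} {ψ : M.Φ₀ k}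
    (hψ : IsDiscreteSolution ε κ S g u ψ) :
    gradNorm (ψ : H1 Ω) ≤ poincareConst Ω / (ε * min 1 lo) * ‖g‖ := by
  have hmin : 0 < min 1 lo := lt_min one_pos hlo
  have h1 := le_linB hε hlo hS u ψ
  have h2 := hψ ψ
  rw [bForm_eq] at h2
  have h3 : 0 ≤ ∑ j, dForm κ j ψ ψ :=
    Finset.sum_nonneg fun j _ => dForm_self_nonneg hmono h0 j ψ
  have h4 := load_le g ψ
  have h5 := l2norm_le_poincareConst M.isBounded ψ.2.1
  have hn : 0 ≤ gradNorm (ψ : H1 Ω) := norm_nonneg _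
  have h6 : ε * min 1 lo * gradNorm (ψ : H1 Ω) * gradNorm (ψ : H1 Ω)
      ≤ poincareConst Ω * ‖g‖ * gradNorm (ψ : H1 Ω) := by
    have h7 := mul_le_mul_of_nonneg_left h5 (norm_nonneg g)
    nlinarith
  rw [div_mul_eq_mul_div, le_div_iff₀ (by positivity), mul_comm]
  -- One factor of the gradient norm is cancelled, which needs it to be nonzero.
  rcases hn.eq_or_lt with h | h
  · rw [← h, mul_zero]
    exact mul_nonneg (poincareConst_nonneg Ω) (norm_nonneg g)
  · exact le_of_mul_le_mul_right h6 h

/-- The norm of `Φ₀` is the maximum of the two `L²` norms; the summand `1` takes care of the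
gradient. -/
lemma norm_le_gradNorm (φ : M.Φ₀ k) :
    ‖φ‖ ≤ (poincareConst Ω + 1) * gradNorm (φ : H1 Ω) := by
  have h := l2norm_le_poincareConst M.isBounded φ.2.1
  have hn : 0 ≤ gradNorm (φ : H1 Ω) := norm_nonneg _
  have h0 := mul_nonneg (poincareConst_nonneg Ω) hn
  refine max_le ?_ ?_
  · refine le_trans h ?_
    linarith
  · show gradNorm (φ : H1 Ω) ≤ _
    linarith

lemma stronglyMonotone {ε lo hi : ℝ} (hε : 0 < ε) (hlo : 0 < lo)
    {S : ∀ j, LinearMap.BilinForm ℝ ((M.elem j).Vloc k)}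
    (hS : ∀ j, (M.elem j).IsStabilization k lo hi (S j)) {κ : ℝ → ℝ} (hκ : Continuous κ)
    (hmono : Monotone κ) (u : Fin 2 → M.Φ₀ k) (φ ψ : M.Φ₀ k) :
    ε * min 1 lo / (poincareConst Ω + 1) ^ 2 * ‖φ - ψ‖ ^ 2
      ≤ bL ε hκ S u φ (φ - ψ) - bL ε hκ S u ψ (φ - ψ) := by
  have hmin : 0 < min 1 lo := lt_min one_pos hlo
  have hP := poincareConst_nonneg Ω
  have h1 := le_linB hε hlo hS u (φ - ψ)
  rw [linB_sub] at h1
  have h2 : 0 ≤ ∑ j, (dForm κ j φ (φ - ψ) - dForm κ j ψ (φ - ψ)) :=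
    Finset.sum_nonneg fun j _ => dForm_sub_nonneg hκ hmono j φ ψ
  rw [Finset.sum_sub_distrib] at h2
  have h3 : ‖φ - ψ‖ ^ 2 ≤ (poincareConst Ω + 1) ^ 2 * gradNorm ((φ - ψ : M.Φ₀ k) : H1 Ω) ^ 2 := by
    rw [← mul_pow]
    exact pow_le_pow_left₀ (a := ‖φ - ψ‖) (norm_nonneg (φ - ψ)) (norm_le_gradNorm (φ - ψ)) 2
  have h4 : ε * min 1 lo / (poincareConst Ω + 1) ^ 2 * ‖φ - ψ‖ ^ 2
      ≤ ε * min 1 lo * gradNorm ((φ - ψ : M.Φ₀ k) : H1 Ω) ^ 2 := by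
    rw [div_mul_eq_mul_div, div_le_iff₀ (by positivity), mul_assoc]
    have := mul_le_mul_of_nonneg_left h3 (mul_pos hε hmin).le
    linarith
  rw [bL_apply, bL_apply]
  linarith

lemma exists_abs_linB_le (ε : ℝ) (S : ∀ j, LinearMap.BilinForm ℝ ((M.elem j).Vloc k))
    (u : Fin 2 → M.Φ₀ k) : ∃ C, ∀ φ ξ : M.Φ₀ k, |linB ε S u φ ξ| ≤ C * ‖φ‖ * ‖ξ‖ := by
  obtain ⟨C, -, h⟩ := exists_bilinear_bound (V := M.Φ₀ k) (linB ε S u)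
  exact ⟨C, h⟩

lemma exists_abs_bL_sub_le (ε : ℝ) {κ : ℝ → ℝ} {K : NNReal} (hκ : LipschitzWith K κ)
    (S : ∀ j, LinearMap.BilinForm ℝ ((M.elem j).Vloc k)) (u : Fin 2 → M.Φ₀ k) :
    ∃ L : ℝ, ∀ φ ψ ξ : M.Φ₀ k,
      |bL ε hκ.continuous S u φ ξ - bL ε hκ.continuous S u ψ ξ| ≤ L * ‖φ - ψ‖ * ‖ξ‖ := by
  obtain ⟨C, hA⟩ := exists_abs_linB_le ε S u
  refine ⟨C + ∑ _j : M.ι, (K : ℝ), fun φ ψ ξ => ?_⟩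
  have e : bL ε hκ.continuous S u φ ξ - bL ε hκ.continuous S u ψ ξ
      = linB ε S u (φ - ψ) ξ + ∑ j, (dForm κ j φ ξ - dForm κ j ψ ξ) := by
    rw [bL_apply, bL_apply, linB_sub, Finset.sum_sub_distrib]
    ring
  have h1 : |∑ j, (dForm κ j φ ξ - dForm κ j ψ ξ)| ≤ ∑ _j : M.ι, (K * ‖φ - ψ‖ * ‖ξ‖) :=
    (Finset.abs_sum_le_sum_abs _ _).trans
      (Finset.sum_le_sum fun j _ => abs_dForm_sub_le hκ j φ ψ ξ)
  have h2 := hA (φ - ψ) ξ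
  have h3 : (C + ∑ _j : M.ι, (K : ℝ)) * ‖φ - ψ‖ * ‖ξ‖
      = C * ‖φ - ψ‖ * ‖ξ‖ + ∑ _j : M.ι, (K * ‖φ - ψ‖ * ‖ξ‖) := by
    rw [Finset.sum_const, Finset.sum_const, nsmul_eq_mul, nsmul_eq_mul]
    ring
  rw [e, h3]
  exact (abs_add_le _ _).trans (add_le_add h2 h1)

lemma exists_isDiscreteSolution_of_lipschitz {ε lo hi : ℝ} (hε : 0 < ε) (hlo : 0 < lo)
    {S : ∀ j, LinearMap.BilinForm ℝ ((M.elem j).Vloc k)}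
    (hS : ∀ j, (M.elem j).IsStabilization k lo hi (S j)) {κ : ℝ → ℝ} {K : NNReal}
    (hκ : LipschitzWith K κ) (hmono : Monotone κ) (g : L2 Ω ℝ) (u : Fin 2 → M.Φ₀ k) :
    ∃ ψ : M.Φ₀ k, IsDiscreteSolution ε κ S g u ψ := by
  have hmin : 0 < min 1 lo := lt_min one_pos hlo
  have hP := poincareConst_nonneg Ω
  have hm : 0 < ε * min 1 lo / (poincareConst Ω + 1) ^ 2 := by positivity
  obtain ⟨L, hL⟩ := exists_abs_bL_sub_le ε hκ S u
  obtain ⟨ψ, hψ⟩ := exists_forall_eq_of_stronglyMonotone (V := M.Φ₀ k) hm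
    (stronglyMonotone hε hlo hS hκ.continuous hmono u) hL (loadL g)
  refine ⟨ψ, fun ξ => ?_⟩
  rw [bForm_eq, ← bL_apply ε hκ.continuous, hψ, loadL_apply]

lemma isDiscreteSolution_unique {ε lo hi : ℝ} (hε : 0 < ε) (hlo : 0 < lo)
    {S : ∀ j, LinearMap.BilinForm ℝ ((M.elem j).Vloc k)}
    (hS : ∀ j, (M.elem j).IsStabilization k lo hi (S j)) {κ : ℝ → ℝ} (hκ : Continuous κ)
    (hmono : Monotone κ) {g : L2 Ω ℝ} {u : Fin 2 → M.Φ₀ k} {φ ψ : M.Φ₀ k}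
    (hφ : IsDiscreteSolution ε κ S g u φ) (hψ : IsDiscreteSolution ε κ S g u ψ) : φ = ψ := by
  have hmin : 0 < min 1 lo := lt_min one_pos hlo
  have hP := poincareConst_nonneg Ω
  have h := stronglyMonotone hε hlo hS hκ hmono u φ ψ
  rw [bL_apply, bL_apply, ← bForm_eq, ← bForm_eq, hφ, hψ, sub_self] at h
  have hm : 0 < ε * min 1 lo / (poincareConst Ω + 1) ^ 2 := by positivity
  have h2 : ‖φ - ψ‖ ^ 2 ≤ 0 := by
    by_contra! hlt
    exact absurd h (not_le.2 (mul_pos hm hlt))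
  have h3 : ‖φ - ψ‖ = 0 := by
    have := sq_nonneg ‖φ - ψ‖
    exact pow_eq_zero_iff (two_ne_zero) |>.1 (le_antisymm h2 this)
  exact sub_eq_zero.1 (norm_eq_zero.1 h3)

/-! ### Truncation of the nonlinearity -/

/-- In a bounded set of discrete functions the local projections are uniformly bounded. -/
lemma exists_P0_le (R : ℝ) :
    ∃ T, 0 ≤ T ∧ ∀ φ : M.Φ₀ k, ‖φ‖ ≤ R → ∀ j, ∀ x ∈ (M.elem j).dom, |P0 j φ x| ≤ T := by
  have h : ∀ j : M.ι, ∃ C, 0 ≤ C ∧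
      ∀ φ : M.Φ₀ k, ∀ x ∈ (M.elem j).dom, |P0 j φ x| ≤ C * ‖φ‖ := by
    intro j
    have : CompactSpace (closure ((M.elem j).dom : Set Plane)) :=
      isCompact_iff_compactSpace.1 (M.elem j).bounded.isCompact_closure
    -- A linear map from a finite-dimensional space into the continuous functions with the sup norm
    -- is bounded.
    let L : M.Φ₀ k →ₗ[ℝ] C(closure ((M.elem j).dom : Set Plane), ℝ) :=
      { toFun := fun φ => ⟨fun x => pfn (projL j φ) x,
          (Polygon.continuous_pfn _).comp continuous_subtype_val⟩
        map_add' := fun φ ξ => by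
          ext x
          simp [Polygon.pfn_add]
        map_smul' := fun c φ => by
          ext x
          simp [Polygon.pfn_smul] }
    obtain ⟨C, hC0, hC⟩ := exists_linear_bound (V := M.Φ₀ k) L
    exact ⟨C, hC0, fun φ x hx =>
      ((L φ).norm_coe_le_norm ⟨x, subset_closure hx⟩).trans (hC φ)⟩
  choose C hC0 hC using h
  refine ⟨(∑ j, C j) * |R|, mul_nonneg (Finset.sum_nonneg fun j _ => hC0 j) (abs_nonneg R),
    fun φ hφ j x hx => (hC j φ x hx).trans ?_⟩
  gcongr
  · exact Finset.sum_nonneg fun j _ => hC0 j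
  · exact Finset.single_le_sum (f := C) (fun j _ => hC0 j) (Finset.mem_univ j)
  · exact hφ.trans (le_abs_self R)

lemma monotone_kappa {α₀ α₁ : ℝ} (h₀ : 0 < α₀) (h₁ : 0 < α₁) : Monotone (kappa α₀ α₁) :=
  fun _ _ h => mul_le_mul_of_nonneg_left
    (Real.sinh_le_sinh.2 (mul_le_mul_of_nonneg_left h h₁.le)) h₀.le

/-- A function frozen outside of `[-T, T]`. -/
def freeze (κ : ℝ → ℝ) (T t : ℝ) : ℝ := κ (max (-T) (min t T))

lemma exists_lipschitzWith_freeze {κ : ℝ → ℝ} (hκ : ContDiff ℝ 1 κ) {T : ℝ} (hT : 0 ≤ T) :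
    ∃ K, LipschitzWith K (freeze κ T) := by
  obtain ⟨C, hC⟩ := (isCompact_Icc (a := -T) (b := T)).exists_bound_of_continuousOn
    (hκ.continuous_deriv le_rfl).continuousOn
  have h1 : LipschitzOnWith C.toNNReal κ (Set.Icc (-T) T) := by
    refine (convex_Icc (-T) T).lipschitzOnWith_of_nnnorm_deriv_le
      (fun x _ => hκ.differentiable (by norm_num) x) fun x hx => ?_
    rw [← NNReal.coe_le_coe, coe_nnnorm]
    exact (hC x hx).trans (Real.le_coe_toNNReal C)
  have h2 : LipschitzWith 1 fun t : ℝ => max (-T) (min t T) :=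
    (LipschitzWith.id.min_const T).const_max (-T)
  refine ⟨C.toNNReal * 1, ?_⟩
  rw [← lipschitzOnWith_univ]
  refine h1.comp h2.lipschitzOnWith fun t _ => ?_
  exact ⟨le_max_left _ _, max_le (by linarith) (min_le_right _ _)⟩

lemma monotone_freeze {κ : ℝ → ℝ} (hκ : Monotone κ) (T : ℝ) : Monotone (freeze κ T) :=
  fun _ _ h => hκ (max_le_max le_rfl (min_le_min h le_rfl))

lemma freeze_eq {κ : ℝ → ℝ} {T t : ℝ} (h : |t| ≤ T) : freeze κ T t = κ t := by
  obtain ⟨h1, h2⟩ := abs_le.1 h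
  rw [freeze, min_eq_left h2, max_eq_right h1]

/-- The level `T` comes from the a priori bound, which is known before truncating. The solution of
the frozen problem obeys that bound, so its projections stay in `[-T, T]`, where the frozen and the
original nonlinearity agree. -/
lemma exists_isDiscreteSolution {ε lo hi : ℝ} (hε : 0 < ε) (hlo : 0 < lo)
    {S : ∀ j, LinearMap.BilinForm ℝ ((M.elem j).Vloc k)}
    (hS : ∀ j, (M.elem j).IsStabilization k lo hi (S j)) {κ : ℝ → ℝ} (hκ : ContDiff ℝ 1 κ)
    (hmono : Monotone κ) (h0 : κ 0 = 0) (g : L2 Ω ℝ) (u : Fin 2 → M.Φ₀ k) :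
    ∃ ψ : M.Φ₀ k, IsDiscreteSolution ε κ S g u ψ := by
  have hP := poincareConst_nonneg Ω
  obtain ⟨T, hT0, hT⟩ := exists_P0_le (M := M) (k := k)
    ((poincareConst Ω + 1) * (poincareConst Ω / (ε * min 1 lo) * ‖g‖))
  obtain ⟨K, hK⟩ := exists_lipschitzWith_freeze hκ hT0
  obtain ⟨ψ, hψ⟩ := exists_isDiscreteSolution_of_lipschitz hε hlo hS hK
    (monotone_freeze hmono T) g u
  have h1 := gradNorm_le_of_isDiscreteSolution hε hlo hS (monotone_freeze hmono T)
    -- Because `0 ≤ T`, freezing keeps the value at `0`.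
    (by rw [freeze_eq (by simpa using hT0), h0]) hψ
  have h2 := hT ψ ((norm_le_gradNorm ψ).trans (by gcongr))
  refine ⟨ψ, fun ξ => ?_⟩
  rw [← hψ ξ, bForm_eq, bForm_eq]
  congr 1
  refine Finset.sum_congr rfl fun j _ => ?_
  refine setIntegral_congr_fun (M.elem j).dom.isOpen.measurableSet fun x hx => ?_
  simp only [freeze_eq (h2 j x hx)]

end Mesh

end VEM

end

theorem mainTheorem7
    {Ω : TopologicalSpace.Opens VEM.Plane} (M : VEM.Mesh Ω)
    (k : ℕ) (hk : 1 ≤ k)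
    (ε α₀ α₁ : ℝ) (hε : 0 < ε) (hα₀ : 0 < α₀) (hα₁ : 0 < α₁)
    (lo hi : ℝ) (hlo : 0 < lo) (hlohi : lo ≤ hi)
    (S : ∀ j, LinearMap.BilinForm ℝ ((M.elem j).Vloc k))
    (hS : ∀ j, (M.elem j).IsStabilization k lo hi (S j))
    (g : VEM.L2 Ω ℝ) (u : Fin 2 → M.Φ₀ k) :
    (∃! ψ : M.Φ₀ k, VEM.Mesh.IsDiscreteSolution ε (VEM.kappa α₀ α₁) S g u ψ) ∧
    ∀ ψ : M.Φ₀ k, VEM.Mesh.IsDiscreteSolution ε (VEM.kappa α₀ α₁) S g u ψ →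
      VEM.gradNorm (ψ : VEM.H1 Ω) ≤ VEM.poincareConst Ω / (ε * min 1 lo) * ‖g‖ := by
  have hc : ContDiff ℝ 1 (VEM.kappa α₀ α₁) :=
    contDiff_const.mul (Real.contDiff_sinh.comp (contDiff_const.mul contDiff_id))
  have hm := VEM.Mesh.monotone_kappa hα₀ hα₁
  have h0 : VEM.kappa α₀ α₁ 0 = 0 := by simp [VEM.kappa]
  obtain ⟨ψ, hψ⟩ := VEM.Mesh.exists_isDiscreteSolution hε hlo hS hc hm h0 g u
  exact ⟨⟨ψ, hψ, fun φ hφ => VEM.Mesh.isDiscreteSolution_unique hε hlo hS hc.continuous hm hφ hψ⟩,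
    fun φ hφ => VEM.Mesh.gradNorm_le_of_isDiscreteSolution hε hlo hS hm h0 hφ⟩
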